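/- Let \(K\) be a field, \(t\) transcendental over \(K\), \(\Omega\) a separable closure of \(K(t)\), and \(\bar K\) the algebraic closure of \(K\) in \(\Omega\) (a separable closure of \(K\)). Let \(f\in K(x)\) be a nonconstant rational function which is tamely ramified, i.e. no ramification index of \(f:\mathbb P^1\to\mathbb P^1\) at a geometric point is divisible by the characteristic of \(K\). For a point \(y\), let \(f^{-n}(y)\) be the set of preimages of \(y\) under the \(n\)-th iterate of \(f\), and \(f^{-\infty}(y)=\bigcup_{n\ge 0} f^{-n}(y)\). (When adjoining such sets to a field, a point \(\infty\) is ignored.) Let \(G=\operatorname{Gal}(K(f^{-\infty}(t))/K(t))\) be the arithmetic and \(\bar G=\operatorname{Gal}(\bar K(f^{-\infty}(t))/\bar K(t))\) the geometric profinite iterated monodromy group of \(f\), with their Krull topologies, and let \(\widehat K_f\) be the algebraic closure of \(K\) in \(K(f^{-\infty}(t))\). Call \(a\in\bar K\) post-critical if \(a=f^n(c)\) for some geometric critical point \(c\) of \(f\) and some \(n\ge 1\). For a field \(K\subseteq L\subseteq\bar K\) and \(a\in L\) not post-critical, let \(\alpha\) be a maximal ideal containing \(t-a\) of the integral closure of \(L[t]\)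 in \(L(f^{-\infty}(t))\), and let \(D_\alpha\subseteq\operatorname{Gal}(L(f^{-\infty}(t))/L(t))\) be its decomposition group (the stabilizer of \(\alpha\)). The group \(\operatorname{Gal}(L(f^{-\infty}(a))/L)\) is identified with \(D_\alpha\) and, by restriction to \(K(f^{-\infty}(t))\), with a subgroup of \(G\), called a specialization at \(t=a\) over \(L\). The specialization is surjective if this subgroup is all of \(G\); this does not depend on \(\alpha\). Theorem. Suppose that the Frattini subgroup of \(\bar G\) (the intersection of its maximal open subgroups) is open in \(\bar G\). Then there is an integer \(m\ge 0\) such that, for every field \(L\) with \(K\subseteq L\subseteq\bar K\), every \(a\in L\) which is not post-critical, and every \(\alpha\) as above, the specialization at \(t=a\) over \(L\) is surjective if and only if \[\operatorname{Gal}\bigl(L\widehat K_f(f^{-m}(a))/L\widehat K_f\bigr)\;\cong\;\operatorname{Gal}\bigl(\widehat K_f(f^{-m}(t))/\widehat K_f(t)\bigr)\] (as groups) and \(L\) is linearly disjoint from \(\widehat K_f\) over \(K\). If \(L=K\), the disjointness condition always holds. -/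

import Mathlib

open scoped IntermediateField Pointwise

noncomputable section

namespace PfIMG

universe u v

/-! ### Rational maps on the projective line, with `ℙ¹(F) = F ∪ {∞}` -/

/-- The degree of a rational function, `max (deg P) (deg Q)` for `f = P / Q` in lowest terms. -/
def degree {K : Type u} [Field K] (f : RatFunc K) : ℕ :=
  max f.num.natDegree f.denom.natDegree

/-- The map `ℙ¹(F) → ℙ¹(F)` induced by a rational function over `K`, for a field `F ⊇ K`. -/
def ratMap {K : Type u} [Field K] (f : RatFunc K) (F : Type v) [Field F] [Algebra K F] :
    OnePoint F → OnePoint F := fun x =>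
  open scoped Classical in
  x.elim
    (if f.denom.coeff (degree f) = 0 then OnePoint.infty
      else ((algebraMap K F (f.num.coeff (degree f) / f.denom.coeff (degree f)) : F) : OnePoint F))
    (fun c => if Polynomial.aeval c f.denom = 0 then OnePoint.infty
      else ((Polynomial.aeval c f.num / Polynomial.aeval c f.denom : F) : OnePoint F))

/-- The ramification index of `f = P / Q` at a point `c` of `ℙ¹(F)`: the multiplicity of `c` as a
zero of the binary form of degree `deg f` obtained by homogenizing `P(c) Q - Q(c) P`
(for `c = ∞`: of `p Q - q P`, where `p` and `q` are the coefficients of degree `deg f`). -/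
def ramificationIndex {K : Type u} [Field K] (f : RatFunc K) (F : Type v) [Field F] [Algebra K F]
    (c : OnePoint F) : ℕ :=
  c.elim
    (degree f - (Polynomial.C (f.num.coeff (degree f)) * f.denom
        - Polynomial.C (f.denom.coeff (degree f)) * f.num).natDegree)
    (fun c => (Polynomial.C (Polynomial.aeval c f.num) * f.denom.map (algebraMap K F)
        - Polynomial.C (Polynomial.aeval c f.denom) * f.num.map (algebraMap K F)).rootMultiplicity c)

/-- `f` is nonconstant and tamely ramified: no ramification index at a geometric point of `ℙ¹` is
divisible by the characteristic (this forces `f` to be separable). -/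
def IsTamelyRamified {K : Type u} [Field K] (f : RatFunc K) : Prop :=
  0 < degree f ∧
    ∀ c : OnePoint (AlgebraicClosure K), (ramificationIndex f (AlgebraicClosure K) c : K) ≠ 0

section Fields

variable {K : Type u} [Field K] (f : RatFunc K) {Ω : Type v} [Field Ω] [Algebra K Ω]

/-- `a` is post-critical: `a = fⁿ(c)` for a geometric critical point `c` and some `n ≥ 1`. -/
def IsPostCritical (a : Ω) : Prop :=
  ∃ c : OnePoint (AlgebraicClosure Ω), 1 < ramificationIndex f (AlgebraicClosure Ω) c ∧
    ∃ n : ℕ, 1 ≤ n ∧ (ratMap f (AlgebraicClosure Ω))^[n] c =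
      ((algebraMap Ω (AlgebraicClosure Ω) a : AlgebraicClosure Ω) : OnePoint (AlgebraicClosure Ω))

/-- The finite points of `f⁻ⁿ(y)`, in `Ω`. (The point `∞`, if it lies in the fibre, is rational and
contributes nothing to the fields generated by the fibre.) -/
def fiber (n : ℕ) (y : Ω) : Set Ω :=
  {x : Ω | (ratMap f Ω)^[n] (x : OnePoint Ω) = (y : OnePoint Ω)}

/-- The finite points of `f^{-∞}(y)`, the set of all iterated preimages of `y`
(including `y` itself). -/
def backwardOrbit (y : Ω) : Set Ω := ⋃ n : ℕ, fiber f n y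

/-- The field `F(f⁻ⁿ(y))`, as an extension of `F`. -/
abbrev fiberField (F : IntermediateField K Ω) (n : ℕ) (y : Ω) : IntermediateField F Ω :=
  IntermediateField.adjoin F (fiber f n y)

/-- The field `F(f^{-∞}(y))`, as an extension of `F`. -/
abbrev orbitField (F : IntermediateField K Ω) (y : Ω) : IntermediateField F Ω :=
  IntermediateField.adjoin F (backwardOrbit f y)

/-- The Galois group `Gal(F(f⁻ⁿ(y)) / F)`. -/
abbrev fiberGal (F : IntermediateField K Ω) (n : ℕ) (y : Ω) : Type v :=
  Gal(fiberField f F n y/F)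

/-- The field `L(t)`. -/
abbrev funField (L : IntermediateField K Ω) (t : Ω) : IntermediateField K Ω := L ⊔ K⟮t⟯

/-- `Gal(L(f^{-∞}(t)) / L(t))`, the profinite iterated monodromy group of `f` over `L`. -/
abbrev IMG (L : IntermediateField K Ω) (t : Ω) : Type v :=
  Gal(orbitField f (funField L t) t/funField L t)

/-- The arithmetic profinite iterated monodromy group `Gal(K(f^{-∞}(t)) / K(t))`. -/
abbrev arithIMG (t : Ω) : Type v := IMG f (⊥ : IntermediateField K Ω) t

/-- The geometric profinite iterated monodromy group `Gal(K̄(f^{-∞}(t)) / K̄(t))`, where `K̄` is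
the algebraic closure of `K` in `Ω`. -/
abbrev geomIMG (t : Ω) : Type v := IMG f (algebraicClosure K Ω) t

/-- The constant field extension `K̂_f`: the algebraic closure of `K` in `K(f^{-∞}(t))`. -/
def constField (t : Ω) : IntermediateField K Ω :=
  algebraicClosure K Ω ⊓ IntermediateField.adjoin K (backwardOrbit f t)

/-- The integral closure of `L[t]` in `L(f^{-∞}(t))`. -/
def integers (L : IntermediateField K Ω) (t : Ω) : Subring (orbitField f (funField L t) t) :=
  (integralClosure (Algebra.adjoin K ((L : Set Ω) ∪ {t})) Ω).toSubring.comap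
    (algebraMap (orbitField f (funField L t) t) Ω)

/-- The ideal `α` of the ring of integers of `L(f^{-∞}(t))` is maximal and contains `t - a`. -/
def IsMaximalOver (L : IntermediateField K Ω) (t a : Ω) (α : Ideal (integers f L t)) : Prop :=
  α.IsMaximal ∧ ∃ x ∈ α, ((x : orbitField f (funField L t) t) : Ω) = t - a

/-- The decomposition group of `α`: all `σ` in `Gal(L(f^{-∞}(t)) / L(t))` with `σ(α) = α`. -/
def decompositionGroup (L : IntermediateField K Ω) (t : Ω) (α : Ideal (integers f L t)) :
    Subgroup (IMG f L t) :=
  MulAction.stabilizer (IMG f L t)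
    ((fun x : integers f L t => (x : orbitField f (funField L t) t)) '' (α : Set (integers f L t)))

theorem orbitField_bot_le (L : IntermediateField K Ω) (t : Ω) {x : Ω}
    (hx : x ∈ orbitField f (funField (⊥ : IntermediateField K Ω) t) t) :
    x ∈ orbitField f (funField L t) t := by
  induction hx using IntermediateField.adjoin_induction with
  | mem x hx => exact IntermediateField.subset_adjoin _ _ hx
  | algebraMap x =>
    have h : (x : Ω) ∈ funField L t := by
      have hle : funField (⊥ : IntermediateField K Ω) t ≤ funField L t :=
        sup_le_sup_right bot_le _
      exact hle x.2
    exact (orbitField f (funField L t) t).algebraMap_mem ⟨x, h⟩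
  | add x y _ _ hx hy => exact add_mem hx hy
  | inv x _ hx => exact inv_mem hx
  | mul x y _ _ hx hy => exact mul_mem hx hy

/-- The inclusion `K(f^{-∞}(t)) → L(f^{-∞}(t))`. -/
def incl (L : IntermediateField K Ω) (t : Ω)
    (x : orbitField f (funField (⊥ : IntermediateField K Ω) t) t) : orbitField f (funField L t) t :=
  ⟨x, orbitField_bot_le f L t x.2⟩

/-- The specialization at the prime `α`, as a subgroup of the arithmetic profinite iterated
monodromy group: the restrictions to `K(f^{-∞}(t))` of the elements of the decomposition group of
`α` in `Gal(L(f^{-∞}(t)) / L(t))`. -/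
def specialization (L : IntermediateField K Ω) (t : Ω) (α : Ideal (integers f L t)) :
    Subgroup (arithIMG f t) where
  carrier := {g | ∃ σ ∈ decompositionGroup f L t α, ∀ x, σ (incl f L t x) = incl f L t (g x)}
  one_mem' := ⟨1, one_mem _, fun _ => rfl⟩
  mul_mem' := by
    rintro g h ⟨σ, hσ, hg⟩ ⟨τ, hτ, hh⟩
    refine ⟨σ * τ, mul_mem hσ hτ, fun x => ?_⟩
    rw [AlgEquiv.mul_apply, hh, hg, AlgEquiv.mul_apply]
  inv_mem' := by
    rintro g ⟨σ, hσ, hg⟩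
    refine ⟨σ⁻¹, inv_mem hσ, fun x => ?_⟩
    have h := hg (g⁻¹ x)
    rw [← AlgEquiv.mul_apply, mul_inv_cancel, AlgEquiv.one_apply] at h
    rw [← h, ← AlgEquiv.mul_apply, inv_mul_cancel, AlgEquiv.one_apply]

end Fields

/-- The Frattini subgroup of a profinite group: the intersection of its maximal open subgroups. -/
def profiniteFrattini (G : Type u) [Group G] [TopologicalSpace G] : Subgroup G :=
  sInf {M : Subgroup G | IsCoatom M ∧ IsOpen (M : Set G)}

end PfIMG

end

/-!
The argument takes place inside the group of automorphisms of `Ω` over `K`.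

*Reduction of fibres.* The ideal `α` is the trace of a maximal ideal `P` of the integral closure of
`L[t]` in `Ω` (`exists_isMaximal_over`). The local ring at `P` defines a place of `Ω` with algebraic
residue field which is the identity on constants and sends `t` to `a`
(`exists_constPlace_of_isMaximal`). A tamely ramified rational function is separable
(`wronskian_ne_zero`), so a point that is not a critical value has `deg f` preimages in a separably
closed field; since `a` is not post-critical, the place maps the fibre of `f^n` over `t` bijectively
onto the fibre over `a` (`bijOn_red`). Hence an element of the decomposition group of `P` is trivial
on one fibre if and only if it is trivial on the other (`fixes_fiber_iff`).

*The finite level.* Let `Δ` be the decomposition group of `P` over `L K̂_f(t)`. Because `t - a`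
generates a prime ideal of `K̄[t]`, and the Galois group acts transitively on the primes over a
given one (`exists_map_prime`), every automorphism of the constants over `L K̂_f` is induced by an
element of `Δ`; in particular `Δ` surjects onto `Gal(L K̂_f(f^{-m}(a)) / L K̂_f)`. By the previous
paragraph, this finite group is isomorphic to the image of `Δ` in
`Gal(K̂_f(f^{-m}(t)) / K̂_f(t))`, and the two groups of the theorem are isomorphic if and only if
`Δ` surjects onto the latter (`nonempty_fiberGal_iff`).

*The Frattini argument.* Restriction identifies `Gal(K(f^{-∞}(t)) / K̂_f(t))` with the geometric
monodromy group (`exists_geometric`). As its Frattini subgroup is open, it contains the elements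
that are trivial on `f^{-m}(t)`, for some `m` that depends on `f` only
(`exists_fiber_fixing_le`). If `Δ` is surjective at level `m`, its image in the geometric monodromy
group is a subgroup which, together with the Frattini subgroup, generates everything; the
stabilizer of `α`, which is closed, is then the whole group
(`eq_top_of_sup_profiniteFrattini`, `stabilizes_of_geometric`).

*Constants.* It remains to decide when the decomposition group over `L(t)` surjects onto
`Gal(K̂_f / K)`: its image there is `Gal(K̂_f / L ∩ K̂_f)`, and as `K̂_f` is Galois over `K`,
linear disjointness means `L ∩ K̂_f = K` (`linearDisjoint_of_inf_eq_bot`,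
`forall_exists_of_stabilizes`, `inf_constField_eq_bot_of_forall`).
-/

noncomputable section

namespace PfIMG

universe u v

/-! ### Rational maps in homogeneous coordinates -/

section Homogeneous

open Polynomial

/-- The value at `(u, v)` of the binary form of degree `d` obtained by homogenizing `P`, the
coefficients being transported along a ring homomorphism `ι`. -/
def homEval {K R : Type*} [Field K] [CommRing R] (ι : K →+* R) (P : K[X]) (d : ℕ) (u v : R) : R :=
  ∑ i ∈ Finset.range (d + 1), ι (P.coeff i) * u ^ i * v ^ (d - i)

/-- The point `[u : v]` of the projective line, for `(u, v) ≠ (0, 0)`. -/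
def pt {F : Type*} [Field F] (u v : F) : OnePoint F :=
  open scoped Classical in if v = 0 then OnePoint.infty else ((u / v : F) : OnePoint F)

section Pt

variable {F : Type*} [Field F]

theorem pt_zero (u : F) : pt u 0 = OnePoint.infty := by simp [pt]

theorem pt_of_ne {u v : F} (hv : v ≠ 0) : pt u v = ((u / v : F) : OnePoint F) := by simp [pt, hv]

theorem pt_one (u : F) : pt u 1 = (u : OnePoint F) := by simp [pt]

theorem pt_eq_pt_iff {u v u' v' : F} (h : u ≠ 0 ∨ v ≠ 0) (h' : u' ≠ 0 ∨ v' ≠ 0) :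
    pt u v = pt u' v' ↔ u * v' = u' * v := by
  by_cases hv : v = 0 <;> by_cases hv' : v' = 0
  · simp [hv, hv', pt_zero]
  · subst hv
    have : u ≠ 0 := by simpa using h
    simp [pt_zero, pt_of_ne hv', this, hv']
  · subst hv'
    have : u' ≠ 0 := by simpa using h'
    simp [pt_zero, pt_of_ne hv, this, hv]
  · rw [pt_of_ne hv, pt_of_ne hv', OnePoint.coe_eq_coe, div_eq_div_iff hv hv']

theorem exists_pt (x : OnePoint F) : ∃ u v : F, (u ≠ 0 ∨ v ≠ 0) ∧ x = pt u v := by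
  induction x using OnePoint.rec with
  | infty => exact ⟨1, 0, by simp, (pt_zero 1).symm⟩
  | coe x => exact ⟨x, 1, by simp, (pt_one x).symm⟩

end Pt

section HomEval

variable {K R : Type*} [Field K] [CommRing R]

theorem map_homEval {S : Type*} [CommRing S] (φ : R →+* S) (ι : K →+* R) (P : K[X]) (d : ℕ)
    (u v : R) : φ (homEval ι P d u v) = homEval (φ.comp ι) P d (φ u) (φ v) := by
  simp [homEval]

theorem homEval_one_right (ι : K →+* R) {P : K[X]} {d : ℕ} (h : P.natDegree ≤ d) (u : R) :
    homEval ι P d u 1 = P.eval₂ ι u := by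
  rw [eval₂_eq_sum_range' ι (Nat.lt_succ_of_le h)]
  simp [homEval]

theorem homEval_mul (ι : K →+* R) (P : K[X]) (d : ℕ) (c u v : R) :
    homEval ι P d (c * u) (c * v) = c ^ d * homEval ι P d u v := by
  rw [homEval, homEval, Finset.mul_sum]
  refine Finset.sum_congr rfl fun i hi => ?_
  have hi : i ≤ d := Nat.lt_succ_iff.1 (Finset.mem_range.1 hi)
  have hc : c ^ i * c ^ (d - i) = c ^ d := by rw [← pow_add, Nat.add_sub_cancel' hi]
  rw [mul_pow, mul_pow, ← hc]; ring

theorem homEval_zero_right (ι : K →+* R) (P : K[X]) (d : ℕ) (u : R) :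
    homEval ι P d u 0 = ι (P.coeff d) * u ^ d := by
  rw [homEval, Finset.sum_eq_single d]
  · simp
  · intro i hi hid
    have hi : i ≤ d := Nat.lt_succ_iff.1 (Finset.mem_range.1 hi)
    rw [zero_pow (by omega), mul_zero]
  · simp

theorem homEval_one_left (ι : K →+* R) {P : K[X]} {d : ℕ} (h : P.natDegree ≤ d) (v : R) :
    homEval ι P d 1 v = (reflect d P).eval₂ ι v := by
  have hr : (reflect d P).natDegree ≤ d := (natDegree_reflect_le).trans (by simp [h])
  rw [eval₂_eq_sum_range' ι (Nat.lt_succ_of_le hr), homEval, ← Finset.sum_range_reflect]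
  refine Finset.sum_congr rfl fun i hi => ?_
  have hi : i ≤ d := Nat.lt_succ_iff.1 (Finset.mem_range.1 hi)
  simp only [coeff_reflect, revAt_le hi, one_pow, mul_one, Nat.add_sub_cancel]
  congr 2
  omega

end HomEval

variable {K : Type u} [Field K] (f : RatFunc K)

theorem natDegree_num_le : f.num.natDegree ≤ degree f := le_max_left _ _

theorem natDegree_denom_le : f.denom.natDegree ≤ degree f := le_max_right _ _

theorem coeff_degree_ne_zero : f.num.coeff (degree f) ≠ 0 ∨ f.denom.coeff (degree f) ≠ 0 := by
  rcases le_total f.denom.natDegree f.num.natDegree with h | h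
  · rw [degree, max_eq_left h]
    by_cases h0 : f.num = 0
    · right
      have h1 : f.denom.natDegree = f.num.natDegree := by rw [h0] at h ⊢; simpa using h
      rw [← h1]
      exact leadingCoeff_ne_zero.2 f.denom_ne_zero
    · exact Or.inl (leadingCoeff_ne_zero.2 h0)
  · rw [degree, max_eq_right h]
    exact Or.inr (leadingCoeff_ne_zero.2 f.denom_ne_zero)

section Field

variable (F : Type v) [Field F] [Algebra K F]

theorem isCoprime_map : IsCoprime (f.num.map (algebraMap K F)) (f.denom.map (algebraMap K F)) :=
  f.isCoprime_num_denom.map (mapRingHom (algebraMap K F))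

variable {F}

theorem aeval_num_ne_zero_or (c : F) : aeval c f.num ≠ 0 ∨ aeval c f.denom ≠ 0 := by
  obtain ⟨a, b, h⟩ := f.isCoprime_num_denom
  by_contra! h0
  have := congrArg (aeval c) h
  simp [h0.1, h0.2] at this

/-- The binary forms attached to the numerator and the denominator of `f` have no common zero on the
projective line, so that their values are homogeneous coordinates of a point. -/
theorem homEval_ne_zero_or {u v : F} (h : u ≠ 0 ∨ v ≠ 0) :
    homEval (algebraMap K F) f.num (degree f) u v ≠ 0 ∨
      homEval (algebraMap K F) f.denom (degree f) u v ≠ 0 := by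
  by_cases hv : v = 0
  · subst hv
    have hu : u ≠ 0 := by simpa using h
    simpa [homEval_zero_right, hu] using coeff_degree_ne_zero f
  · have key : ∀ P : K[X], P.natDegree ≤ degree f →
        homEval (algebraMap K F) P (degree f) u v = v ^ degree f * aeval (u / v) P := by
      intro P hP
      have := homEval_mul (algebraMap K F) P (degree f) v (u / v) 1
      rwa [mul_div_cancel₀ _ hv, mul_one, homEval_one_right _ hP] at this
    rw [key _ (natDegree_num_le f), key _ (natDegree_denom_le f)]
    simpa [hv] using aeval_num_ne_zero_or f (u / v)

theorem ratMap_pt {u v : F} (h : u ≠ 0 ∨ v ≠ 0) :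
    ratMap f F (pt u v) = pt (homEval (algebraMap K F) f.num (degree f) u v)
      (homEval (algebraMap K F) f.denom (degree f) u v) := by
  by_cases hv : v = 0
  · subst hv
    have hu : u ≠ 0 := by simpa using h
    rw [pt_zero, homEval_zero_right, homEval_zero_right]
    by_cases hq : f.denom.coeff (degree f) = 0
    · simp [ratMap, hq, pt_zero]
    · have hq' : algebraMap K F (f.denom.coeff (degree f)) * u ^ degree f ≠ 0 := by simp [hq, hu]
      rw [pt_of_ne hq']
      simp only [ratMap, OnePoint.elim_infty, if_neg hq, map_div₀]
      rw [mul_div_mul_right _ _ (pow_ne_zero _ hu)]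
  · have key : ∀ P : K[X], P.natDegree ≤ degree f →
        homEval (algebraMap K F) P (degree f) u v = v ^ degree f * aeval (u / v) P := by
      intro P hP
      have := homEval_mul (algebraMap K F) P (degree f) v (u / v) 1
      rwa [mul_div_cancel₀ _ hv, mul_one, homEval_one_right _ hP] at this
    rw [key _ (natDegree_num_le f), key _ (natDegree_denom_le f), pt_of_ne hv]
    by_cases hq : aeval (u / v) f.denom = 0
    · simp [ratMap, hq, pt_zero]
    · rw [pt_of_ne (mul_ne_zero (pow_ne_zero _ hv) hq)]
      simp only [ratMap, OnePoint.elim_some, if_neg hq]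
      rw [mul_div_mul_left _ _ (pow_ne_zero _ hv)]

theorem ratMap_coe (c : F) : ratMap f F (c : OnePoint F) =
    pt (aeval c f.num) (aeval c f.denom) := by
  rw [← pt_one, ratMap_pt f (by simp), homEval_one_right _ (natDegree_num_le f),
    homEval_one_right _ (natDegree_denom_le f)]
  rfl

theorem ratMap_infty : ratMap f F OnePoint.infty =
    pt (algebraMap K F (f.num.coeff (degree f))) (algebraMap K F (f.denom.coeff (degree f))) := by
  rw [← pt_zero (1 : F), ratMap_pt f (by simp), homEval_zero_right, homEval_zero_right]
  simp

/-- `ratMap` commutes with homomorphisms of fields over `K`. -/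
theorem ratMap_map {F' : Type*} [Field F'] [Algebra K F'] (σ : F →ₐ[K] F') (x : OnePoint F) :
    ratMap f F' (OnePoint.map σ x) = OnePoint.map σ (ratMap f F x) := by
  have hpt : ∀ u v : F, OnePoint.map σ (pt u v) = pt (σ u) (σ v) := by
    intro u v
    by_cases hv : v = 0
    · simp [hv, pt_zero]
    · rw [pt_of_ne hv, pt_of_ne (by simpa using hv)]; simp
  induction x using OnePoint.rec with
  | infty =>
    rw [OnePoint.map_infty, ratMap_infty, ratMap_infty, hpt]
    simp
  | coe c =>
    rw [OnePoint.map_some, ratMap_coe, ratMap_coe, hpt, aeval_algHom_apply, aeval_algHom_apply]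

theorem iterate_ratMap_map {F' : Type*} [Field F'] [Algebra K F'] (σ : F →ₐ[K] F') (n : ℕ)
    (x : OnePoint F) :
    (ratMap f F')^[n] (OnePoint.map σ x) = OnePoint.map σ ((ratMap f F)^[n] x) := by
  induction n generalizing x with
  | zero => rfl
  | succ n ih => rw [Function.iterate_succ_apply, Function.iterate_succ_apply, ratMap_map, ih]

/-- The numerator and denominator of a nonconstant rational function are linearly independent. -/
theorem linear_combination_eq_zero (hd : 0 < degree f) {p q : F}
    (h : C p * f.denom.map (algebraMap K F) - C q * f.num.map (algebraMap K F) = 0) :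
    p = 0 ∧ q = 0 := by
  have hco := isCoprime_map f F
  have h' := sub_eq_zero.1 h
  have aux : ∀ {A B : F[X]} {r s : F}, IsCoprime A B → C r * A = C s * B → r ≠ 0 →
      A.natDegree = 0 ∧ B.natDegree = 0 := by
    intro A B r s hAB hrs hr
    have hA : A = C (r⁻¹ * s) * B := by
      rw [C_mul, mul_assoc, ← hrs, ← mul_assoc, ← C_mul, inv_mul_cancel₀ hr, C_1, one_mul]
    have hB : IsUnit B := hAB.symm.isUnit_of_dvd' dvd_rfl ⟨_, hA.trans (mul_comm _ _)⟩
    have hB0 := natDegree_eq_zero_of_isUnit hB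
    refine ⟨?_, hB0⟩
    rw [hA]
    have := natDegree_C_mul_le (r⁻¹ * s) B
    omega
  have hdeg : ¬ ((f.num.map (algebraMap K F)).natDegree = 0 ∧
      (f.denom.map (algebraMap K F)).natDegree = 0) := by
    rw [natDegree_map, natDegree_map]
    rintro ⟨h1, h2⟩
    rw [degree, h1, h2] at hd
    simp at hd
  by_contra hpq
  by_cases hp : p = 0
  · exact hdeg (aux hco h'.symm fun hq => hpq ⟨hp, hq⟩)
  · exact hdeg (aux hco.symm h' hp).symm

/-- The polynomial whose roots are the finite points of the fibre of `f` over `[p : q]`. -/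
def fiberPoly (p q : F) : F[X] :=
  C p * f.denom.map (algebraMap K F) - C q * f.num.map (algebraMap K F)

theorem natDegree_fiberPoly_le (p q : F) : (fiberPoly f p q).natDegree ≤ degree f := by
  refine (natDegree_sub_le _ _).trans (max_le ?_ ?_)
  · exact (natDegree_C_mul_le _ _).trans ((natDegree_map_le).trans (natDegree_denom_le f))
  · exact (natDegree_C_mul_le _ _).trans ((natDegree_map_le).trans (natDegree_num_le f))

theorem fiberPoly_ne_zero (hd : 0 < degree f) {p q : F} (h : p ≠ 0 ∨ q ≠ 0) :
    fiberPoly f p q ≠ 0 := fun h0 => by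
  have := linear_combination_eq_zero f hd h0
  simp [this] at h

theorem eval_fiberPoly (p q c : F) :
    (fiberPoly f p q).eval c = p * aeval c f.denom - q * aeval c f.num := by
  simp [fiberPoly, eval_map_algebraMap]

theorem eval_derivative_fiberPoly (p q c : F) : (derivative (fiberPoly f p q)).eval c =
    p * aeval c (derivative f.denom) - q * aeval c (derivative f.num) := by
  simp [fiberPoly, derivative_map, eval_map_algebraMap]

theorem ratMap_coe_eq_pt_iff {p q : F} (h : p ≠ 0 ∨ q ≠ 0) (c : F) :
    ratMap f F (c : OnePoint F) = pt p q ↔ (fiberPoly f p q).IsRoot c := by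
  rw [ratMap_coe, pt_eq_pt_iff (aeval_num_ne_zero_or f c) h, IsRoot.def, eval_fiberPoly,
    sub_eq_zero, mul_comm, eq_comm]

theorem ratMap_infty_eq_pt_iff {p q : F} (h : p ≠ 0 ∨ q ≠ 0) :
    ratMap f F OnePoint.infty = pt p q ↔ (fiberPoly f p q).coeff (degree f) = 0 := by
  rw [ratMap_infty, pt_eq_pt_iff (by simpa using coeff_degree_ne_zero f) h, fiberPoly, coeff_sub,
    coeff_C_mul, coeff_C_mul, coeff_map, coeff_map, sub_eq_zero, mul_comm, eq_comm]

theorem fiber_finite_and_ncard_le (hd : 0 < degree f) (b : OnePoint F) :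
    {c : OnePoint F | ratMap f F c = b}.Finite ∧
      {c : OnePoint F | ratMap f F c = b}.ncard ≤ degree f := by
  classical
  obtain ⟨p, q, hpq, rfl⟩ := exists_pt b
  set g := fiberPoly f p q
  have hg : g ≠ 0 := fiberPoly_ne_zero f hd hpq
  set R : Finset (OnePoint F) := g.roots.toFinset.image (fun c : F => (c : OnePoint F)) with hR
  have hRc : R.card ≤ g.natDegree :=
    Finset.card_image_le.trans ((Multiset.toFinset_card_le _).trans (card_roots' g))
  have hcoe : ∀ c : F, ratMap f F (c : OnePoint F) = pt p q → (c : OnePoint F) ∈ R := fun c hc =>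
    Finset.mem_image.2 ⟨c, by
      simpa [hg] using (ratMap_coe_eq_pt_iff f hpq c).1 hc, rfl⟩
  by_cases h : g.coeff (degree f) = 0
  · have hlt : g.natDegree < degree f := lt_of_le_of_ne (natDegree_fiberPoly_le f p q) fun he =>
      leadingCoeff_ne_zero.2 hg (by rw [leadingCoeff, he, h])
    have hsub : {c : OnePoint F | ratMap f F c = pt p q} ⊆
        ((insert OnePoint.infty R : Finset (OnePoint F)) : Set (OnePoint F)) := by
      intro c hc
      induction c using OnePoint.rec with
      | infty => simp
      | coe c => exact Finset.mem_coe.2 (Finset.mem_insert_of_mem (hcoe c hc))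
    refine ⟨(Finset.finite_toSet _).subset hsub, ?_⟩
    have h1 := Set.ncard_le_ncard hsub (Finset.finite_toSet _)
    rw [Set.ncard_coe_finset] at h1
    have h2 := Finset.card_insert_le OnePoint.infty R
    omega
  · have hsub : {c : OnePoint F | ratMap f F c = pt p q} ⊆ (R : Set (OnePoint F)) := by
      intro c hc
      induction c using OnePoint.rec with
      | infty => exact absurd ((ratMap_infty_eq_pt_iff f hpq).1 hc) h
      | coe c => exact hcoe c hc
    refine ⟨(Finset.finite_toSet _).subset hsub, ?_⟩
    have h1 := Set.ncard_le_ncard hsub (Finset.finite_toSet _)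
    rw [Set.ncard_coe_finset] at h1
    exact h1.trans (hRc.trans (natDegree_fiberPoly_le f p q))

/-! ### Critical points and the Wronskian -/

theorem one_lt_ramificationIndex_coe (hd : 0 < degree f) {c : F}
    (h : aeval c (wronskian f.num f.denom) = 0) : 1 < ramificationIndex f F (c : OnePoint F) := by
  change 1 < (fiberPoly f (aeval c f.num) (aeval c f.denom)).rootMultiplicity c
  rw [one_lt_rootMultiplicity_iff_isRoot (fiberPoly_ne_zero f hd (aeval_num_ne_zero_or f c)),
    IsRoot.def, IsRoot.def, eval_fiberPoly, eval_derivative_fiberPoly]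
  simp only [wronskian, map_sub, map_mul] at h
  exact ⟨by ring, by linear_combination h⟩

/-- At infinity the local coordinate is `1 / x`, in which `f` is the quotient of the reversed
polynomials. -/
theorem one_lt_ramificationIndex_infty (hd : 0 < degree f)
    (h : (wronskian (reflect (degree f) f.num) (reflect (degree f) f.denom)).eval 0 = 0) :
    1 < ramificationIndex f F OnePoint.infty := by
  set d := degree f with hdd
  set p := f.num.coeff d
  set q := f.denom.coeff d
  change 1 < d - (C p * f.denom - C q * f.num).natDegree
  have hT : C p * f.denom - C q * f.num = fiberPoly f p q := by simp [fiberPoly]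
  rw [hT]
  have h0 : (fiberPoly f p q).coeff d = 0 := by
    rw [← hT]; simp only [coeff_sub, coeff_C_mul]; change p * q - q * p = 0; ring
  have h1 : (fiberPoly f p q).coeff (d - 1) = 0 := by
    rw [← hT]
    have e : ∀ P : K[X], (reflect d P).eval 0 = P.coeff d := fun P => by
      rw [← coeff_zero_eq_eval_zero, coeff_reflect, revAt_le (Nat.zero_le _), Nat.sub_zero]
    have e' : ∀ P : K[X], (derivative (reflect d P)).eval 0 = P.coeff (d - 1) := fun P => by
      rw [← coeff_zero_eq_eval_zero, coeff_derivative, coeff_reflect, zero_add, revAt_le hd]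
      simp
    rw [wronskian, eval_sub, eval_mul, eval_mul, e, e, e', e'] at h
    simp only [coeff_sub, coeff_C_mul]
    linear_combination h
  have hle := natDegree_fiberPoly_le f p q
  have hne : fiberPoly f p q ≠ 0 := fiberPoly_ne_zero f hd (coeff_degree_ne_zero f)
  have hl := leadingCoeff_ne_zero.2 hne
  rw [leadingCoeff] at hl
  have n0 : (fiberPoly f p q).natDegree ≠ d := fun e => hl (by rw [e, h0])
  have n1 : (fiberPoly f p q).natDegree ≠ d - 1 := fun e => hl (by rw [e, h1])
  omega

/-- A tamely ramified map is separable: were the Wronskian zero, every multiplicity of a fibre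
polynomial, having zero derivative, would vanish in `K`. -/
theorem wronskian_ne_zero (hf : IsTamelyRamified f) : wronskian f.num f.denom ≠ 0 := by
  intro h0
  obtain ⟨h1, h2⟩ := (f.isCoprime_num_denom.wronskian_eq_zero_iff).1 h0
  set F := AlgebraicClosure K
  obtain ⟨hd, ht⟩ := hf
  have ht := ht ((0 : F) : OnePoint F)
  set p := aeval (0 : F) f.num with hp
  set q := aeval (0 : F) f.denom with hq
  change (((fiberPoly f p q).rootMultiplicity 0 : ℕ) : K) ≠ 0 at ht
  have hne : fiberPoly f p q ≠ 0 := fiberPoly_ne_zero f hd (aeval_num_ne_zero_or f _)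
  have hder : derivative (fiberPoly f p q) = 0 := by
    simp [fiberPoly, derivative_map, h1, h2]
  obtain ⟨g, hg, hndvd⟩ := exists_eq_pow_rootMultiplicity_mul_and_not_dvd _ hne 0
  set n := (fiberPoly f p q).rootMultiplicity 0
  have hn : n ≠ 0 := fun h => ht (by simp [h])
  obtain ⟨k, hk⟩ := Nat.exists_eq_succ_of_ne_zero hn
  rw [hg, derivative_mul, derivative_X_sub_C_pow, hk, Nat.succ_sub_one, pow_succ] at hder
  have hX : (X - C (0 : F)) ≠ 0 := X_sub_C_ne_zero 0
  have : (X - C (0 : F)) ^ k * (C ((n : ℕ) : F) * g + (X - C 0) * derivative g) = 0 := by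
    rw [← hder, hk]; ring
  rw [mul_eq_zero, or_iff_right (pow_ne_zero _ hX)] at this
  have hev := congrArg (eval 0) this
  simp only [eval_add, eval_mul, eval_C, eval_sub, eval_X, sub_self, zero_mul, add_zero,
    eval_zero, mul_eq_zero] at hev
  rcases hev with hev | hev
  · refine ht ((algebraMap K F).injective ?_)
    simpa using hev
  · exact hndvd (dvd_iff_isRoot.2 hev)

end Field

end Homogeneous

/-! ### Fibres over separably closed fields -/

section Fibres

open Polynomial

variable {K : Type u} [Field K] (f : RatFunc K) {Ω : Type v} [Field Ω] [Algebra K Ω]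

theorem isAlgebraic_of_ratMap_coe {x w : Ω} (hx : IsAlgebraic K x)
    (h : ratMap f Ω (x : OnePoint Ω) = (w : OnePoint Ω)) : IsAlgebraic K w := by
  rw [ratMap_coe] at h
  by_cases hq : aeval x f.denom = 0
  · rw [hq, pt_zero] at h
    exact absurd h (OnePoint.infty_ne_coe _)
  · rw [pt_of_ne hq, OnePoint.coe_eq_coe] at h
    rw [← h, div_eq_mul_inv]
    have key : ∀ P : K[X], IsAlgebraic K (aeval x P) := fun P =>
      (Algebra.adjoin_le (S := (algebraicClosure K Ω).toSubalgebra)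
        (Set.singleton_subset_iff.2 hx.isIntegral)
        (aeval_mem_adjoin_singleton K x (p := P)) : IsIntegral K _).isAlgebraic
    exact (key _).mul (key _).inv

theorem isAlgebraic_of_ratMap_infty {w : Ω}
    (h : ratMap f Ω OnePoint.infty = (w : OnePoint Ω)) : IsAlgebraic K w := by
  rw [ratMap_infty] at h
  by_cases hq : algebraMap K Ω (f.denom.coeff (degree f)) = 0
  · rw [hq, pt_zero] at h
    exact absurd h (OnePoint.infty_ne_coe _)
  · rw [pt_of_ne hq, OnePoint.coe_eq_coe, ← map_div₀] at h
    rw [← h]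
    exact isAlgebraic_algebraMap _

/-- The points of a fibre over a point that is algebraic over `K` (or infinite) are algebraic. -/
theorem isAlgebraic_of_ratMap_eq (hd : 0 < degree f) {y : Ω} {b : OnePoint Ω}
    (hb : ∀ w : Ω, b = (w : OnePoint Ω) → IsAlgebraic K w)
    (h : ratMap f Ω (y : OnePoint Ω) = b) : IsAlgebraic K y := by
  have key : ∀ p q : algebraicClosure K Ω, (p ≠ 0 ∨ q ≠ 0) → b = pt (p : Ω) (q : Ω) →
      IsAlgebraic K y := by
    intro p q hpq hb
    have hpq' : (p : Ω) ≠ 0 ∨ (q : Ω) ≠ 0 := by simpa using hpq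
    have hr := (ratMap_coe_eq_pt_iff f hpq' y).1 (h.trans hb)
    have hy : IsAlgebraic (algebraicClosure K Ω) y := by
      refine ⟨fiberPoly f p q, fiberPoly_ne_zero f hd hpq, ?_⟩
      rw [IsRoot.def, eval_fiberPoly] at hr
      simp only [fiberPoly, map_sub, map_mul, aeval_C, aeval_map_algebraMap]
      exact hr
    exact hy.restrictScalars K
  induction b using OnePoint.rec with
  | infty => exact key 1 0 (by simp) (by simp [pt_zero])
  | coe w =>
    exact key ⟨w, (hb w rfl).isIntegral⟩ 1 (by simp) (by simp [pt_one])

/-- Over a separably closed field, a transcendental point has exactly `deg f` preimages. -/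
theorem ncard_ratMap_eq [IsSepClosed Ω] (hd : 0 < degree f)
    (hW : wronskian f.num f.denom ≠ 0) {w : Ω} (hw : Transcendental K w) :
    {x : OnePoint Ω | ratMap f Ω x = (w : OnePoint Ω)}.ncard = degree f := by
  classical
  set g : Polynomial Ω := fiberPoly f w 1 with hg
  have hpq : w ≠ 0 ∨ (1 : Ω) ≠ 0 := by simp
  have hg0 : g ≠ 0 := fiberPoly_ne_zero f hd hpq
  -- a multiple root would be a zero of the Wronskian, hence algebraic over `K`
  have hsep : g.Separable := by
    rw [separable_def, isCoprime_iff_aeval_ne_zero_of_isAlgClosed Ω (AlgebraicClosure Ω)]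
    intro c
    by_contra! hc
    have e1 : aeval c g = algebraMap Ω _ w * aeval c f.denom - aeval c f.num := by
      simp [hg, fiberPoly]
    have e2 : aeval c (derivative g) = algebraMap Ω _ w * aeval c (derivative f.denom)
        - aeval c (derivative f.num) := by
      simp [hg, fiberPoly, derivative_map]
    rw [e1, e2] at hc
    have hWc : aeval c (wronskian f.num f.denom) = 0 := by
      simp only [wronskian, map_sub, map_mul]
      linear_combination aeval c f.denom * hc.2 - aeval c (derivative f.denom) * hc.1
    have hcalg : IsAlgebraic K c := ⟨_, hW, hWc⟩
    refine hw ?_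
    have hr : ratMap f (AlgebraicClosure Ω) (c : OnePoint (AlgebraicClosure Ω)) =
        ((algebraMap Ω (AlgebraicClosure Ω) w : AlgebraicClosure Ω) : OnePoint _) := by
      rw [← pt_one (algebraMap Ω (AlgebraicClosure Ω) w), ratMap_coe_eq_pt_iff f (by simp),
        IsRoot.def, eval_fiberPoly, one_mul]
      exact hc.1
    exact (isAlgebraic_algebraMap_iff (algebraMap Ω (AlgebraicClosure Ω)).injective).1
      (isAlgebraic_of_ratMap_coe f hcalg hr)
  have hcoeff : g.coeff (degree f) ≠ 0 := by
    intro h0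
    refine hw (isAlgebraic_of_ratMap_infty f ?_)
    rw [← pt_one, ratMap_infty_eq_pt_iff f hpq]
    exact h0
  have hdeg : g.natDegree = degree f :=
    le_antisymm (natDegree_fiberPoly_le f _ _) (le_natDegree_of_ne_zero hcoeff)
  have hset : {x : OnePoint Ω | ratMap f Ω x = (w : OnePoint Ω)} =
      (fun c : Ω => (c : OnePoint Ω)) '' (g.roots.toFinset : Set Ω) := by
    ext x
    induction x using OnePoint.rec with
    | infty =>
      simp only [Set.mem_ofPred_eq, Set.mem_image, OnePoint.coe_ne_infty, and_false, exists_false,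
        iff_false]
      exact fun h => hw (isAlgebraic_of_ratMap_infty f h)
    | coe c =>
      rw [Set.mem_ofPred_eq, ← pt_one w, ratMap_coe_eq_pt_iff f hpq]
      simp [hg0, ← hg]
  rw [hset, Set.ncard_image_of_injective _ OnePoint.coe_injective, Set.ncard_coe_finset,
    Multiset.toFinset_card_of_nodup (nodup_roots hsep),
    ← (IsSepClosed.splits_of_separable g hsep).natDegree_eq_card_roots, hdeg]

/-- Over a separably closed field, the unramified points of a rational fibre are rational. -/
theorem exists_map_of_ratMap_eq [IsSepClosed Ω] (hd : 0 < degree f)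
    {c : OnePoint (AlgebraicClosure Ω)}
    (hc : ¬ 1 < ramificationIndex f (AlgebraicClosure Ω) c) {b : OnePoint Ω}
    (h : ratMap f (AlgebraicClosure Ω) c = OnePoint.map (algebraMap Ω (AlgebraicClosure Ω)) b) :
    ∃ y : OnePoint Ω, c = OnePoint.map (algebraMap Ω (AlgebraicClosure Ω)) y := by
  induction c using OnePoint.rec with
  | infty => exact ⟨OnePoint.infty, rfl⟩
  | coe c =>
    obtain ⟨p, q, hpq, rfl⟩ := exists_pt b
    set j := algebraMap Ω (AlgebraicClosure Ω)
    have hmap : OnePoint.map j (pt p q) = pt (j p) (j q) := by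
      by_cases hq : q = 0
      · simp [hq, pt_zero]
      · rw [pt_of_ne hq, pt_of_ne (by simpa using hq)]; simp
    rw [hmap, ratMap_coe_eq_pt_iff f (by simpa using hpq), IsRoot.def, eval_fiberPoly] at h
    set g : Polynomial Ω := fiberPoly f p q
    have hgc : aeval c g = 0 := by simpa [g, fiberPoly] using h
    have hgc' : aeval c (derivative g) ≠ 0 := by
      intro h'
      have h' : j p * aeval c (derivative f.denom) - j q * aeval c (derivative f.num) = 0 := by
        simpa [g, fiberPoly, derivative_map] using h'
      refine hc (one_lt_ramificationIndex_coe f hd ?_)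
      simp only [wronskian, map_sub, map_mul]
      rcases hpq with hp | hq
      · refine (mul_eq_zero.1 ?_).resolve_left ((map_ne_zero j).2 hp)
        linear_combination aeval c f.num * h' - aeval c (derivative f.num) * h
      · refine (mul_eq_zero.1 ?_).resolve_left ((map_ne_zero j).2 hq)
        linear_combination aeval c f.denom * h' - aeval c (derivative f.denom) * h
    have hint : IsIntegral Ω c := Algebra.IsIntegral.isIntegral c
    have hirr := minpoly.irreducible hint
    have hsep : (minpoly Ω c).Separable := by
      rw [separable_iff_derivative_ne_zero hirr]
      intro h0
      obtain ⟨k, hk⟩ := minpoly.dvd Ω c hgc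
      refine hgc' ?_
      rw [hk, derivative_mul, h0, zero_mul, zero_add, map_mul, minpoly.aeval, zero_mul]
    obtain ⟨y, hy⟩ := minpoly.mem_range_of_degree_eq_one Ω c
      (IsSepClosed.degree_eq_one_of_irreducible Ω hirr hsep)
    exact ⟨(y : OnePoint Ω), by rw [OnePoint.map_some, hy]⟩

/-- The iterated preimages of a point which is not post-critical are unramified and rational over
a separably closed field. -/
theorem unramified_and_rational_of_iterate [IsSepClosed Ω] (hd : 0 < degree f) {a : Ω}
    (ha : ¬ IsPostCritical f a) (m : ℕ) {c : OnePoint (AlgebraicClosure Ω)}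
    (h : (ratMap f (AlgebraicClosure Ω))^[m] c =
      ((algebraMap Ω (AlgebraicClosure Ω) a : AlgebraicClosure Ω) : OnePoint _)) :
    (1 ≤ m → ¬ 1 < ramificationIndex f (AlgebraicClosure Ω) c) ∧
      ∃ y : OnePoint Ω, c = OnePoint.map (algebraMap Ω (AlgebraicClosure Ω)) y := by
  induction m generalizing c with
  | zero => exact ⟨by simp, (a : OnePoint Ω), by simpa using h⟩
  | succ m ih =>
    have hcrit : ¬ 1 < ramificationIndex f (AlgebraicClosure Ω) c := fun hc =>
      ha ⟨c, hc, m + 1, by omega, h⟩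
    refine ⟨fun _ => hcrit, ?_⟩
    obtain ⟨-, b, hb⟩ := ih (by simpa using h)
    exact exists_map_of_ratMap_eq f hd hcrit hb

theorem isAlgebraic_of_mem_fiber (hd : 0 < degree f) {a : Ω} (ha : IsAlgebraic K a) (m : ℕ)
    {y : Ω} (hy : y ∈ fiber f m a) : IsAlgebraic K y := by
  have key : ∀ (m : ℕ) (x : OnePoint Ω), (ratMap f Ω)^[m] x = (a : OnePoint Ω) →
      ∀ w : Ω, x = (w : OnePoint Ω) → IsAlgebraic K w := by
    intro m
    induction m with
    | zero =>
      rintro x hx w rfl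
      rw [Function.iterate_zero_apply, OnePoint.coe_eq_coe] at hx
      rwa [hx]
    | succ m ih =>
      rintro x hx w rfl
      exact isAlgebraic_of_ratMap_eq f hd (ih _ hx) rfl
  exact key m _ hy _ rfl

/-- The iterated preimages of a transcendental point are finite and transcendental. -/
theorem transcendental_of_iterate {t : Ω} (ht : Transcendental K t) (m : ℕ) {x : OnePoint Ω}
    (hx : (ratMap f Ω)^[m] x = (t : OnePoint Ω)) :
    ∃ w : Ω, x = (w : OnePoint Ω) ∧ Transcendental K w := by
  induction m generalizing x with
  | zero => exact ⟨t, hx, ht⟩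
  | succ m ih =>
    obtain ⟨w, hw, hwt⟩ := ih (by simpa using hx)
    induction x using OnePoint.rec with
    | infty => exact absurd (isAlgebraic_of_ratMap_infty f hw) hwt
    | coe x => exact ⟨x, rfl, fun hx => hwt (isAlgebraic_of_ratMap_coe f hx hw)⟩

end Fibres

/-! ### Reduction of fibres at a place -/

/-- A place of `Ω` that is trivial on the algebraic elements over `K`: a valuation ring together
with a homomorphism to `AlgebraicClosure Ω`, having the maximal ideal as its kernel and restricting
to the inclusion on the algebraic closure of `K` in `Ω`. -/
structure ConstPlace (K : Type u) (Ω : Type v) [Field K] [Field Ω] [Algebra K Ω] where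
  /-- the valuation ring -/
  ring : ValuationSubring Ω
  /-- the residue map -/
  residue : ring →+* AlgebraicClosure Ω
  isUnit_of_residue_ne_zero : ∀ x, residue x ≠ 0 → IsUnit x
  mem_of_isAlgebraic : ∀ x : Ω, IsAlgebraic K x → x ∈ ring
  residue_of_isAlgebraic : ∀ (x : Ω) (hx : IsAlgebraic K x),
    residue ⟨x, mem_of_isAlgebraic x hx⟩ = algebraMap Ω (AlgebraicClosure Ω) x

namespace ConstPlace

open Polynomial

variable {K : Type u} [Field K] (f : RatFunc K) {Ω : Type v} [Field Ω] [Algebra K Ω]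
  (v : ConstPlace K Ω)

/-- The inclusion of the constants in the valuation ring. -/
def const : K →+* v.ring :=
  (algebraMap K Ω).codRestrict v.ring fun x => v.mem_of_isAlgebraic _ (isAlgebraic_algebraMap x)

theorem residue_comp_const : v.residue.comp v.const = algebraMap K (AlgebraicClosure Ω) := by
  ext x
  exact (v.residue_of_isAlgebraic _ (isAlgebraic_algebraMap x)).trans
    (IsScalarTower.algebraMap_apply K Ω (AlgebraicClosure Ω) x).symm

/-- The reduction map on the projective line. -/
def red (x : OnePoint Ω) : OnePoint (AlgebraicClosure Ω) :=
  open scoped Classical in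
  x.elim OnePoint.infty fun x =>
    if h : x ∈ v.ring then (v.residue ⟨x, h⟩ : OnePoint (AlgebraicClosure Ω)) else OnePoint.infty

theorem red_infty : v.red OnePoint.infty = OnePoint.infty := rfl

theorem red_of_mem (x : v.ring) :
    v.red ((x : Ω) : OnePoint Ω) = (v.residue x : OnePoint (AlgebraicClosure Ω)) := by
  simp [red]

theorem red_of_notMem {x : Ω} (h : x ∉ v.ring) : v.red (x : OnePoint Ω) = OnePoint.infty := by
  simp [red, h]

theorem red_pt {r s : v.ring} (h : v.residue r ≠ 0 ∨ v.residue s ≠ 0) :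
    v.red (pt (r : Ω) (s : Ω)) = pt (v.residue r) (v.residue s) := by
  by_cases hs : v.residue s = 0
  · have hr : v.residue r ≠ 0 := by simpa [hs] using h
    rw [hs, pt_zero]
    by_cases hs0 : (s : Ω) = 0
    · rw [hs0, pt_zero, red_infty]
    · rw [pt_of_ne hs0, red_of_notMem]
      intro hmem
      refine hr ?_
      have : r = ⟨(r : Ω) / s, hmem⟩ * s := Subtype.ext (by simp [div_mul_cancel₀ _ hs0])
      rw [this, map_mul, hs, mul_zero]
  · obtain ⟨i, hi⟩ := (v.isUnit_of_residue_ne_zero s hs).exists_right_inv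
    have hi' : (s : Ω) * i = 1 := by exact_mod_cast congrArg (Subtype.val) hi
    have hs0 : (s : Ω) ≠ 0 := left_ne_zero_of_mul_eq_one hi'
    have hinv : (r : Ω) / s = ((r * i : v.ring) : Ω) := by
      rw [div_eq_iff hs0]
      push_cast
      linear_combination -(r : Ω) * hi'
    rw [pt_of_ne hs0, pt_of_ne hs, hinv, red_of_mem]
    congr 1
    rw [map_mul, eq_div_iff hs]
    have := congrArg v.residue hi
    rw [map_mul, map_one] at this
    linear_combination (v.residue r) * this

/-- Every point has homogeneous coordinates in the valuation ring that are not both in the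
maximal ideal. -/
theorem exists_pt_ring (x : OnePoint Ω) : ∃ r s : v.ring,
    (r = 1 ∨ s = 1) ∧ x = pt (r : Ω) (s : Ω) := by
  induction x using OnePoint.rec with
  | infty => exact ⟨1, 0, by simp, by simp [pt_zero]⟩
  | coe x =>
    by_cases h : x ∈ v.ring
    · exact ⟨⟨x, h⟩, 1, by simp, by simp [pt_one]⟩
    · have hx : x ≠ 0 := by rintro rfl; exact h (zero_mem _)
      exact ⟨1, ⟨x⁻¹, (v.ring.mem_or_inv_mem x).resolve_left h⟩, by simp, by
        rw [pt_of_ne (by simpa using hx)]; simp⟩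

theorem red_ratMap (x : OnePoint Ω) :
    v.red (ratMap f Ω x) = ratMap f (AlgebraicClosure Ω) (v.red x) := by
  obtain ⟨r, s, h, rfl⟩ := v.exists_pt_ring x
  have h1 : (r : Ω) ≠ 0 ∨ (s : Ω) ≠ 0 := by rcases h with rfl | rfl <;> simp
  have h2 : v.residue r ≠ 0 ∨ v.residue s ≠ 0 := by rcases h with rfl | rfl <;> simp
  have e : ∀ P : K[X], homEval (algebraMap K Ω) P (degree f) (r : Ω) (s : Ω) =
      ((homEval v.const P (degree f) r s : v.ring) : Ω) := fun P =>
    (map_homEval v.ring.subtype v.const P _ r s).symm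
  have e' : ∀ P : K[X], homEval (algebraMap K (AlgebraicClosure Ω)) P (degree f) (v.residue r)
      (v.residue s) = v.residue (homEval v.const P (degree f) r s) := fun P => by
    rw [map_homEval, residue_comp_const]
  rw [ratMap_pt f h1, red_pt v h2, ratMap_pt f h2, e, e, e', e', red_pt]
  rw [← e', ← e']
  exact homEval_ne_zero_or f h2

theorem iterate_red_ratMap (m : ℕ) (x : OnePoint Ω) :
    v.red ((ratMap f Ω)^[m] x) = (ratMap f (AlgebraicClosure Ω))^[m] (v.red x) := by
  induction m generalizing x with
  | zero => rfl
  | succ m ih => rw [Function.iterate_succ_apply, Function.iterate_succ_apply, ih, red_ratMap]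

/-- Two congruent points with equal images under `A / B` are congruent to a zero of the
Wronskian of `A` and `B`. -/
theorem eval₂_wronskian_eq_zero {A B : K[X]} {x y : v.ring} (hne : x ≠ y)
    (hxy : v.residue x = v.residue y)
    (h : A.eval₂ v.const x * B.eval₂ v.const y = A.eval₂ v.const y * B.eval₂ v.const x) :
    (wronskian A B).eval₂ (algebraMap K (AlgebraicClosure Ω)) (v.residue x) = 0 := by
  obtain ⟨z, rfl⟩ : ∃ z, y = x + z := ⟨y - x, by ring⟩
  have hz : z ≠ 0 := by rintro rfl; simp at hne
  have hrz : v.residue z = 0 := by simpa using hxy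
  obtain ⟨k, hk⟩ := binomExpansion (A.map v.const) x z
  obtain ⟨l, hl⟩ := binomExpansion (B.map v.const) x z
  rw [← eval_map, ← eval_map, ← eval_map, ← eval_map, hk, hl] at h
  have key : ((wronskian A B).map v.const).eval x =
      z * (k * (B.map v.const).eval x - (A.map v.const).eval x * l) := by
    refine mul_left_cancel₀ hz ?_
    simp only [wronskian, Polynomial.map_sub, Polynomial.map_mul, eval_sub, eval_mul,
      ← derivative_map]
    linear_combination h
  rw [← residue_comp_const, ← hom_eval₂, ← eval_map, key, map_mul, hrz, zero_mul]

/-- Two distinct points of a fibre of `f` can only be congruent to each other at a critical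
point. -/
theorem one_lt_ramificationIndex_red (hd : 0 < degree f) {z z' : OnePoint Ω} (hne : z ≠ z')
    (hf : ratMap f Ω z = ratMap f Ω z') (hred : v.red z = v.red z') :
    1 < ramificationIndex f (AlgebraicClosure Ω) (v.red z) := by
  have e : ∀ (P : K[X]) (r s : v.ring), homEval (algebraMap K Ω) P (degree f) (r : Ω) (s : Ω) =
      ((homEval v.const P (degree f) r s : v.ring) : Ω) := fun P r s =>
    (map_homEval v.ring.subtype v.const P _ r s).symm
  obtain ⟨r, s, h, rfl⟩ := v.exists_pt_ring z
  obtain ⟨r', s', h', rfl⟩ := v.exists_pt_ring z'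
  have h1 : (r : Ω) ≠ 0 ∨ (s : Ω) ≠ 0 := by rcases h with rfl | rfl <;> simp
  have h2 : v.residue r ≠ 0 ∨ v.residue s ≠ 0 := by rcases h with rfl | rfl <;> simp
  have h1' : (r' : Ω) ≠ 0 ∨ (s' : Ω) ≠ 0 := by rcases h' with rfl | rfl <;> simp
  have h2' : v.residue r' ≠ 0 ∨ v.residue s' ≠ 0 := by rcases h' with rfl | rfl <;> simp
  rw [ratMap_pt f h1, ratMap_pt f h1', pt_eq_pt_iff (homEval_ne_zero_or f h1)
    (homEval_ne_zero_or f h1'), e, e, e, e] at hf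
  have hf : homEval v.const f.num (degree f) r s * homEval v.const f.denom (degree f) r' s' =
      homEval v.const f.num (degree f) r' s' * homEval v.const f.denom (degree f) r s :=
    Subtype.ext hf
  rw [red_pt v h2, red_pt v h2', pt_eq_pt_iff h2 h2'] at hred
  rw [red_pt v h2]
  rw [Ne, pt_eq_pt_iff h1 h1'] at hne
  -- the two points lie in a common affine chart
  have chart1 : ∀ r r' : v.ring, r ≠ r' → v.residue r = v.residue r' →
      homEval v.const f.num (degree f) r 1 * homEval v.const f.denom (degree f) r' 1 =
      homEval v.const f.num (degree f) r' 1 * homEval v.const f.denom (degree f) r 1 →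
      1 < ramificationIndex f (AlgebraicClosure Ω) (pt (v.residue r) 1) := by
    intro r r' hne hr hh
    rw [pt_one]
    refine one_lt_ramificationIndex_coe f hd ?_
    refine v.eval₂_wronskian_eq_zero hne hr ?_
    simpa only [homEval_one_right _ (natDegree_num_le f),
      homEval_one_right _ (natDegree_denom_le f)] using hh
  by_cases hs : v.residue s = 0
  · obtain rfl : r = 1 := h.resolve_right (by rintro rfl; simp at hs)
    have hs' : v.residue s' = 0 := by simpa [hs] using hred
    obtain rfl : r' = 1 := h'.resolve_right (by rintro rfl; simp at hs')
    rw [hs, pt_zero]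
    refine one_lt_ramificationIndex_infty f hd ?_
    have := v.eval₂_wronskian_eq_zero (A := reflect (degree f) f.num)
      (B := reflect (degree f) f.denom) (x := s) (y := s')
      (by rintro rfl; exact hne rfl) (by rw [hs, hs'])
      (by simpa only [homEval_one_left _ (natDegree_num_le f),
        homEval_one_left _ (natDegree_denom_le f)] using hf)
    rw [hs, eval₂_at_zero] at this
    rw [← coeff_zero_eq_eval_zero]
    exact (map_eq_zero _).1 this
  · have hs' : v.residue s' ≠ 0 := by
      intro hs'
      rw [hs', mul_zero] at hred
      have : v.residue r' = 0 := (mul_eq_zero.1 hred.symm).resolve_right hs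
      simp [this, hs'] at h2'
    have norm : ∀ r s : v.ring, v.residue s ≠ 0 → ∃ u i : v.ring, s * i = 1 ∧ r = s * u := by
      intro r s hs
      obtain ⟨i, hi⟩ := (v.isUnit_of_residue_ne_zero s hs).exists_right_inv
      exact ⟨i * r, i, hi, by rw [← mul_assoc, hi, one_mul]⟩
    obtain ⟨u, i, hi, rfl⟩ := norm r s hs
    obtain ⟨u', i', hi', rfl⟩ := norm r' s' hs'
    have hs0 : s ≠ 0 := left_ne_zero_of_mul_eq_one hi
    have hs0' : s' ≠ 0 := left_ne_zero_of_mul_eq_one hi'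
    have hpt : pt (v.residue (s * u)) (v.residue s) = pt (v.residue u) 1 := by
      rw [pt_eq_pt_iff h2 (by simp), map_mul]; ring
    rw [hpt]
    have hh : ∀ (P : K[X]) (s u : v.ring), homEval v.const P (degree f) (s * u) s =
        s ^ degree f * homEval v.const P (degree f) u 1 := fun P s u => by
      rw [← homEval_mul, mul_one]
    refine chart1 u u' ?_ ?_ ?_
    · rintro rfl
      refine hne ?_
      push_cast
      ring
    · have := mul_ne_zero hs hs'
      refine mul_left_cancel₀ this ?_
      rw [map_mul, map_mul] at hred
      linear_combination hred
    · refine mul_left_cancel₀ (mul_ne_zero (pow_ne_zero (degree f) hs0)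
        (pow_ne_zero (degree f) hs0')) ?_
      rw [hh, hh, hh, hh] at hf
      linear_combination hf

/-- At a place reducing the transcendental element `t` to an element `a` that is not post-critical,
reduction is a bijection between the fibres of the iterates of `f`: it is injective as no critical
point lies over `a`, and the fibre over `t` already has the maximal number of points. -/
theorem bijOn_red [IsSepClosed Ω] (hd : 0 < degree f)
    (hW : wronskian f.num f.denom ≠ 0) {t a : Ω} (ht : Transcendental K t)
    (ha : ¬ IsPostCritical f a)
    (hta : v.red (t : OnePoint Ω) =
      ((algebraMap Ω (AlgebraicClosure Ω) a : AlgebraicClosure Ω) : OnePoint _)) (m : ℕ) :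
    Set.BijOn v.red {x | (ratMap f Ω)^[m] x = (t : OnePoint Ω)}
      {c | (ratMap f (AlgebraicClosure Ω))^[m] c =
        ((algebraMap Ω (AlgebraicClosure Ω) a : AlgebraicClosure Ω) : OnePoint _)} := by
  induction m with
  | zero =>
    refine ⟨?_, ?_, ?_⟩
    · rintro x rfl; exact hta
    · rintro x rfl y rfl _; rfl
    · rintro c rfl; exact ⟨_, rfl, hta⟩
  | succ m ih =>
    obtain ⟨-, hinj, hsurj⟩ := ih
    refine ⟨fun x hx => ?_, fun x hx y hy hxy => ?_, fun c hc => ?_⟩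
    · change _ = _
      rw [← iterate_red_ratMap, hx, hta]
    · have h1 : ratMap f Ω x = ratMap f Ω y := by
        refine hinj hx hy ?_
        rw [red_ratMap, red_ratMap, hxy]
      by_contra hne
      refine (unramified_and_rational_of_iterate f hd ha (m + 1) ?_).1 (by omega)
        (v.one_lt_ramificationIndex_red f hd hne h1 hxy)
      rw [← iterate_red_ratMap, hx, hta]
    · obtain ⟨w, hw, hwc⟩ := hsurj (a := ratMap f _ c) hc
      obtain ⟨w, rfl, hwt⟩ := transcendental_of_iterate f ht m hw
      have hsub : v.red '' {x | ratMap f Ω x = (w : OnePoint Ω)} ⊆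
          {c' | ratMap f (AlgebraicClosure Ω) c' = ratMap f (AlgebraicClosure Ω) c} := by
        rintro _ ⟨x, hx, rfl⟩
        change _ = _
        rw [← red_ratMap, hx, hwc]
      have hinj' : Set.InjOn v.red {x | ratMap f Ω x = (w : OnePoint Ω)} := by
        intro x hx y hy hxy
        by_contra hne
        refine (unramified_and_rational_of_iterate f hd ha (m + 1) ?_).1 (by omega)
          (v.one_lt_ramificationIndex_red f hd hne (hx.trans hy.symm) hxy)
        rw [Function.iterate_succ_apply, ← red_ratMap, hx, hwc]
        exact hc
      obtain ⟨hfin, hcard⟩ :=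
        fiber_finite_and_ncard_le f hd (ratMap f (AlgebraicClosure Ω) c)
      have heq := Set.eq_of_subset_of_ncard_le hsub (by
        rwa [hinj'.ncard_image, ncard_ratMap_eq f hd hW hwt]) hfin
      have hcm : c ∈ {c' | ratMap f (AlgebraicClosure Ω) c' =
        ratMap f (AlgebraicClosure Ω) c} := rfl
      rw [← heq] at hcm
      obtain ⟨x, hx, hxc⟩ := hcm
      refine ⟨x, ?_, hxc⟩
      change _ = _
      rw [Function.iterate_succ_apply, show ratMap f Ω x = _ from hx]
      exact hw

/-- Reduction commutes with the elements of the decomposition group of the place, at points whose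
reduction is the image of an algebraic point. -/
theorem red_apply_of_red_eq (δ : Ω ≃ₐ[K] Ω) (hδ : ∀ x, δ x ∈ v.ring ↔ x ∈ v.ring)
    {x : Ω} {y : OnePoint Ω} (hy : ∀ w : Ω, y = (w : OnePoint Ω) → IsAlgebraic K w)
    (h : v.red (x : OnePoint Ω) = OnePoint.map (algebraMap Ω (AlgebraicClosure Ω)) y) :
    v.red (δ x : OnePoint Ω) =
      OnePoint.map (algebraMap Ω (AlgebraicClosure Ω)) (OnePoint.map δ y) := by
  induction y using OnePoint.rec with
  | infty =>
    rw [OnePoint.map_infty, OnePoint.map_infty]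
    refine v.red_of_notMem fun hmem => ?_
    have := v.red_of_mem ⟨x, (hδ x).1 hmem⟩
    rw [h, OnePoint.map_infty] at this
    exact OnePoint.infty_ne_coe _ this
  | coe y =>
    have hya := hy y rfl
    have hδy : IsAlgebraic K (δ y) := hya.algHom δ.toAlgHom
    have hx : x ∈ v.ring := by
      by_contra hx
      rw [v.red_of_notMem hx] at h
      exact OnePoint.infty_ne_coe _ h
    have h := (v.red_of_mem ⟨x, hx⟩).symm.trans h
    rw [OnePoint.map_some, OnePoint.coe_eq_coe, ← v.residue_of_isAlgebraic y hya] at h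
    have hδx : δ x ∈ v.ring := (hδ x).2 hx
    rw [OnePoint.map_some, OnePoint.map_some, v.red_of_mem ⟨δ x, hδx⟩, OnePoint.coe_eq_coe,
      ← v.residue_of_isAlgebraic (δ y) hδy, ← sub_eq_zero, ← map_sub]
    by_contra hne
    obtain ⟨i, hi⟩ := (v.isUnit_of_residue_ne_zero _ hne).exists_right_inv
    have hi' : (δ x - δ y) * (i : Ω) = 1 := congrArg Subtype.val hi
    have hi2 : (x - y) * δ.symm i = 1 := δ.injective (by simpa using hi')
    have hmem : δ.symm i ∈ v.ring := (hδ _).1 (by simp)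
    have hz : v.residue (⟨x, hx⟩ - ⟨y, v.mem_of_isAlgebraic y hya⟩) = 0 := by
      rw [map_sub, h, sub_self]
    have h1 : (⟨x, hx⟩ - ⟨y, v.mem_of_isAlgebraic y hya⟩) * (⟨δ.symm i, hmem⟩ : v.ring) = 1 :=
      Subtype.ext hi2
    have := congrArg v.residue h1
    rw [map_mul, hz, zero_mul, map_one] at this
    exact zero_ne_one this

/-- An element of the decomposition group of the place fixes the fibre over `t` pointwise if and
only if it fixes the fibre over the reduction of `t` pointwise. -/
theorem fixes_fiber_iff [IsSepClosed Ω] (hd : 0 < degree f)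
    (hW : wronskian f.num f.denom ≠ 0) {t a : Ω} (ht : Transcendental K t)
    (haK : IsAlgebraic K a) (ha : ¬ IsPostCritical f a)
    (hta : v.red (t : OnePoint Ω) =
      ((algebraMap Ω (AlgebraicClosure Ω) a : AlgebraicClosure Ω) : OnePoint _)) (m : ℕ)
    (δ : Ω ≃ₐ[K] Ω) (hδ : ∀ x, δ x ∈ v.ring ↔ x ∈ v.ring) (hδt : δ t = t) :
    (∀ x ∈ fiber f m t, δ x = x) ↔ ∀ y ∈ fiber f m a, δ y = y := by
  obtain ⟨hmaps, hinj, hsurj⟩ := v.bijOn_red f hd hW ht ha hta m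
  set j := algebraMap Ω (AlgebraicClosure Ω)
  have hiter : ∀ y : OnePoint Ω, (ratMap f (AlgebraicClosure Ω))^[m] (OnePoint.map j y) =
      OnePoint.map j ((ratMap f Ω)^[m] y) := fun y =>
    iterate_ratMap_map f (IsScalarTower.toAlgHom K Ω (AlgebraicClosure Ω)) m y
  have hjinj : Function.Injective (OnePoint.map j) :=
    Option.map_injective j.injective
  constructor
  · intro h y hy
    have hy' : (ratMap f (AlgebraicClosure Ω))^[m] (OnePoint.map j (y : OnePoint Ω)) =
        (j a : OnePoint _) := by
      rw [hiter, show (ratMap f Ω)^[m] (y : OnePoint Ω) = (a : OnePoint Ω) from hy,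
        OnePoint.map_some]
    obtain ⟨x, hx, hxy⟩ := hsurj hy'
    obtain ⟨x, rfl, -⟩ := transcendental_of_iterate f ht m hx
    have h1 := v.red_apply_of_red_eq δ hδ (y := (y : OnePoint Ω)) (by
      intro w hw
      rw [← OnePoint.coe_injective hw]
      exact isAlgebraic_of_mem_fiber f hd haK m hy) hxy
    rw [h x hx, hxy] at h1
    exact (OnePoint.coe_injective (hjinj h1)).symm
  · intro h x hx
    have hx' := hmaps hx
    obtain ⟨y, hy⟩ := (unramified_and_rational_of_iterate f hd ha m hx').2
    have hya : (ratMap f Ω)^[m] y = (a : OnePoint Ω) := by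
      refine hjinj ?_
      rw [← hiter, ← hy]
      exact hx'
    have hfix : OnePoint.map δ y = y := by
      induction y using OnePoint.rec with
      | infty => rfl
      | coe y => rw [OnePoint.map_some, h y hya]
    have h1 := v.red_apply_of_red_eq δ hδ (y := y) (by
      rintro w rfl
      exact isAlgebraic_of_mem_fiber f hd haK m hya) hy
    rw [hfix, ← hy] at h1
    refine OnePoint.coe_injective (hinj ?_ hx h1)
    have := iterate_ratMap_map f δ.toAlgHom m (x : OnePoint Ω)
    rw [show (ratMap f Ω)^[m] (x : OnePoint Ω) = (t : OnePoint Ω) from hx] at this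
    change (ratMap f Ω)^[m] (δ x : OnePoint Ω) = (t : OnePoint Ω)
    refine this.trans ?_
    rw [OnePoint.map_some]
    exact congrArg _ hδt

end ConstPlace

/-! ### Galois theory over a rational function field -/

section FieldTheory

variable {K : Type u} [Field K] {Ω : Type v} [Field Ω] [Algebra K Ω] {t : Ω}

theorem isGalois_of_mem (hΩ : IsSepClosure K⟮t⟯ Ω) {F : IntermediateField K Ω} (htF : t ∈ F) :
    IsGalois F Ω := by
  have hle : K⟮t⟯ ≤ F := by rwa [IntermediateField.adjoin_simple_le_iff]
  let : Algebra K⟮t⟯ F := (IntermediateField.inclusion hle).toAlgebra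
  have : IsScalarTower K⟮t⟯ F Ω := IsScalarTower.of_algebraMap_eq fun _ => rfl
  have := hΩ.separable
  have := hΩ.sep_closed
  have : Algebra.IsSeparable F Ω := Algebra.isSeparable_tower_top_of_isSeparable K⟮t⟯ F Ω
  have : IsSepClosure F Ω := ⟨inferInstance, inferInstance⟩
  exact IsSepClosure.isGalois

theorem mem_of_forall_fixed (hΩ : IsSepClosure K⟮t⟯ Ω) {F : IntermediateField K Ω} (htF : t ∈ F)
    {x : Ω} (h : ∀ σ ∈ F.fixingSubgroup, σ x = x) : x ∈ F := by
  have := isGalois_of_mem hΩ htF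
  obtain ⟨y, rfl⟩ := (InfiniteGalois.mem_range_algebraMap_iff_fixed (k := F) x).2 fun σ =>
    h (σ.restrictScalars K) fun y => σ.commutes y
  exact y.2

theorem transcendental_of_le (ht : Transcendental K t) {F : IntermediateField K Ω}
    (hF : F ≤ algebraicClosure K Ω) : Transcendental F t := by
  have : Algebra.IsAlgebraic K F := ⟨fun x =>
    (isAlgebraic_algebraMap_iff (A := Ω) (algebraMap F Ω).injective).1
      (show IsIntegral K (x : Ω) from hF x.2).isAlgebraic⟩
  exact fun h => ht (h.restrictScalars K)

theorem mem_sup_adjoin_iff {F : IntermediateField K Ω} {x : Ω} : x ∈ F ⊔ K⟮t⟯ ↔ x ∈ F⟮t⟯ := by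
  rw [← IntermediateField.restrictScalars_adjoin_eq_sup, IntermediateField.mem_restrictScalars]

/-- Elements of `F(t)` are quotients of coprime polynomials. -/
theorem exists_polynomial_quotient {F : IntermediateField K Ω} (ht : Transcendental F t) {x : Ω}
    (hx : x ∈ F ⊔ K⟮t⟯) : ∃ p q : Polynomial F, IsCoprime p q ∧
      x * Polynomial.aeval t q = Polynomial.aeval t p := by
  rw [mem_sup_adjoin_iff] at hx
  obtain ⟨r, hr⟩ := (RatFunc.algEquivOfTranscendental t ht).surjective ⟨x, hx⟩
  have hr' := congrArg Subtype.val hr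
  rw [RatFunc.algEquivOfTranscendental_apply] at hr'
  refine ⟨r.num, r.denom, r.isCoprime_num_denom, ?_⟩
  have h0 : Polynomial.aeval t r.denom ≠ 0 := fun h =>
    ht ⟨_, r.denom_ne_zero, h⟩
  exact ((div_eq_iff h0).1 hr').symm

/-- The constant field of `F(t)` is `F`. -/
theorem mem_of_mem_sup_of_isAlgebraic (ht : Transcendental K t) {F : IntermediateField K Ω}
    (hF : F ≤ algebraicClosure K Ω) {x : Ω} (hx : x ∈ F ⊔ K⟮t⟯) (hxa : IsAlgebraic K x) :
    x ∈ F := by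
  have htF := transcendental_of_le ht hF
  rw [mem_sup_adjoin_iff] at hx
  obtain ⟨r, hr⟩ := (RatFunc.algEquivOfTranscendental t htF).surjective ⟨x, hx⟩
  have hra : IsAlgebraic F r := by
    rw [← isAlgebraic_algHom_iff (RatFunc.algEquivOfTranscendental t htF).toAlgHom
      (RatFunc.algEquivOfTranscendental t htF).injective,
      ← isAlgebraic_algHom_iff (IntermediateField.val F⟮t⟯) Subtype.val_injective]
    change IsAlgebraic F ((RatFunc.algEquivOfTranscendental t htF r : F⟮t⟯) : Ω)
    rw [hr]
    exact hxa.tower_top F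
  by_contra hxF
  refine RatFunc.transcendental_of_ne_C r ?_ hra
  rintro ⟨c, rfl⟩
  have h1 : RatFunc.algEquivOfTranscendental t htF (algebraMap F (RatFunc F) c) = ⟨x, hx⟩ := hr
  rw [AlgEquiv.commutes] at h1
  have h2 : (c : Ω) = x := congrArg Subtype.val h1
  exact hxF (h2 ▸ c.2)

theorem mem_bot_of_mem_adjoin (ht : Transcendental K t) {x : Ω} (hx : x ∈ K⟮t⟯)
    (hxa : IsAlgebraic K x) : x ∈ (⊥ : IntermediateField K Ω) :=
  mem_of_mem_sup_of_isAlgebraic ht bot_le (by rwa [bot_sup_eq]) hxa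

/-- A field of constants that is stable under the absolute Galois group of `K(t)` is Galois
over `K`: the minimal polynomial over `K(t)` of a constant has constant coefficients. -/
theorem isGalois_of_stable (ht : Transcendental K t) (hΩ : IsSepClosure K⟮t⟯ Ω)
    (N : IntermediateField K Ω) (hN : N ≤ algebraicClosure K Ω)
    (hst : ∀ σ : Ω ≃ₐ[K] Ω, σ t = t → ∀ x ∈ N, σ x ∈ N) : IsGalois K N := by
  have : IsGalois K⟮t⟯ Ω := isGalois_of_mem hΩ (IntermediateField.mem_adjoin_simple_self K t)
  have main : ∀ x : N, (minpoly K x).Separable ∧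
      ((minpoly K x).map (algebraMap K N)).Splits := by
    intro x
    have hxa : IsIntegral K (x : Ω) := hN x.2
    have hxN : IsIntegral K x := (isIntegral_algebraMap_iff (algebraMap N Ω).injective).1 hxa
    have hxt : IsIntegral K⟮t⟯ (x : Ω) := hxa.tower_top
    set m := minpoly K⟮t⟯ (x : Ω) with hm
    have hmm : m.Monic := minpoly.monic hxt
    have hlift : m ∈ Polynomial.lifts (algebraMap K K⟮t⟯) := by
      rw [Polynomial.lifts_iff_coeff_lifts]
      intro i
      have hi : IsIntegral K (m.coeff i) := Polynomial.isIntegral_coeff_of_dvd _ _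
        (minpoly.monic hxa) hmm (minpoly.dvd_map_of_isScalarTower K K⟮t⟯ (x : Ω)) i
      obtain ⟨c, hc⟩ := IntermediateField.mem_bot.1
        (mem_bot_of_mem_adjoin ht (m.coeff i).2 (hi.algebraMap (B := Ω)).isAlgebraic)
      exact ⟨c, Subtype.ext hc⟩
    obtain ⟨m0, hm0, -, hm0m⟩ := Polynomial.lifts_and_natDegree_eq_and_monic hlift hmm
    have hirr : Irreducible m0 := by
      refine hm0m.irreducible_of_irreducible_map (algebraMap K K⟮t⟯) _ ?_
      rw [hm0]
      exact minpoly.irreducible hxt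
    have hroot : Polynomial.aeval (x : Ω) m0 = 0 := by
      rw [← Polynomial.aeval_map_algebraMap K⟮t⟯, hm0, hm, minpoly.aeval]
    have hroot' : Polynomial.aeval x m0 = 0 :=
      (algebraMap N Ω).injective (by
        rw [← Polynomial.aeval_algebraMap_apply, map_zero]; exact hroot)
    have hmin : m0 = minpoly K x := minpoly.eq_of_irreducible_of_monic hirr hroot' hm0m
    rw [← hmin]
    refine ⟨?_, ?_⟩
    · have : m.Separable := Algebra.IsSeparable.isSeparable K⟮t⟯ (x : Ω)
      rw [← hm0] at this
      exact (Polynomial.separable_map _).1 this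
    · have hsp : (m0.map (algebraMap K Ω)).Splits := by
        rw [IsScalarTower.algebraMap_eq K K⟮t⟯ Ω, ← Polynomial.map_map, hm0]
        exact Normal.splits inferInstance _
      rw [IntermediateField.splits_iff_mem hsp]
      intro y hy
      have hy0 : Polynomial.aeval y m = 0 := by
        rw [← hm0, Polynomial.aeval_map_algebraMap]
        exact Polynomial.aeval_eq_zero_of_mem_rootSet hy
      obtain ⟨σ, hσ⟩ := minpoly.exists_algEquiv_of_root hxt.isAlgebraic hy0
      have hy' : y = σ.symm (x : Ω) := by rw [← hσ, AlgEquiv.symm_apply_apply]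
      rw [hy']
      exact hst (σ.symm.restrictScalars K)
        (σ.symm.commutes (IntermediateField.AdjoinSimple.gen K t)) _ x.2
  have hint : ∀ x : N, IsIntegral K x := fun x =>
    (isIntegral_algebraMap_iff (algebraMap N Ω).injective).1 (hN x.2)
  have : Normal K N := normal_iff.2 fun x => ⟨hint x, (main x).2⟩
  have : Algebra.IsSeparable K N := ⟨fun x => (main x).1⟩
  exact ⟨⟩

/-- A neighbourhood of the identity in the Krull topology contains all automorphisms fixing some
finite set. -/
theorem exists_finset_fixing_mem {k N : Type*} [Field k] [Field N] [Algebra k N]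
    {U : Set Gal(N/k)} (hU : U ∈ nhds 1) :
    ∃ S : Finset N, ∀ g : Gal(N/k), (∀ x ∈ S, g x = x) → g ∈ U := by
  classical
  obtain ⟨E, hE, hEU⟩ := (krullTopology_mem_nhds_one_iff k N U).1 hU
  let b := Module.finBasis k E
  refine ⟨Finset.univ.image fun i => (b i : N), fun g hg => hEU ?_⟩
  rw [SetLike.mem_coe, IntermediateField.mem_fixingSubgroup_iff]
  have hlin : g.toLinearMap ∘ₗ E.val.toLinearMap = E.val.toLinearMap :=
    b.ext fun i => hg _ (Finset.mem_image_of_mem _ (Finset.mem_univ i))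
  exact fun x hx => LinearMap.congr_fun hlin ⟨x, hx⟩

/-- If `N` is a Galois extension of `K` and `M` contains `t`, then every automorphism of `N` that
is trivial on `N ∩ M` extends to an automorphism of `Ω` over `M`. Indeed, the image of the
restriction map is compact and has the fixed field `N ∩ M`. -/
theorem exists_extension (hΩ : IsSepClosure K⟮t⟯ Ω) (N : IntermediateField K Ω) [IsGalois K N]
    {M : IntermediateField K Ω} (htM : t ∈ M) (τ : Gal(N/K))
    (hτ : ∀ x : N, (x : Ω) ∈ M → τ x = x) :
    ∃ σ ∈ M.fixingSubgroup, ∀ x : N, σ (x : Ω) = τ x := by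
  have := isGalois_of_mem hΩ htM
  let res : Gal(Ω/M) →* Gal(N/K) :=
    { toFun := fun σ => (σ.restrictScalars K).restrictNormal N
      map_one' := by
        ext x
        exact AlgEquiv.restrictNormal_commutes ((1 : Gal(Ω/M)).restrictScalars K) N x
      map_mul' := fun σ σ' => by
        ext x
        refine (AlgEquiv.restrictNormal_commutes ((σ * σ').restrictScalars K) N x).trans ?_
        change σ (σ' (x : Ω)) = algebraMap N Ω
          ((σ.restrictScalars K).restrictNormal N ((σ'.restrictScalars K).restrictNormal N x))
        rw [AlgEquiv.restrictNormal_commutes, AlgEquiv.restrictNormal_commutes]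
        rfl }
  have hres : ∀ (σ : Gal(Ω/M)) (x : N), ((res σ x : N) : Ω) = σ (x : Ω) := fun σ x =>
    AlgEquiv.restrictNormal_commutes (σ.restrictScalars K) N x
  have hcont : Continuous res := by
    refine continuous_of_continuousAt_one res ?_
    rw [ContinuousAt, map_one]
    intro U hU
    obtain ⟨S, hS⟩ := exists_finset_fixing_mem hU
    have hSf : (⋂ s ∈ S, (MulAction.stabilizer Gal(Ω/M) (s : Ω) : Set Gal(Ω/M))) ∈
        nhds (1 : Gal(Ω/M)) := by
      rw [Filter.biInter_finset_mem]
      exact fun s _ => (stabilizer_isOpen_of_isIntegral _).mem_nhds (one_mem _)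
    refine Filter.mem_map.2 (Filter.mem_of_superset hSf fun σ hσ => hS _ fun s hs => ?_)
    exact Subtype.ext ((hres σ s).trans (Set.mem_iInter₂.1 hσ s hs))
  let H : ClosedSubgroup Gal(N/K) :=
    { res.range with
      isClosed' := by
        have : IsCompact (Set.range res) := isCompact_range hcont
        exact this.isClosed }
  have hmem : τ ∈ (IntermediateField.fixedField (H : Subgroup Gal(N/K))).fixingSubgroup := by
    rw [IntermediateField.mem_fixingSubgroup_iff]
    intro x hx
    refine hτ x (mem_of_forall_fixed hΩ htM fun σ hσ => ?_)
    have := (IntermediateField.mem_fixedField_iff _ _).1 hx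
      (res ((IntermediateField.fixingSubgroupEquiv M) ⟨σ, hσ⟩)) ⟨_, rfl⟩
    rw [← Subtype.coe_inj, hres] at this
    exact this
  rw [InfiniteGalois.fixingSubgroup_fixedField] at hmem
  obtain ⟨σ, hσ⟩ := hmem
  refine ⟨σ.restrictScalars K, fun y => σ.commutes y, fun x => ?_⟩
  rw [← hσ, hres]
  rfl

/-! ### Restriction of automorphisms -/

/-- Restriction to a normal extension `N` of `F` of the automorphisms fixing `F`. -/
def resHom (F : IntermediateField K Ω) (N : IntermediateField F Ω) [Normal F N] :
    F.fixingSubgroup →* Gal(N/F) :=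
  (AlgEquiv.restrictNormalHom N).comp (IntermediateField.fixingSubgroupEquiv F).toMonoidHom

theorem coe_resHom (F : IntermediateField K Ω) (N : IntermediateField F Ω) [Normal F N]
    (σ : F.fixingSubgroup) (x : N) : ((resHom F N σ x : N) : Ω) = σ.1 (x : Ω) :=
  AlgEquiv.restrictNormal_commutes (IntermediateField.fixingSubgroupEquiv F σ) N x

theorem resHom_surjective (hΩ : IsSepClosure K⟮t⟯ Ω) {F : IntermediateField K Ω} (htF : t ∈ F)
    (N : IntermediateField F Ω) [Normal F N] : Function.Surjective (resHom F N) := by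
  have := isGalois_of_mem hΩ htF
  exact (AlgEquiv.restrictNormalHom_surjective Ω).comp
    (IntermediateField.fixingSubgroupEquiv F).surjective

theorem normal_adjoin (hΩ : IsSepClosure K⟮t⟯ Ω) {F : IntermediateField K Ω} (htF : t ∈ F)
    {S : Set Ω} (hS : ∀ σ : Ω ≃ₐ[K] Ω, σ t = t → ∀ x ∈ S, σ x ∈ S) :
    Normal F (IntermediateField.adjoin F S) := by
  have := isGalois_of_mem hΩ htF
  rw [IntermediateField.normal_iff_forall_map_le']
  intro σ
  rw [IntermediateField.adjoin_map]
  refine IntermediateField.adjoin.mono _ _ _ ?_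
  rintro _ ⟨x, hx, rfl⟩
  exact hS (σ.restrictScalars K) (σ.commutes ⟨t, htF⟩) x hx

theorem eq_of_forall_mem_adjoin {F : IntermediateField K Ω} {S : Set Ω} {σ τ : Ω ≃ₐ[K] Ω}
    (hF : ∀ x ∈ F, σ x = τ x) (hS : ∀ x ∈ S, σ x = τ x) {x : Ω}
    (hx : x ∈ IntermediateField.adjoin F S) : σ x = τ x := by
  induction hx using IntermediateField.adjoin_induction with
  | mem x hx => exact hS x hx
  | algebraMap x => exact hF x x.2
  | add x y _ _ hx hy => rw [map_add, map_add, hx, hy]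
  | inv x _ hx => rw [map_inv₀, map_inv₀, hx]
  | mul x y _ _ hx hy => rw [map_mul, map_mul, hx, hy]

theorem resHom_adjoin_eq_iff {F : IntermediateField K Ω} {S : Set Ω}
    [Normal F (IntermediateField.adjoin F S)] {σ τ : F.fixingSubgroup} :
    resHom F (IntermediateField.adjoin F S) σ = resHom F (IntermediateField.adjoin F S) τ ↔
      ∀ x ∈ S, σ.1 x = τ.1 x := by
  constructor
  · intro h x hx
    have := congrArg (fun g => ((g ⟨x, IntermediateField.subset_adjoin F S hx⟩ : _) : Ω)) h
    simpa only [coe_resHom] using this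
  · intro h
    ext x
    rw [coe_resHom, coe_resHom]
    exact eq_of_forall_mem_adjoin (fun y hy => (σ.2 ⟨y, hy⟩).trans (τ.2 ⟨y, hy⟩).symm) h x.2

/-! ### Transitivity on primes -/

/-- The absolute Galois group of `F` permutes transitively the primes of a stable ring with a
given intersection with `F`. -/
theorem exists_map_prime (hΩ : IsSepClosure K⟮t⟯ Ω) {F : IntermediateField K Ω} (htF : t ∈ F)
    (B : Subring Ω) (hB : ∀ σ ∈ F.fixingSubgroup, ∀ x ∈ B, σ x ∈ B) (P Q : Set Ω)
    (P' Q' : Ideal B) [P'.IsPrime] [Q'.IsPrime] (hP : ∀ x : B, (x : Ω) ∈ P ↔ x ∈ P')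
    (hQ : ∀ x : B, (x : Ω) ∈ Q ↔ x ∈ Q')
    (hPQ : ∀ x ∈ B, x ∈ F → (x ∈ P ↔ x ∈ Q)) :
    ∃ σ ∈ F.fixingSubgroup, ∀ x ∈ B, x ∈ P ↔ σ x ∈ Q := by
  have := isGalois_of_mem hΩ htF
  have hB' : ∀ (σ : Gal(Ω/F)), ∀ x ∈ B, σ x ∈ B := fun σ =>
    hB (σ.restrictScalars K) fun y => σ.commutes y
  let : MulSemiringAction Gal(Ω/F) B :=
    { smul := fun σ x => ⟨σ x, hB' σ x x.2⟩
      one_smul := fun x => rfl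
      mul_smul := fun σ τ x => rfl
      smul_zero := fun σ => Subtype.ext (map_zero σ)
      smul_add := fun σ x y => Subtype.ext (map_add σ _ _)
      smul_one := fun σ => Subtype.ext (map_one σ)
      smul_mul := fun σ x y => Subtype.ext (map_mul σ _ _) }
  have hsmul : ∀ (σ : Gal(Ω/F)) (x : B), ((σ • x : B) : Ω) = σ x := fun _ _ => rfl
  let A : Subring B := F.toSubalgebra.toSubring.comap B.subtype
  have hA : ∀ x : B, x ∈ A ↔ (x : Ω) ∈ F := fun _ => Iff.rfl
  have : SMulCommClass Gal(Ω/F) A B := ⟨fun σ a b => Subtype.ext (by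
    have h1 : σ ((a : B) : Ω) = ((a : B) : Ω) := σ.commutes ⟨_, (hA _).1 a.2⟩
    change σ (((a : B) : Ω) * b) = ((a : B) : Ω) * σ b
    rw [map_mul, h1])⟩
  let : TopologicalSpace B := ⊥
  have : DiscreteTopology B := ⟨rfl⟩
  have : ContinuousSMul Gal(Ω/F) B := by
    rw [continuousSMul_iff_stabilizer_isOpen]
    intro x
    convert! stabilizer_isOpen_of_isIntegral (K := F) (x : Ω) using 1
    ext σ
    exact Subtype.ext_iff
  have : Algebra.IsInvariant A B Gal(Ω/F) := ⟨fun b hb => by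
    obtain ⟨y, hy⟩ := (InfiniteGalois.mem_range_algebraMap_iff_fixed (k := F) (b : Ω)).2
      fun σ => congrArg Subtype.val (hb σ)
    exact ⟨⟨b, (hA b).2 (hy ▸ y.2)⟩, rfl⟩⟩
  have hunder : P'.under A = Q'.under A := by
    ext a
    rw [Ideal.mem_comap, Ideal.mem_comap]
    change (a : B) ∈ P' ↔ (a : B) ∈ Q'
    rw [← hP, ← hQ]
    exact hPQ _ (a : B).2 ((hA _).1 a.2)
  obtain ⟨σ, hσ⟩ := Algebra.IsInvariant.exists_smul_of_under_eq_of_profinite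
    (G := Gal(Ω/F)) P' Q' hunder
  refine ⟨σ.restrictScalars K, fun y => σ.commutes y, fun x hx => ?_⟩
  change x ∈ P ↔ ((σ • (⟨x, hx⟩ : B) : B) : Ω) ∈ Q
  rw [hQ, hσ, Ideal.smul_mem_pointwise_smul_iff, ← hP]

/-! ### Linear disjointness and the Frattini subgroup -/

/-- Algebraic extensions with trivial intersection, one of which is Galois, are linearly
disjoint. -/
theorem linearDisjoint_of_inf_eq_bot (L N : IntermediateField K Ω) [IsGalois K N]
    (hL : L ≤ algebraicClosure K Ω) (h : L ⊓ N = ⊥) : L.LinearDisjoint N := by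
  rw [IntermediateField.linearDisjoint_iff']
  have : Algebra.IsIntegral K L.toSubalgebra := ⟨fun x =>
    (isIntegral_algebraMap_iff (B := Ω) Subtype.val_injective).1 (hL x.2)⟩
  have : Algebra.IsIntegral K N.toSubalgebra :=
    inferInstanceAs (Algebra.IsIntegral K N)
  refine Subalgebra.LinearDisjoint.of_linearDisjoint_finite fun A B hA hB hfA hfB => ?_
  have hspan : ∀ (A : Subalgebra K Ω), Module.Finite K A → ∃ S : Set Ω, S.Finite ∧
      S ⊆ A ∧ ∀ E : IntermediateField K Ω, S ⊆ E → A ≤ E.toSubalgebra := by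
    intro A hA
    obtain ⟨S, hS⟩ := hA.fg_top
    refine ⟨Subtype.val '' (S : Set A), S.finite_toSet.image _, ?_, fun E hE x hx => ?_⟩
    · rintro _ ⟨x, -, rfl⟩
      exact x.2
    · have hle : (⊤ : Submodule K A) ≤
          (Subalgebra.toSubmodule E.toSubalgebra).comap A.val.toLinearMap := by
        rw [← hS, Submodule.span_le]
        exact fun s hs => hE ⟨s, hs, rfl⟩
      exact hle (x := ⟨x, hx⟩) Submodule.mem_top
  obtain ⟨S, hSf, hSA, hS⟩ := hspan A hfA
  obtain ⟨T, hTf, hTB, hT⟩ := hspan B hfB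
  have hSL : IntermediateField.adjoin K S ≤ L :=
    IntermediateField.adjoin_le_iff.2 (hSA.trans hA)
  have : FiniteDimensional K (IntermediateField.adjoin K S) := by
    have : Finite S := hSf
    exact IntermediateField.finiteDimensional_adjoin fun x hx => hL (hA (hSA hx))
  -- the Galois closure of `B` in `N`, which is finite over `K`
  let T' : Set N := Subtype.val ⁻¹' T
  have : Finite T' := hTf.preimage Subtype.val_injective.injOn
  let E := FiniteGaloisIntermediateField.adjoin K T'
  have hE : T ⊆ IntermediateField.lift E.toIntermediateField := fun x hx =>
    (IntermediateField.mem_lift (⟨x, hB (hTB hx)⟩ : N)).2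
      (FiniteGaloisIntermediateField.subset_adjoin K T' hx)
  have e := IntermediateField.liftAlgEquiv E.toIntermediateField
  have : FiniteDimensional K (IntermediateField.lift E.toIntermediateField) :=
    Module.Finite.equiv e.toLinearEquiv
  have : IsGalois K (IntermediateField.lift E.toIntermediateField) := IsGalois.of_algEquiv e
  have hdis : (IntermediateField.lift E.toIntermediateField).LinearDisjoint
      (IntermediateField.adjoin K S) := by
    refine IntermediateField.LinearDisjoint.of_inf_eq_bot (le_bot_iff.1 ?_)
    rw [← h, inf_comm]
    exact inf_le_inf hSL (IntermediateField.lift_le _)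
  have hdis' := IntermediateField.linearDisjoint_iff'.1 hdis.symm
  exact (hdis'.of_le_left_of_flat (hS _ (IntermediateField.subset_adjoin K S))).of_le_right_of_flat
    (hT _ hE)

end FieldTheory

/-- A closed subgroup that generates a profinite group together with the Frattini subgroup is
everything: a proper closed subgroup lies in a proper open one, which has finite index and so lies
in a maximal one. -/
theorem eq_top_of_sup_profiniteFrattini {G : Type u} [Group G] [TopologicalSpace G]
    [IsTopologicalGroup G] [CompactSpace G] [TotallyDisconnectedSpace G] (D : Subgroup G)
    (hD : IsClosed (D : Set G)) (h : D ⊔ profiniteFrattini G = ⊤) : D = ⊤ := by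
  by_contra hne
  have hDs := ProfiniteGrp.closedSubgroup_eq_sInf_open ⟨D, hD⟩
  change D = _ at hDs
  obtain ⟨U, ⟨hUo, hDU⟩, hU⟩ : ∃ U ∈ {N : Subgroup G | IsOpen (N : Set G) ∧ D ≤ N}, U ≠ ⊤ := by
    by_contra! hall
    exact hne (hDs.trans (sInf_eq_top.2 hall))
  have hexists : ∀ (n : ℕ) (W : Subgroup G), IsOpen (W : Set G) → W ≠ ⊤ → W.index = n →
      ∃ M : Subgroup G, IsCoatom M ∧ W ≤ M := by
    intro n
    induction n using Nat.strong_induction_on with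
    | _ n ih =>
      intro W hWo hW hn
      by_cases hc : IsCoatom W
      · exact ⟨W, hc, le_rfl⟩
      · obtain ⟨W', hWW', hW'⟩ : ∃ W', W < W' ∧ W' ≠ ⊤ := by
          by_contra! hall
          exact hc ⟨hW, hall⟩
        have := Subgroup.quotient_finite_of_isOpen W hWo
        have : W.FiniteIndex := Subgroup.finiteIndex_of_finite_quotient
        obtain ⟨M, hM, hW'M⟩ := ih W'.index (hn ▸ Subgroup.index_strictAnti hWW') W'
          (Subgroup.isOpen_mono hWW'.le hWo) hW' rfl
        exact ⟨M, hM, hWW'.le.trans hW'M⟩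
  obtain ⟨M, hM, hUM⟩ := hexists _ U hUo hU rfl
  refine hM.1 (top_le_iff.1 (h ▸ sup_le (hDU.trans hUM) ?_))
  exact sInf_le ⟨hM, Subgroup.isOpen_mono hUM hUo⟩

/-! ### Places attached to primes of integral closures -/

section Places

open Polynomial

variable {K : Type u} [Field K] {Ω : Type v} [Field Ω] [Algebra K Ω]

/-- The `u, u⁻¹` lemma: a root `x` of a polynomial over an integrally closed ring `B`, not all of
whose coefficients lie in the ideal `P`, is a quotient of two elements of `B` that do not both lie
in `P`. One descends on the degree: if `c` is the leading coefficient, then `c * x` is integral,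
hence in `B`, and can be absorbed in the next coefficient. -/
theorem exists_quotient_of_root (B : Subring Ω) (hB : ∀ x : Ω, IsIntegral B x → x ∈ B)
    (P : Ideal B) (x : Ω) (n : ℕ) (g : Polynomial B) (hn : g.natDegree ≤ n)
    (hx : aeval x g = 0) (hg : ∃ i, g.coeff i ∉ P) :
    ∃ r s : B, (r ∉ P ∨ s ∉ P) ∧ x * s = r := by
  induction n generalizing g with
  | zero =>
    rw [eq_C_of_natDegree_le_zero hn, aeval_C] at hx
    have h0 : g.coeff 0 = 0 := Subtype.ext hx
    obtain ⟨i, hi⟩ := hg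
    rw [eq_C_of_natDegree_le_zero hn, h0, C_0, coeff_zero] at hi
    exact absurd P.zero_mem hi
  | succ n ih =>
    set c := g.coeff (n + 1) with hc
    have hcx : x * (c : Ω) ∈ B := by
      by_cases h0 : c = 0
      · rw [h0]; simp [B.zero_mem]
      · have hd : g.natDegree = n + 1 := le_antisymm hn (le_natDegree_of_ne_zero h0)
        have := hB _ (isIntegral_leadingCoeff_smul g x hx)
        rwa [leadingCoeff, hd, ← hc, Subring.smul_def, smul_eq_mul, mul_comm] at this
    by_cases hP : (⟨x * (c : Ω), hcx⟩ : B) ∉ P ∨ c ∉ P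
    · exact ⟨_, _, hP, rfl⟩
    · push Not at hP
      set g' : Polynomial B := g - C c * X ^ (n + 1) + C ⟨x * (c : Ω), hcx⟩ * X ^ n with hg'
      refine ih g' ?_ ?_ ?_
      · rw [natDegree_le_iff_coeff_eq_zero]
        intro i hi
        simp only [hg', coeff_add, coeff_sub, coeff_C_mul, coeff_X_pow]
        rcases Nat.lt_or_ge (n + 1) i with h | h
        · rw [coeff_eq_zero_of_natDegree_lt (by omega), if_neg (by omega), if_neg (by omega)]
          simp
        · obtain rfl : i = n + 1 := by omega
          simp [hc]
      · simp only [hg', map_add, map_sub, map_mul, aeval_C, map_pow, aeval_X, hx]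
        change 0 - (c : Ω) * x ^ (n + 1) + x * (c : Ω) * x ^ n = 0
        ring
      · by_contra! hall
        obtain ⟨i, hi⟩ := hg
        refine hi ?_
        have h1 : g.coeff i = g'.coeff i + c * (X ^ (n + 1) : Polynomial B).coeff i
            - ⟨x * (c : Ω), hcx⟩ * (X ^ n : Polynomial B).coeff i := by
          simp only [hg', coeff_add, coeff_sub, coeff_C_mul]; ring
        rw [h1]
        exact P.sub_mem (P.add_mem (hall i) (P.mul_mem_right _ hP.2)) (P.mul_mem_right _ hP.1)

open scoped IntermediateField.algebraAdjoinAdjoin in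
/-- An element algebraic over `K(t)` is a root of a polynomial over `K[t]` whose coefficients have
no common factor. -/
theorem exists_isPrimitive_root {t : Ω} (ht : Transcendental K t) {x : Ω}
    (hx : IsAlgebraic K⟮t⟯ x) :
    ∃ g : Polynomial K[X], g.IsPrimitive ∧ g.eval₂ (aeval t : K[X] →ₐ[K] Ω).toRingHom x = 0 := by
  rw [← IsFractionRing.isAlgebraic_iff (Algebra.adjoin K {t}) K⟮t⟯ Ω] at hx
  obtain ⟨h, hh0, hh⟩ := hx
  let ψ : K[X] →+* Algebra.adjoin K {t} :=
    (aeval (⟨t, Algebra.self_mem_adjoin_singleton K t⟩ : Algebra.adjoin K {t}) :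
      K[X] →ₐ[K] Algebra.adjoin K {t}).toRingHom
  have hψ : Function.Surjective ψ := by
    rintro ⟨y, hy⟩
    rw [Algebra.adjoin_singleton_eq_range_aeval] at hy
    obtain ⟨p, rfl⟩ := hy
    exact ⟨p, Subtype.ext (Subalgebra.aeval_coe _ _ _).symm⟩
  have hcomp : (algebraMap (Algebra.adjoin K {t}) Ω).comp ψ =
      (aeval t : K[X] →ₐ[K] Ω).toRingHom := by
    refine RingHom.ext fun p => ?_
    exact (Subalgebra.aeval_coe _ _ _).symm
  obtain ⟨g, rfl⟩ := map_surjective ψ hψ h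
  have hg0 : g ≠ 0 := by rintro rfl; simp at hh0
  obtain ⟨_⟩ : Nonempty (NormalizedGCDMonoid K[X]) := inferInstance
  refine ⟨g.primPart, isPrimitive_primPart g, ?_⟩
  rw [aeval_def, eval₂_map, hcomp, eq_C_content_mul_primPart g, eval₂_mul, eval₂_C] at hh
  refine (mul_eq_zero.1 hh).resolve_left fun h0 => ht ⟨g.content, ?_, h0⟩
  rwa [Ne, content_eq_zero_iff]

/-- A homomorphism from a ring `B` to `AlgebraicClosure Ω` whose kernel `P` localizes `B` to a
valuation ring extends to a place. -/
theorem exists_constPlace (B : Subring Ω) (φ : B →+* AlgebraicClosure Ω)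
    (hval : ∀ x : Ω, ∃ r s : B, (φ r ≠ 0 ∨ φ s ≠ 0) ∧ x * s = r)
    (hmem : ∀ x : Ω, IsAlgebraic K x → x ∈ B)
    (hφ : ∀ (x : Ω) (hx : IsAlgebraic K x),
      φ ⟨x, hmem x hx⟩ = algebraMap Ω (AlgebraicClosure Ω) x) :
    ∃ v : ConstPlace K Ω, (∀ x : Ω, x ∈ v.ring ↔ ∃ r s : B, φ s ≠ 0 ∧ x * s = r) ∧
      ∀ x : B, v.red ((x : Ω) : OnePoint Ω) = (φ x : OnePoint (AlgebraicClosure Ω)) := by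
  have hne : ∀ s : B, φ s ≠ 0 → (s : Ω) ≠ 0 := fun s hs h0 => hs (by
    rw [show s = 0 from Subtype.ext h0, map_zero])
  let V : ValuationSubring Ω :=
    { carrier := {x | ∃ r s : B, φ s ≠ 0 ∧ x * s = r}
      mul_mem' := by
        rintro x y ⟨r, s, hs, h⟩ ⟨r', s', hs', h'⟩
        exact ⟨r * r', s * s', by rw [map_mul]; exact mul_ne_zero hs hs', by
          push_cast; rw [← h, ← h']; ring⟩
      one_mem' := ⟨1, 1, by simp, by simp⟩
      add_mem' := by
        rintro x y ⟨r, s, hs, h⟩ ⟨r', s', hs', h'⟩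
        exact ⟨r * s' + r' * s, s * s', by rw [map_mul]; exact mul_ne_zero hs hs', by
          push_cast; rw [← h, ← h']; ring⟩
      zero_mem' := ⟨0, 1, by simp, by simp⟩
      neg_mem' := by
        rintro x ⟨r, s, hs, h⟩
        exact ⟨-r, s, hs, by push_cast; rw [← h]; ring⟩
      mem_or_inv_mem' := by
        intro x
        obtain ⟨r, s, hrs, h⟩ := hval x
        by_cases hs : φ s = 0
        · have hr : φ r ≠ 0 := by simpa [hs] using hrs
          refine Or.inr ⟨s, r, hr, ?_⟩
          have hx : x ≠ 0 := by rintro rfl; exact hne r hr (by rw [← h, zero_mul])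
          rw [← h, inv_mul_cancel_left₀ hx]
        · exact Or.inl ⟨r, s, hs, h⟩ }
  have hV : ∀ x : Ω, x ∈ V ↔ ∃ r s : B, φ s ≠ 0 ∧ x * s = r := fun _ => Iff.rfl
  choose r s hs hrs using fun x : V => (hV x).1 x.2
  have key : ∀ (x : V) (r' s' : B), φ s' ≠ 0 → (x : Ω) * s' = r' →
      φ (r x) / φ (s x) = φ r' / φ s' := by
    intro x r' s' hs' h'
    rw [div_eq_div_iff (hs x) hs', ← map_mul, ← map_mul]
    congr 1
    refine Subtype.ext ?_
    push_cast
    rw [← hrs, ← h']; ring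
  let ρ : V →+* AlgebraicClosure Ω :=
    { toFun := fun x => φ (r x) / φ (s x)
      map_one' := by rw [key 1 1 1 (by simp) (by simp)]; simp
      map_zero' := by rw [key 0 0 1 (by simp) (by simp)]; simp
      map_mul' := fun x y => by
        rw [key (x * y) (r x * r y) (s x * s y) (by
          rw [map_mul]; exact mul_ne_zero (hs x) (hs y)) (by
          push_cast; rw [← hrs, ← hrs]; ring), map_mul, map_mul, div_mul_div_comm]
      map_add' := fun x y => by
        rw [key (x + y) (r x * s y + s x * r y) (s x * s y) (by
          rw [map_mul]; exact mul_ne_zero (hs x) (hs y)) (by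
          push_cast; rw [← hrs, ← hrs]; ring), div_add_div _ _ (hs x) (hs y)]
        simp only [map_add, map_mul] }
  have hρ : ∀ (x : V) (r' s' : B), φ s' ≠ 0 → (x : Ω) * s' = r' → ρ x = φ r' / φ s' := key
  have hρB : ∀ (x : B) (hx : (x : Ω) ∈ V), ρ ⟨x, hx⟩ = φ x := fun x hx => by
    rw [hρ ⟨x, hx⟩ x 1 (by simp) (by simp)]; simp
  have hBV : ∀ x ∈ B, x ∈ V := fun x hx => ⟨⟨x, hx⟩, 1, by simp, by simp⟩
  refine ⟨⟨V, ρ, fun x hx => ?_, fun x hx => hBV x (hmem x hx), fun x hx => ?_⟩, hV, fun x => ?_⟩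
  · have hr : φ (r x) ≠ 0 := fun h0 => hx (by
      change φ (r x) / φ (s x) = 0
      rw [h0, zero_div])
    have hx0 : (x : Ω) ≠ 0 := fun h0 => hne _ hr (by rw [← hrs, h0, zero_mul])
    exact IsUnit.of_mul_eq_one ⟨(x : Ω)⁻¹, s x, r x, hr, by
      rw [← hrs, inv_mul_cancel_left₀ hx0]⟩ (Subtype.ext (mul_inv_cancel₀ hx0))
  · exact (hρB ⟨x, hmem x hx⟩ _).trans (hφ x hx)
  · rw [← hρB x (hBV x x.2)]
    exact ConstPlace.red_of_mem _ ⟨(x : Ω), hBV x x.2⟩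

end Places

/-! ### The integral closure of `L[t]` in `Ω` -/

section Integers

variable {K : Type u} [Field K] {Ω : Type v} [Field Ω] [Algebra K Ω]

/-- The integral closure of `L[t]` in `Ω`. -/
def bigIntegers (L : IntermediateField K Ω) (t : Ω) : Subring Ω :=
  (integralClosure (Algebra.adjoin K ((L : Set Ω) ∪ {t})) Ω).toSubring

theorem mem_bigIntegers {L : IntermediateField K Ω} {t x : Ω} :
    x ∈ bigIntegers L t ↔ IsIntegral (Algebra.adjoin K ((L : Set Ω) ∪ {t})) x := Iff.rfl

theorem mem_bigIntegers_of_mem_adjoin {L : IntermediateField K Ω} {t x : Ω}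
    (h : x ∈ Algebra.adjoin K ((L : Set Ω) ∪ {t})) : x ∈ bigIntegers L t :=
  isIntegral_algebraMap (x := (⟨x, h⟩ : Algebra.adjoin K ((L : Set Ω) ∪ {t})))

theorem mem_bigIntegers_of_isAlgebraic {L : IntermediateField K Ω} {t x : Ω}
    (h : IsAlgebraic K x) : x ∈ bigIntegers L t :=
  h.isIntegral.tower_top

theorem self_mem_bigIntegers (L : IntermediateField K Ω) (t : Ω) : t ∈ bigIntegers L t :=
  mem_bigIntegers_of_mem_adjoin (Algebra.subset_adjoin (Or.inr rfl))

theorem mem_bigIntegers_of_isIntegral {L : IntermediateField K Ω} {t x : Ω}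
    (h : IsIntegral (bigIntegers L t) x) : x ∈ bigIntegers L t := by
  have h' : IsIntegral (integralClosure (Algebra.adjoin K ((L : Set Ω) ∪ {t})) Ω) x := h
  exact isIntegral_trans x h'

theorem map_mem_bigIntegers {L : IntermediateField K Ω} {t : Ω} {σ : Ω ≃ₐ[K] Ω}
    (hσ : σ ∈ (funField L t).fixingSubgroup) {x : Ω} (hx : x ∈ bigIntegers L t) :
    σ x ∈ bigIntegers L t := by
  have hle : Algebra.adjoin K ((L : Set Ω) ∪ {t}) ≤ (funField L t).toSubalgebra := by
    refine Algebra.adjoin_le (Set.union_subset (le_sup_left : L ≤ funField L t) ?_)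
    exact Set.singleton_subset_iff.2 ((le_sup_right : K⟮t⟯ ≤ funField L t)
      (IntermediateField.mem_adjoin_simple_self K t))
  refine IsIntegral.map_of_comp_eq (RingHom.id _) (σ : Ω →+* Ω) ?_ (mem_bigIntegers.1 hx)
  ext y
  exact (hσ ⟨y, hle y.2⟩).symm

theorem polynomial_mem_bigIntegers {L : IntermediateField K Ω} {t : Ω}
    (p : Polynomial (algebraicClosure K Ω)) : Polynomial.aeval t p ∈ bigIntegers L t := by
  rw [Polynomial.aeval_eq_sum_range]
  refine sum_mem fun i _ => ?_
  rw [Algebra.smul_def]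
  exact mul_mem
    (mem_bigIntegers_of_isAlgebraic (show IsIntegral K _ from (p.coeff i).2).isAlgebraic)
    (pow_mem (self_mem_bigIntegers L t) i)

/-- A prime containing `t - a` contains a polynomial in `t` if and only if this vanishes at `a`. -/
theorem polynomial_mem_iff {L : IntermediateField K Ω} {t a : Ω} (ha : IsAlgebraic K a)
    (P : Ideal (bigIntegers L t)) [hP : P.IsPrime]
    (hta : ∀ h : t - a ∈ bigIntegers L t, (⟨t - a, h⟩ : bigIntegers L t) ∈ P)
    (p : Polynomial (algebraicClosure K Ω)) :
    (⟨Polynomial.aeval t p, polynomial_mem_bigIntegers p⟩ : bigIntegers L t) ∈ P ↔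
      Polynomial.aeval (⟨a, ha.isIntegral⟩ : algebraicClosure K Ω) p = 0 := by
  let ι : algebraicClosure K Ω →+* bigIntegers L t :=
    (algebraMap (algebraicClosure K Ω) Ω).codRestrict _ fun x =>
      mem_bigIntegers_of_isAlgebraic (show IsIntegral K (x : Ω) from x.2).isAlgebraic
  let t' : bigIntegers L t := ⟨t, self_mem_bigIntegers L t⟩
  set a' : algebraicClosure K Ω := ⟨a, ha.isIntegral⟩
  have h1 : (⟨Polynomial.aeval t p, polynomial_mem_bigIntegers p⟩ : bigIntegers L t) =
      (p.map ι).eval t' := by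
    refine Subtype.ext ?_
    change Polynomial.aeval t p = (bigIntegers L t).subtype ((p.map ι).eval t')
    rw [Polynomial.eval_map, Polynomial.hom_eval₂]
    rfl
  have h2 : (p.map ι).eval (ι a') = ι (Polynomial.aeval a' p) := by
    rw [Polynomial.eval_map, Polynomial.aeval_def, Polynomial.hom_eval₂]
    rfl
  have h3 : (p.map ι).eval t' - (p.map ι).eval (ι a') ∈ P :=
    P.mem_of_dvd (Polynomial.sub_dvd_eval_sub t' (ι a') (p.map ι)) (hta (t' - ι a').2)
  rw [h1]
  constructor
  · intro h
    by_contra hne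
    have h4 : ι (Polynomial.aeval a' p) ∈ P := by
      rw [← h2]
      simpa using P.sub_mem h h3
    exact hP.ne_top (Ideal.eq_top_of_isUnit_mem _ h4 ((IsUnit.mk0 _ hne).map ι))
  · intro h
    rw [h2, h, map_zero, sub_zero] at h3
    exact h3

/-- Two primes containing `t - a` have the same elements in common with `K̄(t)`. -/
theorem mem_iff_mem_of_mem_sup {L : IntermediateField K Ω} {t a : Ω} (ht : Transcendental K t)
    (ha : IsAlgebraic K a) (P Q : Ideal (bigIntegers L t)) [P.IsPrime] [Q.IsPrime]
    (hP : ∀ h : t - a ∈ bigIntegers L t, (⟨t - a, h⟩ : bigIntegers L t) ∈ P)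
    (hQ : ∀ h : t - a ∈ bigIntegers L t, (⟨t - a, h⟩ : bigIntegers L t) ∈ Q)
    (x : bigIntegers L t) (hx : (x : Ω) ∈ algebraicClosure K Ω ⊔ K⟮t⟯) : x ∈ P ↔ x ∈ Q := by
  obtain ⟨p, q, hpq, h⟩ := exists_polynomial_quotient (transcendental_of_le ht le_rfl) hx
  have key : ∀ (P : Ideal (bigIntegers L t)) [P.IsPrime],
      (∀ h : t - a ∈ bigIntegers L t, (⟨t - a, h⟩ : bigIntegers L t) ∈ P) →
      (x ∈ P ↔ Polynomial.aeval (⟨a, ha.isIntegral⟩ : algebraicClosure K Ω) p = 0) := by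
    intro P _ hP
    have h' : x * ⟨Polynomial.aeval t q, polynomial_mem_bigIntegers q⟩ =
        ⟨Polynomial.aeval t p, polynomial_mem_bigIntegers p⟩ := Subtype.ext h
    rw [← polynomial_mem_iff ha P hP, ← h']
    refine ⟨fun hx => P.mul_mem_right _ hx, fun hx => ?_⟩
    refine (Ideal.IsPrime.mem_or_mem inferInstance hx).resolve_right fun hq => ?_
    have hp := hx
    rw [h', polynomial_mem_iff ha P hP] at hp
    rw [polynomial_mem_iff ha P hP] at hq
    obtain ⟨u, v, huv⟩ := hpq
    have := congrArg (Polynomial.aeval (⟨a, ha.isIntegral⟩ : algebraicClosure K Ω)) huv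
    rw [map_add, map_mul, map_mul, hp, hq, mul_zero, mul_zero, add_zero, map_one] at this
    exact zero_ne_one this
  rw [key P hP, key Q hQ]

theorem nonempty_algHom (F κ C : Type*) [Field F] [Field κ] [Field C] [Algebra F κ] [Algebra F C]
    [IsAlgClosed C] [Algebra.IsAlgebraic F κ] : Nonempty (κ →ₐ[F] C) :=
  ⟨IsAlgClosed.lift⟩

/-- A maximal ideal of the integral closure containing `t - a` is the centre of a place with
`t ↦ a`. Its residue field is algebraic over the constants, and so embeds in the algebraic
closure. -/
theorem exists_constPlace_of_isMaximal {L : IntermediateField K Ω} {t a : Ω}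
    (ht : Transcendental K t) (hΩ : IsSepClosure K⟮t⟯ Ω) (hL : L ≤ algebraicClosure K Ω)
    (ha : IsAlgebraic K a) (P : Ideal (bigIntegers L t)) [P.IsMaximal]
    (hta : ∀ h : t - a ∈ bigIntegers L t, (⟨t - a, h⟩ : bigIntegers L t) ∈ P) :
    ∃ v : ConstPlace K Ω,
      (∀ x : Ω, x ∈ v.ring ↔ ∃ r s : bigIntegers L t, s ∉ P ∧ x * s = r) ∧
      v.red (t : OnePoint Ω) =
        ((algebraMap Ω (AlgebraicClosure Ω) a : AlgebraicClosure Ω) : OnePoint _) := by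
  let B := bigIntegers L t
  let ι : algebraicClosure K Ω →+* B :=
    (algebraMap (algebraicClosure K Ω) Ω).codRestrict _ fun x =>
      mem_bigIntegers_of_isAlgebraic (show IsIntegral K (x : Ω) from x.2).isAlgebraic
  obtain ⟨κ, _, π, hπ, hker⟩ : ∃ (κ : Type v) (_ : Field κ) (π : B →+* κ),
      Function.Surjective π ∧ ∀ b, π b = 0 ↔ b ∈ P :=
    ⟨B ⧸ P, Ideal.Quotient.field P, Ideal.Quotient.mk P, Ideal.Quotient.mk_surjective,
      fun _ => Ideal.Quotient.eq_zero_iff_mem⟩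
  let _ : Algebra (algebraicClosure K Ω) κ := (π.comp ι).toAlgebra
  have htκ : π ⟨t, self_mem_bigIntegers L t⟩ =
      algebraMap (algebraicClosure K Ω) κ ⟨a, ha.isIntegral⟩ := by
    change _ = π (ι ⟨a, ha.isIntegral⟩)
    rw [← sub_eq_zero, ← map_sub, hker]
    exact hta (sub_mem (self_mem_bigIntegers L t) (mem_bigIntegers_of_isAlgebraic ha))
  have hA : ∀ y (hy : y ∈ Algebra.adjoin K ((L : Set Ω) ∪ {t})),
      π ⟨y, mem_bigIntegers_of_mem_adjoin hy⟩ ∈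
        (algebraMap (algebraicClosure K Ω) κ).range := by
    intro y hy
    induction hy using Algebra.adjoin_induction with
    | mem y hy =>
      rcases hy with hy | rfl
      · exact ⟨⟨y, hL hy⟩, rfl⟩
      · exact ⟨_, htκ.symm⟩
    | algebraMap c => exact ⟨algebraMap K _ c, rfl⟩
    | add y z hy hz ihy ihz =>
      have := add_mem ihy ihz
      rwa [← map_add] at this
    | mul y z hy hz ihy ihz =>
      have := mul_mem ihy ihz
      rwa [← map_mul] at this
  have halg : Algebra.IsAlgebraic (algebraicClosure K Ω) κ := by
    refine ⟨fun z => ?_⟩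
    obtain ⟨x, rfl⟩ := hπ z
    obtain ⟨p, hp, hpx⟩ := mem_bigIntegers.1 x.2
    let incl : Algebra.adjoin K ((L : Set Ω) ∪ {t}) →+* B :=
      (algebraMap (Algebra.adjoin K ((L : Set Ω) ∪ {t})) Ω).codRestrict _ fun y =>
        mem_bigIntegers_of_mem_adjoin y.2
    have hpx' : p.eval₂ incl x = 0 := by
      refine Subtype.ext ?_
      change (bigIntegers L t).subtype _ = _
      rw [Polynomial.hom_eval₂]
      exact hpx
    have hlift : p.map (π.comp incl) ∈
        Polynomial.lifts (algebraMap (algebraicClosure K Ω) κ) := by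
      rw [Polynomial.lifts_iff_coeff_lifts]
      intro i
      rw [Polynomial.coeff_map]
      exact hA _ (p.coeff i).2
    obtain ⟨q, hq, -, hqm⟩ := Polynomial.lifts_and_natDegree_eq_and_monic hlift (hp.map _)
    refine IsIntegral.isAlgebraic ⟨q, hqm, ?_⟩
    rw [← Polynomial.eval_map, hq, Polynomial.eval_map, ← Polynomial.hom_eval₂, hpx', map_zero]
  obtain ⟨j⟩ := nonempty_algHom (algebraicClosure K Ω) κ (AlgebraicClosure Ω)
  let φ : B →+* AlgebraicClosure Ω := j.toRingHom.comp π
  have hφP : ∀ r : B, φ r = 0 ↔ r ∈ P := fun r => by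
    rw [← hker]
    exact map_eq_zero_iff j.toRingHom j.toRingHom.injective
  have hφK : ∀ (x : Ω) (hx : IsAlgebraic K x), φ ⟨x, mem_bigIntegers_of_isAlgebraic hx⟩ =
      algebraMap Ω (AlgebraicClosure Ω) x := fun x hx => j.commutes ⟨x, hx.isIntegral⟩
  have hval : ∀ x : Ω, ∃ r s : B, (φ r ≠ 0 ∨ φ s ≠ 0) ∧ x * s = r := by
    intro x
    have hsep := hΩ.separable
    obtain ⟨g, hg, hgx⟩ := exists_isPrimitive_root ht
      (Algebra.IsSeparable.isIntegral K⟮t⟯ x).isAlgebraic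
    let ψ : Polynomial K →+* B :=
      ((Polynomial.aeval t : Polynomial K →ₐ[K] Ω).toRingHom).codRestrict _ fun p => by
        have := polynomial_mem_bigIntegers (L := L) (t := t) (p.map (algebraMap K _))
        rwa [Polynomial.aeval_map_algebraMap] at this
    -- the coefficients of a primitive polynomial over a principal ideal ring generate everything
    have hcoeff : ∃ i, (g.map ψ).coeff i ∉ P := by
      by_contra! hall
      obtain ⟨ϖ, hϖ⟩ := (IsPrincipalIdealRing.principal (P.comap ψ)).principal
      have hunit : IsUnit ϖ := hg ϖ (by
        rw [Polynomial.C_dvd_iff_dvd_coeff]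
        intro i
        rw [← Ideal.mem_span_singleton, Ideal.span, ← hϖ, Ideal.mem_comap, ← Polynomial.coeff_map]
        exact hall i)
      have hϖP : ϖ ∈ P.comap ψ := by
        rw [hϖ]; exact Submodule.mem_span_singleton_self ϖ
      exact (inferInstance : (P.comap ψ).IsPrime).ne_top (Ideal.eq_top_of_isUnit_mem _ hϖP hunit)
    obtain ⟨r, s, hrs, h⟩ := exists_quotient_of_root B
      (fun x hx => mem_bigIntegers_of_isIntegral hx) P x _ (g.map ψ) le_rfl (by
        rw [Polynomial.aeval_def, Polynomial.eval₂_map]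
        exact hgx) hcoeff
    refine ⟨r, s, ?_, h⟩
    rwa [Ne, Ne, hφP, hφP]
  obtain ⟨v, hv, hred⟩ := exists_constPlace B φ hval
    (fun x hx => mem_bigIntegers_of_isAlgebraic hx) hφK
  refine ⟨v, fun x => ?_, ?_⟩
  · rw [hv]
    simp only [Ne, hφP]
    rfl
  · have h1 : φ ⟨t, self_mem_bigIntegers L t⟩ = algebraMap Ω (AlgebraicClosure Ω) a := by
      rw [← hφK a ha, ← sub_eq_zero, ← map_sub, hφP]
      exact hta (sub_mem (self_mem_bigIntegers L t) (mem_bigIntegers_of_isAlgebraic ha))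
    rw [← h1]
    exact hred ⟨t, self_mem_bigIntegers L t⟩

end Integers

/-! ### Fields generated by iterated preimages -/

section Orbits

variable {K : Type u} [Field K] {Ω : Type v} [Field Ω] [Algebra K Ω] (f : RatFunc K) {t : Ω}

theorem map_mem_fiber (σ : Ω ≃ₐ[K] Ω) {m : ℕ} {x y : Ω} (hx : x ∈ fiber f m y) :
    σ x ∈ fiber f m (σ y) := by
  have := iterate_ratMap_map f σ.toAlgHom m (x : OnePoint Ω)
  rw [show (ratMap f Ω)^[m] (x : OnePoint Ω) = (y : OnePoint Ω) from hx] at this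
  exact this

theorem map_mem_fiber_of_fixed {σ : Ω ≃ₐ[K] Ω} {y : Ω} (hσ : σ y = y) {m : ℕ} :
    ∀ x ∈ fiber f m y, σ x ∈ fiber f m y := fun x hx => by
  have := map_mem_fiber f σ hx
  rwa [hσ] at this

theorem map_mem_backwardOrbit {σ : Ω ≃ₐ[K] Ω} (hσ : σ t = t) :
    ∀ x ∈ backwardOrbit f t, σ x ∈ backwardOrbit f t := fun x hx => by
  obtain ⟨n, hn⟩ := Set.mem_iUnion.1 hx
  exact Set.mem_iUnion.2 ⟨n, map_mem_fiber_of_fixed f hσ x hn⟩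

theorem self_mem_backwardOrbit : t ∈ backwardOrbit f t := Set.mem_iUnion.2 ⟨0, rfl⟩

theorem fiber_subset_backwardOrbit (m : ℕ) : fiber f m t ⊆ backwardOrbit f t :=
  Set.subset_iUnion (fun n => fiber f n t) m

theorem mem_fixingSubgroup_funField {L : IntermediateField K Ω} {σ : Ω ≃ₐ[K] Ω} :
    σ ∈ (funField L t).fixingSubgroup ↔ (∀ x ∈ L, σ x = x) ∧ σ t = t := by
  constructor
  · intro h
    rw [IntermediateField.mem_fixingSubgroup_iff] at h
    exact ⟨fun x hx => h x ((le_sup_left : L ≤ funField L t) hx),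
      h t ((le_sup_right : K⟮t⟯ ≤ funField L t) (IntermediateField.mem_adjoin_simple_self K t))⟩
  · rintro ⟨h1, h2⟩
    rw [IntermediateField.fixingSubgroup_sup, Subgroup.mem_inf,
      IntermediateField.mem_fixingSubgroup_iff, IntermediateField.mem_fixingSubgroup_iff]
    exact ⟨h1, fun x hx => eq_of_forall_mem_adjoin (τ := 1)
      (F := (⊥ : IntermediateField K Ω)) (S := {t})
      (fun y hy => by
        obtain ⟨c, rfl⟩ := IntermediateField.mem_bot.1 hy
        exact σ.commutes c)
      (by rintro y rfl; exact h2) (by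
        rw [← mem_sup_adjoin_iff, bot_sup_eq]
        exact hx)⟩

theorem self_mem_funField (L : IntermediateField K Ω) (t : Ω) : t ∈ funField L t :=
  (le_sup_right : K⟮t⟯ ≤ funField L t) (IntermediateField.mem_adjoin_simple_self K t)

theorem constField_le_algebraicClosure : constField f t ≤ algebraicClosure K Ω := inf_le_left

theorem eq_on_adjoin_of_eq_on {S : Set Ω} {σ τ : Ω ≃ₐ[K] Ω} (h : ∀ x ∈ S, σ x = τ x) {x : Ω}
    (hx : x ∈ IntermediateField.adjoin K S) : σ x = τ x := by
  have hle : IntermediateField.adjoin K S ≤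
      (IntermediateField.adjoin (⊥ : IntermediateField K Ω) S).restrictScalars K :=
    IntermediateField.adjoin_le_iff.2 (IntermediateField.subset_adjoin _ _)
  refine eq_of_forall_mem_adjoin (F := (⊥ : IntermediateField K Ω)) (fun y hy => ?_) h (hle hx)
  obtain ⟨c, rfl⟩ := IntermediateField.mem_bot.1 hy
  rw [AlgEquiv.commutes, AlgEquiv.commutes]

theorem map_mem_algebraicClosure (σ : Ω ≃ₐ[K] Ω) {x : Ω} (hx : x ∈ algebraicClosure K Ω) :
    σ x ∈ algebraicClosure K Ω :=
  IsIntegral.map σ.toAlgHom (show IsIntegral K x from hx)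

theorem isGalois_algebraicClosure (ht : Transcendental K t) (hΩ : IsSepClosure K⟮t⟯ Ω) :
    IsGalois K (algebraicClosure K Ω) :=
  isGalois_of_stable ht hΩ _ le_rfl fun σ _ _ hx => map_mem_algebraicClosure σ hx

theorem map_mem_constField {σ : Ω ≃ₐ[K] Ω} (hσ : σ t = t) {x : Ω} (hx : x ∈ constField f t) :
    σ x ∈ constField f t := by
  refine ⟨map_mem_algebraicClosure σ hx.1, ?_⟩
  have hle : IntermediateField.adjoin K (backwardOrbit f t) ≤
      (IntermediateField.adjoin K (backwardOrbit f t)).comap σ.toAlgHom :=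
    IntermediateField.adjoin_le_iff.2 fun y hy =>
      IntermediateField.subset_adjoin K _ (map_mem_backwardOrbit f hσ y hy)
  exact hle hx.2

theorem isGalois_constField (ht : Transcendental K t) (hΩ : IsSepClosure K⟮t⟯ Ω) :
    IsGalois K (constField f t) :=
  isGalois_of_stable ht hΩ _ (constField_le_algebraicClosure f) fun _ hσ _ hx =>
    map_mem_constField f hσ hx

/-- Restriction identifies the geometric monodromy group with `Gal(K(f^{-∞}(t)) / K̂_f(t))`: every
automorphism that is trivial on `K̂_f(t)` agrees on the backward orbit of `t` with one that is
trivial on `K̄(t)`. -/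
theorem exists_geometric (ht : Transcendental K t) (hΩ : IsSepClosure K⟮t⟯ Ω) {δ : Ω ≃ₐ[K] Ω}
    (hδ : δ ∈ (funField (constField f t) t).fixingSubgroup) :
    ∃ δ' ∈ (funField (algebraicClosure K Ω) t).fixingSubgroup,
      ∀ x ∈ backwardOrbit f t, δ' x = δ x := by
  have := isGalois_algebraicClosure ht hΩ
  obtain ⟨h1, h2⟩ := mem_fixingSubgroup_funField.1 hδ
  have hE : ∀ {x : Ω}, x ∈ backwardOrbit f t →
      x ∈ IntermediateField.adjoin K (backwardOrbit f t) :=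
    fun hx => IntermediateField.subset_adjoin K _ hx
  obtain ⟨ε, hε, hεδ⟩ := exists_extension hΩ (algebraicClosure K Ω)
    (M := IntermediateField.adjoin K (backwardOrbit f t)) (hE (self_mem_backwardOrbit f))
    (δ.restrictNormal (algebraicClosure K Ω)) (fun x hx => Subtype.ext (by
      refine (AlgEquiv.restrictNormal_commutes δ _ x).trans ?_
      exact h1 (x : Ω) ⟨(x : algebraicClosure K Ω).2, hx⟩))
  rw [IntermediateField.mem_fixingSubgroup_iff] at hε
  have hεδ' : ∀ x ∈ algebraicClosure K Ω, ε x = δ x := fun x hx =>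
    (hεδ ⟨x, hx⟩).trans (AlgEquiv.restrictNormal_commutes δ (algebraicClosure K Ω) ⟨x, hx⟩)
  have hinv : ∀ x ∈ IntermediateField.adjoin K (backwardOrbit f t), ε.symm x = x := fun x hx => by
    rw [AlgEquiv.symm_apply_eq, hε x hx]
  refine ⟨δ * ε⁻¹, mem_fixingSubgroup_funField.2 ⟨fun x hx => ?_, ?_⟩, fun x hx => ?_⟩
  · change δ (ε.symm x) = x
    rw [← hεδ' _ (map_mem_algebraicClosure ε.symm hx), AlgEquiv.apply_symm_apply]
  · change δ (ε.symm t) = t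
    rw [hinv t (hE (self_mem_backwardOrbit f)), h2]
  · change δ (ε.symm x) = δ x
    rw [hinv x (hE hx)]

theorem normal_orbitField (hΩ : IsSepClosure K⟮t⟯ Ω) (L : IntermediateField K Ω) :
    Normal (funField L t) (orbitField f (funField L t) t) :=
  normal_adjoin hΩ (self_mem_funField L t) fun _ hσ => map_mem_backwardOrbit f hσ

theorem map_mem_orbitField {L : IntermediateField K Ω} {σ : Ω ≃ₐ[K] Ω}
    (hσ : σ ∈ (funField L t).fixingSubgroup) {x : Ω} :
    σ x ∈ orbitField f (funField L t) t ↔ x ∈ orbitField f (funField L t) t := by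
  have key : ∀ σ ∈ (funField L t).fixingSubgroup, ∀ x ∈ orbitField f (funField L t) t,
      σ x ∈ orbitField f (funField L t) t := by
    intro σ hσ x hx
    have ht := (mem_fixingSubgroup_funField.1 hσ).2
    rw [IntermediateField.mem_fixingSubgroup_iff] at hσ
    induction hx using IntermediateField.adjoin_induction with
    | mem x hx => exact IntermediateField.subset_adjoin _ _ (map_mem_backwardOrbit f ht x hx)
    | algebraMap x =>
      rw [show σ (algebraMap (funField L t) Ω x) = algebraMap (funField L t) Ω x from hσ x x.2]
      exact IntermediateField.algebraMap_mem _ x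
    | add x y _ _ hx hy => rw [map_add]; exact add_mem hx hy
    | inv x _ hx => rw [map_inv₀]; exact inv_mem hx
    | mul x y _ _ hx hy => rw [map_mul]; exact mul_mem hx hy
  refine ⟨fun h => ?_, key σ hσ x⟩
  have := key σ⁻¹ (inv_mem hσ) _ h
  rwa [← AlgEquiv.mul_apply, inv_mul_cancel, AlgEquiv.one_apply] at this

theorem eq_on_orbitField {L : IntermediateField K Ω} {σ τ : Ω ≃ₐ[K] Ω}
    (hσ : σ ∈ (funField L t).fixingSubgroup) (hτ : τ ∈ (funField L t).fixingSubgroup)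
    (h : ∀ x ∈ backwardOrbit f t, σ x = τ x) {x : Ω} (hx : x ∈ orbitField f (funField L t) t) :
    σ x = τ x := by
  rw [IntermediateField.mem_fixingSubgroup_iff] at hσ hτ
  exact eq_of_forall_mem_adjoin (fun y hy => (hσ y hy).trans (hτ y hy).symm) h hx

theorem finite_fiber (hd : 0 < degree f) (m : ℕ) (y : Ω) : (fiber f m y).Finite := by
  have key : ∀ m : ℕ, {x | (ratMap f Ω)^[m] x = (y : OnePoint Ω)}.Finite := by
    intro m
    induction m with
    | zero => exact Set.finite_singleton (y : OnePoint Ω)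
    | succ m ih =>
      refine (ih.biUnion fun w _ => (fiber_finite_and_ncard_le f hd w).1).subset fun x hx => ?_
      exact Set.mem_biUnion (x := ratMap f Ω x) hx rfl
  exact (key m).preimage OnePoint.coe_injective.injOn

/-- The fields generated by the fibres over a transcendental element increase with the iterate. -/
theorem fiberField_mono (ht : Transcendental K t) [IsSepClosed Ω] (hf : IsTamelyRamified f)
    (F : IntermediateField K Ω) {m n : ℕ} (hmn : m ≤ n) :
    fiberField f F m t ≤ fiberField f F n t := by
  have hW := wronskian_ne_zero f hf
  induction n, hmn using Nat.le_induction with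
  | base => exact le_rfl
  | succ n _ ih =>
    refine ih.trans (IntermediateField.adjoin_le_iff.2 fun y hy => ?_)
    obtain ⟨w, hw, hyt⟩ := transcendental_of_iterate f ht n hy
    obtain rfl := OnePoint.coe_injective hw
    have hcard := ncard_ratMap_eq f hf.1 hW hyt
    obtain ⟨x, hx⟩ := Set.nonempty_of_ncard_ne_zero (hcard ▸ hf.1.ne')
    have hx : ratMap f Ω x = (y : OnePoint Ω) := hx
    obtain ⟨x, rfl, -⟩ := transcendental_of_iterate f hyt 1 hx
    have hxm : x ∈ fiberField f F (n + 1) t := IntermediateField.subset_adjoin F _ (by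
      change (ratMap f Ω)^[n + 1] (x : OnePoint Ω) = t
      rw [Function.iterate_succ_apply, hx]
      exact hy)
    rw [ratMap_coe] at hx
    by_cases hq : Polynomial.aeval x f.denom = 0
    · rw [hq, pt_zero] at hx
      exact absurd hx (OnePoint.infty_ne_coe _)
    · rw [pt_of_ne hq, OnePoint.coe_eq_coe] at hx
      have hmem : ∀ P : Polynomial K, Polynomial.aeval x P ∈ fiberField f F (n + 1) t :=
        fun P => Algebra.adjoin_le
          (S := ((fiberField f F (n + 1) t).restrictScalars K).toSubalgebra)
          (Set.singleton_subset_iff.2 hxm) (Polynomial.aeval_mem_adjoin_singleton K x)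
      rw [← hx]
      exact div_mem (hmem _) (hmem _)

/-- An open subgroup of the Galois group of the field generated by the backward orbit contains all
automorphisms that fix a suitable fibre. -/
theorem exists_fiber_fixing_le (ht : Transcendental K t) [IsSepClosed Ω]
    (hf : IsTamelyRamified f) (F : IntermediateField K Ω) (Φ : Subgroup Gal(orbitField f F t/F))
    (hΦ : IsOpen (Φ : Set Gal(orbitField f F t/F))) :
    ∃ m : ℕ, ∀ g : Gal(orbitField f F t/F),
      (∀ x : orbitField f F t, (x : Ω) ∈ fiber f m t → g x = x) → g ∈ Φ := by
  obtain ⟨S, hS⟩ := exists_finset_fixing_mem (hΦ.mem_nhds (one_mem Φ))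
  have hmem : ∀ x ∈ orbitField f F t, ∃ n, x ∈ fiberField f F n t := by
    intro x hx
    induction hx using IntermediateField.adjoin_induction with
    | mem x hx =>
      obtain ⟨n, hn⟩ := Set.mem_iUnion.1 hx
      exact ⟨n, IntermediateField.subset_adjoin F _ hn⟩
    | algebraMap x => exact ⟨0, IntermediateField.algebraMap_mem _ x⟩
    | add x y _ _ hx hy =>
      obtain ⟨m, hm⟩ := hx
      obtain ⟨n, hn⟩ := hy
      exact ⟨max m n, add_mem (fiberField_mono f ht hf F (le_max_left m n) hm)
        (fiberField_mono f ht hf F (le_max_right m n) hn)⟩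
    | inv x _ hx =>
      obtain ⟨n, hn⟩ := hx
      exact ⟨n, inv_mem hn⟩
    | mul x y _ _ hx hy =>
      obtain ⟨m, hm⟩ := hx
      obtain ⟨n, hn⟩ := hy
      exact ⟨max m n, mul_mem (fiberField_mono f ht hf F (le_max_left m n) hm)
        (fiberField_mono f ht hf F (le_max_right m n) hn)⟩
  choose n hn using fun x : orbitField f F t => hmem x x.2
  refine ⟨S.sup n, fun g hg => hS g fun x hx => ?_⟩
  have hfix : ∀ x (hx : x ∈ fiberField f F (S.sup n) t) (hx' : x ∈ orbitField f F t),
      g ⟨x, hx'⟩ = ⟨x, hx'⟩ := by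
    intro x hx
    have hle : ∀ {y}, y ∈ fiberField f F (S.sup n) t → y ∈ orbitField f F t := fun hy =>
      IntermediateField.adjoin.mono F _ _ (fiber_subset_backwardOrbit f _) hy
    induction hx using IntermediateField.adjoin_induction with
    | mem x hx => exact fun hx' => hg ⟨x, hx'⟩ hx
    | algebraMap x => exact fun hx' => g.commutes x
    | add x y hx hy ihx ihy =>
      intro hx'
      have : (⟨x + y, hx'⟩ : orbitField f F t) = ⟨x, hle hx⟩ + ⟨y, hle hy⟩ := rfl
      rw [this, map_add, ihx, ihy]
    | inv x hx ihx =>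
      intro hx'
      have : (⟨x⁻¹, hx'⟩ : orbitField f F t) = (⟨x, hle hx⟩ : orbitField f F t)⁻¹ := rfl
      rw [this, map_inv₀, ihx]
    | mul x y hx hy ihx ihy =>
      intro hx'
      have : (⟨x * y, hx'⟩ : orbitField f F t) = ⟨x, hle hx⟩ * ⟨y, hle hy⟩ := rfl
      rw [this, map_mul, ihx, ihy]
  exact hfix x (fiberField_mono f ht hf F (Finset.le_sup hx) (hn x)) x.2

/-! ### Galois groups over fields of constants -/

theorem isSepClosure_adjoin (hΩ : IsSepClosure K⟮t⟯ Ω) (F : IntermediateField K Ω) :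
    IsSepClosure F⟮t⟯ Ω := by
  have hle : K⟮t⟯ ≤ (F⟮t⟯).restrictScalars K := by
    rw [IntermediateField.adjoin_simple_le_iff]
    exact IntermediateField.mem_adjoin_simple_self F t
  let _ : Algebra K⟮t⟯ F⟮t⟯ := (IntermediateField.inclusion hle).toRingHom.toAlgebra
  have : IsScalarTower K⟮t⟯ F⟮t⟯ Ω := IsScalarTower.of_algebraMap_eq fun _ => rfl
  have := hΩ.separable
  exact ⟨hΩ.sep_closed, Algebra.isSeparable_tower_top_of_isSeparable K⟮t⟯ F⟮t⟯ Ω⟩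

section Constants

variable {F : IntermediateField K Ω} {S : Set Ω}

theorem adjoin_le_algebraicClosure (hS : ∀ x ∈ S, IsAlgebraic K x) :
    IntermediateField.adjoin F S ≤ algebraicClosure F Ω :=
  IntermediateField.adjoin_le_iff.2 fun x hx => ((hS x hx).tower_top F).isIntegral

theorem isGalois_adjoin_of_isAlgebraic (ht : Transcendental K t) (hΩ : IsSepClosure K⟮t⟯ Ω)
    (hF : F ≤ algebraicClosure K Ω) (hS : ∀ x ∈ S, IsAlgebraic K x)
    (hst : ∀ σ ∈ F.fixingSubgroup, ∀ x ∈ S, σ x ∈ S) :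
    IsGalois F (IntermediateField.adjoin F S) := by
  refine isGalois_of_stable (transcendental_of_le ht hF) (isSepClosure_adjoin hΩ F) _
    (adjoin_le_algebraicClosure hS) fun σ _ x hx => ?_
  have hle : IntermediateField.adjoin F S ≤ (IntermediateField.adjoin F S).comap σ.toAlgHom :=
    IntermediateField.adjoin_le_iff.2 fun y hy => IntermediateField.subset_adjoin F _
      (hst (σ.restrictScalars K) (fun z => σ.commutes z) y hy)
  exact hle hx

/-- Automorphisms of constant extensions of `F` extend to automorphisms over `F(t)`. -/
theorem exists_extension_of_isAlgebraic (ht : Transcendental K t) (hΩ : IsSepClosure K⟮t⟯ Ω)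
    (hF : F ≤ algebraicClosure K Ω) (hS : ∀ x ∈ S, IsAlgebraic K x)
    [IsGalois F (IntermediateField.adjoin F S)] (g : Gal(IntermediateField.adjoin F S/F)) :
    ∃ σ ∈ (funField F t).fixingSubgroup, ∀ x : IntermediateField.adjoin F S,
      σ (x : Ω) = g x := by
  obtain ⟨σ, hσ, hσg⟩ := exists_extension (isSepClosure_adjoin hΩ F)
    (IntermediateField.adjoin F S) (IntermediateField.mem_adjoin_simple_self F t) g (by
      intro x hx
      have hxa : IsAlgebraic F (x : Ω) :=
        (show IsIntegral F (x : Ω) from adjoin_le_algebraicClosure hS x.2).isAlgebraic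
      obtain ⟨c, hc⟩ := IntermediateField.mem_bot.1
        (mem_bot_of_mem_adjoin (transcendental_of_le ht hF) hx hxa)
      have : x = algebraMap F _ c := Subtype.ext hc.symm
      rw [this, AlgEquiv.commutes])
  rw [IntermediateField.mem_fixingSubgroup_iff] at hσ
  exact ⟨σ.restrictScalars K, mem_fixingSubgroup_funField.2
    ⟨fun x hx => σ.commutes ⟨x, hx⟩, hσ t (IntermediateField.mem_adjoin_simple_self F t)⟩, hσg⟩

end Constants

end Orbits

/-- If `p` and `q` have the same kernel and `p` is onto `A`, then `A` is isomorphic to the image of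
`q`. When `B` is finite, any isomorphism of `A` with `B` therefore forces `q` to be surjective, by
counting. -/
theorem nonempty_mulEquiv_iff_surjective {Δ A B : Type*} [Group Δ] [Group A] [Group B] [Finite B]
    (p : Δ →* A) (q : Δ →* B) (hp : Function.Surjective p) (hker : p.ker = q.ker) :
    Nonempty (A ≃* B) ↔ Function.Surjective q := by
  have e1 := (QuotientGroup.quotientKerEquivOfSurjective p hp).symm.trans
    (QuotientGroup.quotientMulEquivOfEq hker)
  constructor
  · rintro ⟨e⟩
    have e2 := e1.trans (QuotientGroup.quotientKerEquivRange q)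
    rw [← MonoidHom.range_eq_top]
    exact Subgroup.eq_top_of_card_eq _ (Nat.card_congr (e2.symm.trans e).toEquiv)
  · intro hq
    exact ⟨e1.trans (QuotientGroup.quotientKerEquivOfSurjective q hq)⟩

theorem isClosed_stabilizer_set {k N : Type*} [Field k] [Field N] [Algebra k N]
    [Algebra.IsIntegral k N] (S : Set N) :
    IsClosed (MulAction.stabilizer Gal(N/k) S : Set Gal(N/k)) := by
  rw [← isOpen_compl_iff, isOpen_iff_mem_nhds]
  intro g hg
  have hg' : ¬ ∀ x, g • x ∈ S ↔ x ∈ S := fun h => hg (MulAction.mem_stabilizer_set.2 h)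
  push Not at hg'
  obtain ⟨x, hx⟩ := hg'
  have hopen : IsOpen (g • (MulAction.stabilizer Gal(N/k) x : Set Gal(N/k))) :=
    (stabilizer_isOpen_of_isIntegral x).smul g
  refine Filter.mem_of_superset (hopen.mem_nhds ⟨1, one_mem _, mul_one g⟩) ?_
  rintro _ ⟨h, hh, rfl⟩ hmem
  have hh' : h • x = x := hh
  have := MulAction.mem_stabilizer_set.1 hmem x
  simp only [smul_eq_mul, mul_smul, hh'] at this
  tauto

/-! ### Lifting and restricting automorphisms -/

section Lifts

variable {K : Type u} [Field K] {Ω : Type v} [Field Ω] [Algebra K Ω] {t : Ω}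

theorem exists_restrict {F : IntermediateField K Ω} (N : IntermediateField F Ω) [Normal F N]
    {σ : Ω ≃ₐ[K] Ω} (hσ : σ ∈ F.fixingSubgroup) :
    ∃ g : Gal(N/F), ∀ x : N, σ (x : Ω) = g x :=
  ⟨resHom F N ⟨σ, hσ⟩, fun x => (coe_resHom F N ⟨σ, hσ⟩ x).symm⟩

theorem exists_lift (hΩ : IsSepClosure K⟮t⟯ Ω) {F : IntermediateField K Ω} (htF : t ∈ F)
    (N : IntermediateField F Ω) [Normal F N] (g : Gal(N/F)) :
    ∃ σ ∈ F.fixingSubgroup, ∀ x : N, σ (x : Ω) = g x := by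
  obtain ⟨⟨σ, hσ⟩, rfl⟩ := resHom_surjective hΩ htF N g
  exact ⟨σ, hσ, fun x => (coe_resHom F N ⟨σ, hσ⟩ x).symm⟩

/-- If a group `D` of automorphisms surjects onto `Gal(F(S)/F)`, and the same elements of `D` are
trivial on `S` and on `T`, then `Gal(F(S)/F) ≃ Gal(M(T)/M)` if and only if `D` surjects onto
the latter group. -/
theorem nonempty_gal_adjoin_iff {F M : IntermediateField K Ω} {S T : Set Ω}
    (D : Subgroup (Ω ≃ₐ[K] Ω)) (hDF : D ≤ F.fixingSubgroup) (hDM : D ≤ M.fixingSubgroup)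
    [Normal F (IntermediateField.adjoin F S)] [Normal M (IntermediateField.adjoin M T)]
    [Finite Gal(IntermediateField.adjoin M T/M)]
    (hlift : ∀ g : Gal(IntermediateField.adjoin M T/M), ∃ σ ∈ M.fixingSubgroup,
      ∀ x : IntermediateField.adjoin M T, σ (x : Ω) = g x)
    (hD : ∀ g : Gal(IntermediateField.adjoin F S/F), ∃ δ ∈ D,
      ∀ x : IntermediateField.adjoin F S, δ (x : Ω) = g x)
    (hker : ∀ δ ∈ D, (∀ x ∈ S, δ x = x) ↔ ∀ x ∈ T, δ x = x) :
    Nonempty (Gal(IntermediateField.adjoin F S/F) ≃* Gal(IntermediateField.adjoin M T/M)) ↔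
      ∀ σ ∈ M.fixingSubgroup, ∃ δ ∈ D, ∀ x ∈ T, δ x = σ x := by
  let p : D →* Gal(IntermediateField.adjoin F S/F) :=
    (resHom F (IntermediateField.adjoin F S)).comp (Subgroup.inclusion hDF)
  let q : D →* Gal(IntermediateField.adjoin M T/M) :=
    (resHom M (IntermediateField.adjoin M T)).comp (Subgroup.inclusion hDM)
  have hp : Function.Surjective p := fun g => by
    obtain ⟨δ, hδ, hδg⟩ := hD g
    refine ⟨⟨δ, hδ⟩, AlgEquiv.ext fun x => Subtype.ext ?_⟩
    exact (coe_resHom F _ ⟨δ, hDF hδ⟩ x).trans (hδg x)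
  have hpq : p.ker = q.ker := by
    ext ⟨δ, hδ⟩
    rw [MonoidHom.mem_ker, MonoidHom.mem_ker, ← map_one (resHom F (IntermediateField.adjoin F S)),
      ← map_one (resHom M (IntermediateField.adjoin M T))]
    exact (resHom_adjoin_eq_iff (σ := ⟨δ, hDF hδ⟩) (τ := 1)).trans
      ((hker δ hδ).trans (resHom_adjoin_eq_iff (σ := ⟨δ, hDM hδ⟩) (τ := 1)).symm)
  rw [nonempty_mulEquiv_iff_surjective p q hp hpq]
  constructor
  · intro hq σ hσ
    obtain ⟨⟨δ, hδ⟩, h⟩ := hq (resHom M _ ⟨σ, hσ⟩)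
    exact ⟨δ, hδ, resHom_adjoin_eq_iff.1 h⟩
  · intro h g
    obtain ⟨σ, hσ, hσg⟩ := hlift g
    obtain ⟨δ, hδ, hδσ⟩ := h σ hσ
    refine ⟨⟨δ, hδ⟩, AlgEquiv.ext fun x => Subtype.ext ?_⟩
    refine (coe_resHom M _ ⟨δ, hDM hδ⟩ x).trans (Eq.trans ?_ (hσg x))
    have h1 := (IntermediateField.mem_fixingSubgroup_iff _ _).1 (hDM hδ)
    have h2 := (IntermediateField.mem_fixingSubgroup_iff _ _).1 hσ
    exact eq_of_forall_mem_adjoin (fun y hy => (h1 y hy).trans (h2 y hy).symm) hδσ x.2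

end Lifts

/-! ### Decomposition groups -/

section Decomposition

variable {K : Type u} [Field K] {Ω : Type v} [Field Ω] [Algebra K Ω] (f : RatFunc K) {t a : Ω}
  {L : IntermediateField K Ω}

/-- The underlying subset of `Ω` of an ideal of the integral closure of `L[t]` in `Ω`. -/
def carrierSet (P : Ideal (bigIntegers L t)) : Set Ω := Subtype.val '' (P : Set (bigIntegers L t))

theorem coe_mem_carrierSet {P : Ideal (bigIntegers L t)} (x : bigIntegers L t) :
    (x : Ω) ∈ carrierSet P ↔ x ∈ P := by
  simp [carrierSet]

theorem mem_bigIntegers_of_mem_carrierSet {P : Ideal (bigIntegers L t)} {x : Ω}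
    (hx : x ∈ carrierSet P) : x ∈ bigIntegers L t := by
  obtain ⟨y, -, rfl⟩ := hx
  exact y.2

/-- The underlying subset of `Ω` of an ideal of the integral closure of `L[t]` in
`L(f^{-∞}(t))`. -/
def idealSet (α : Ideal (integers f L t)) : Set Ω :=
  (fun x : integers f L t => ((x : orbitField f (funField L t) t) : Ω)) ''
    (α : Set (integers f L t))

theorem idealSet_subset {α : Ideal (integers f L t)} {x : Ω} (hx : x ∈ idealSet f α) :
    x ∈ orbitField f (funField L t) t := by
  obtain ⟨y, -, rfl⟩ := hx
  exact (y : orbitField f (funField L t) t).2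

/-- Lying over: the ideal `α` is the trace of a maximal ideal of the integral closure in `Ω`. -/
theorem exists_isMaximal_over {α : Ideal (integers f L t)} (hα : IsMaximalOver f L t a α) :
    ∃ P : Ideal (bigIntegers L t), P.IsMaximal ∧
      (∀ h : t - a ∈ bigIntegers L t, (⟨t - a, h⟩ : bigIntegers L t) ∈ P) ∧
      ∀ x, x ∈ idealSet f α ↔ x ∈ orbitField f (funField L t) t ∧ x ∈ carrierSet P := by
  obtain ⟨hmax, x₀, hx₀, hx₀t⟩ := hα
  let ι : integers f L t →+* bigIntegers L t :=
    ((algebraMap (orbitField f (funField L t) t) Ω).comp (integers f L t).subtype).codRestrict _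
      fun x => x.2
  let _ : Algebra (integers f L t) (bigIntegers L t) := ι.toAlgebra
  have hA : ∀ y ∈ Algebra.adjoin K ((L : Set Ω) ∪ {t}), ∃ z : integers f L t,
      ((z : orbitField f (funField L t) t) : Ω) = y := by
    intro y hy
    have hle : Algebra.adjoin K ((L : Set Ω) ∪ {t}) ≤ (funField L t).toSubalgebra :=
      Algebra.adjoin_le (Set.union_subset (le_sup_left : L ≤ funField L t)
        (Set.singleton_subset_iff.2 (self_mem_funField L t)))
    have hy' : y ∈ orbitField f (funField L t) t :=
      IntermediateField.algebraMap_mem _ (⟨y, hle hy⟩ : funField L t)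
    exact ⟨⟨⟨y, hy'⟩, mem_bigIntegers_of_mem_adjoin hy⟩, rfl⟩
  have : Algebra.IsIntegral (integers f L t) (bigIntegers L t) := by
    refine ⟨fun x => ?_⟩
    obtain ⟨p, hp, hpx⟩ := mem_bigIntegers.1 x.2
    choose z hz using fun y : Algebra.adjoin K ((L : Set Ω) ∪ {t}) => hA y y.2
    have hzinj : Function.Injective fun w : integers f L t =>
        ((w : orbitField f (funField L t) t) : Ω) :=
      Subtype.val_injective.comp Subtype.val_injective
    let ψ : Algebra.adjoin K ((L : Set Ω) ∪ {t}) →+* integers f L t :=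
      { toFun := z
        map_one' := hzinj ((hz 1).trans rfl)
        map_zero' := hzinj ((hz 0).trans rfl)
        map_add' := fun y w => hzinj (by
          change ((z (y + w) : orbitField f (funField L t) t) : Ω) = (z y : _) + (z w : _)
          rw [hz, hz, hz]; rfl)
        map_mul' := fun y w => hzinj (by
          change ((z (y * w) : orbitField f (funField L t) t) : Ω) = (z y : _) * (z w : _)
          rw [hz, hz, hz]; rfl) }
    refine ⟨p.map ψ, hp.map ψ, Subtype.ext ?_⟩
    rw [Polynomial.eval₂_map]
    change (bigIntegers L t).subtype _ = _
    rw [Polynomial.hom_eval₂]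
    refine Eq.trans ?_ hpx
    congr 1
    exact RingHom.ext hz
  have hinj : Function.Injective ι := fun x y h =>
    Subtype.ext (Subtype.ext (congrArg (fun w : bigIntegers L t => (w : Ω)) h))
  obtain ⟨P, hP, hPα⟩ := Ideal.exists_ideal_over_maximal_of_isIntegral (S := bigIntegers L t) α
    (by
      change RingHom.ker ι ≤ α
      rw [(RingHom.injective_iff_ker_eq_bot ι).1 hinj]
      exact bot_le)
  have hmem : ∀ x : integers f L t, x ∈ α ↔ ι x ∈ P := fun x => by
    rw [← hPα]; rfl
  refine ⟨P, hP, fun h => ?_, fun x => ⟨?_, ?_⟩⟩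
  · rw [hmem] at hx₀
    convert hx₀ using 1
    exact Subtype.ext hx₀t.symm
  · rintro ⟨y, hy, rfl⟩
    exact ⟨(y : orbitField f (funField L t) t).2, (coe_mem_carrierSet (ι y)).2 ((hmem y).1 hy)⟩
  · rintro ⟨h1, h2⟩
    have h3 := mem_bigIntegers_of_mem_carrierSet h2
    refine ⟨⟨⟨x, h1⟩, h3⟩, (hmem _).2 ?_, rfl⟩
    exact (coe_mem_carrierSet (⟨x, h3⟩ : bigIntegers L t)).1 h2

/-- An automorphism `σ` over `L(t)` can be moved into the decomposition group of the prime `P` by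
automorphisms over `F`, provided that `σ(P)` and `P` have the same intersection with `F`. -/
theorem exists_mul_stabilizes (hΩ : IsSepClosure K⟮t⟯ Ω) (P : Ideal (bigIntegers L t)) [P.IsPrime]
    {F : IntermediateField K Ω} (hF : funField L t ≤ F) {σ : Ω ≃ₐ[K] Ω}
    (hσ : σ ∈ (funField L t).fixingSubgroup)
    (h : ∀ x ∈ F, (σ⁻¹ x ∈ carrierSet P ↔ x ∈ carrierSet P)) :
    ∃ τ ∈ F.fixingSubgroup, ∀ x, (τ * σ) x ∈ carrierSet P ↔ x ∈ carrierSet P := by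
  have hle : F.fixingSubgroup ≤ (funField L t).fixingSubgroup :=
    IntermediateField.fixingSubgroup_le hF
  let ι : bigIntegers L t →+* bigIntegers L t :=
    ((σ⁻¹ : Ω ≃ₐ[K] Ω).toRingHom.comp (bigIntegers L t).subtype).codRestrict _ fun x =>
      map_mem_bigIntegers (inv_mem hσ) x.2
  have : (P.comap ι).IsPrime := Ideal.comap_isPrime ι P
  obtain ⟨τ, hτ, hτP⟩ := exists_map_prime hΩ (hF (self_mem_funField L t)) (bigIntegers L t)
    (fun τ hτ x hx => map_mem_bigIntegers (hle hτ) hx)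
    {x | (σ⁻¹ : Ω ≃ₐ[K] Ω) x ∈ carrierSet P} (carrierSet P)
    (P.comap ι) P (fun x => coe_mem_carrierSet (ι x)) coe_mem_carrierSet (fun x _ hx => h x hx)
  refine ⟨τ, hτ, fun x => ?_⟩
  have hτσ : τ * σ ∈ (funField L t).fixingSubgroup := mul_mem (hle hτ) hσ
  by_cases hx : x ∈ bigIntegers L t
  · have := hτP (σ x) (map_mem_bigIntegers hσ hx)
    rw [Set.mem_ofPred_eq, ← AlgEquiv.mul_apply, inv_mul_cancel, AlgEquiv.one_apply] at this
    exact this.symm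
  · refine iff_of_false (fun hmem => hx ?_)
      (fun hmem => hx (mem_bigIntegers_of_mem_carrierSet hmem))
    have := map_mem_bigIntegers (inv_mem hτσ) (mem_bigIntegers_of_mem_carrierSet hmem)
    rwa [← AlgEquiv.mul_apply, inv_mul_cancel, AlgEquiv.one_apply] at this

/-- As `t - a` generates a prime of `K̄[t]`, every automorphism over `L(t)` agrees on `K̄` with an
element of the decomposition group. -/
theorem exists_geometric_mul_stabilizes (ht : Transcendental K t) (hΩ : IsSepClosure K⟮t⟯ Ω)
    (hL : L ≤ algebraicClosure K Ω) (ha : a ∈ L) (P : Ideal (bigIntegers L t)) [P.IsPrime]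
    (hta : ∀ h : t - a ∈ bigIntegers L t, (⟨t - a, h⟩ : bigIntegers L t) ∈ P) {σ : Ω ≃ₐ[K] Ω}
    (hσ : σ ∈ (funField L t).fixingSubgroup) :
    ∃ τ ∈ (funField (algebraicClosure K Ω) t).fixingSubgroup,
      ∀ x, (τ * σ) x ∈ carrierSet P ↔ x ∈ carrierSet P := by
  refine exists_mul_stabilizes hΩ P (sup_le_sup_right hL _) hσ fun x hx => ?_
  have hσ' := mem_fixingSubgroup_funField.1 (inv_mem hσ)
  by_cases hxB : x ∈ bigIntegers L t
  · let ι : bigIntegers L t →+* bigIntegers L t :=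
      ((σ⁻¹ : Ω ≃ₐ[K] Ω).toRingHom.comp (bigIntegers L t).subtype).codRestrict _ fun x =>
        map_mem_bigIntegers (inv_mem hσ) x.2
    have : (P.comap ι).IsPrime := Ideal.comap_isPrime ι P
    have key := mem_iff_mem_of_mem_sup ht (show IsIntegral K a from hL ha).isAlgebraic
      (P.comap ι) P (fun h => by
        rw [Ideal.mem_comap]
        convert hta h using 1
        refine Subtype.ext ?_
        change σ⁻¹ (t - a) = t - a
        rw [map_sub, hσ'.2, hσ'.1 a ha]) hta ⟨x, hxB⟩ hx
    exact (coe_mem_carrierSet (ι ⟨x, hxB⟩)).trans (key.trans (coe_mem_carrierSet ⟨x, hxB⟩).symm)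
  · refine iff_of_false (fun hmem => hxB ?_)
      (fun hmem => hxB (mem_bigIntegers_of_mem_carrierSet hmem))
    have := map_mem_bigIntegers hσ (mem_bigIntegers_of_mem_carrierSet hmem)
    rwa [← AlgEquiv.mul_apply, mul_inv_cancel, AlgEquiv.one_apply] at this

/-- Automorphisms over `L(t)` that agree on the backward orbit of `t` stabilize the same ideals
of the integral closure in `L(f^{-∞}(t))`. -/
theorem stabilizes_congr (α : Ideal (integers f L t)) {σ τ : Ω ≃ₐ[K] Ω}
    (hσ : σ ∈ (funField L t).fixingSubgroup) (hτ : τ ∈ (funField L t).fixingSubgroup)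
    (h : ∀ x ∈ backwardOrbit f t, σ x = τ x)
    (hs : ∀ x, σ x ∈ idealSet f α ↔ x ∈ idealSet f α) (x : Ω) :
    τ x ∈ idealSet f α ↔ x ∈ idealSet f α := by
  by_cases hx : x ∈ orbitField f (funField L t) t
  · rw [← eq_on_orbitField f hσ hτ h hx, hs]
  · exact iff_of_false (fun hmem => hx ((map_mem_orbitField f hτ).1 (idealSet_subset f hmem)))
      (fun hmem => hx (idealSet_subset f hmem))

theorem mem_decompositionGroup_iff {α : Ideal (integers f L t)} {g : IMG f L t} :
    g ∈ decompositionGroup f L t α ↔ ∀ x : orbitField f (funField L t) t,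
      ((g x : orbitField f (funField L t) t) : Ω) ∈ idealSet f α ↔ (x : Ω) ∈ idealSet f α := by
  have himg : ∀ x : orbitField f (funField L t) t,
      x ∈ (fun x : integers f L t => (x : orbitField f (funField L t) t)) ''
        (α : Set (integers f L t)) ↔ (x : Ω) ∈ idealSet f α := by
    intro x
    constructor
    · rintro ⟨y, hy, rfl⟩
      exact ⟨y, hy, rfl⟩
    · rintro ⟨y, hy, hyx⟩
      exact ⟨y, hy, Subtype.ext hyx⟩
  rw [decompositionGroup, MulAction.mem_stabilizer_set]
  refine forall_congr' fun x => ?_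
  rw [himg, himg, AlgEquiv.smul_def]

theorem coe_incl (x : orbitField f (funField (⊥ : IntermediateField K Ω) t) t) :
    ((incl f L t x : orbitField f (funField L t) t) : Ω) = x := by
  rw [incl]

theorem mem_specialization_iff {α : Ideal (integers f L t)} {g : arithIMG f t} :
    g ∈ specialization f L t α ↔ ∃ h ∈ decompositionGroup f L t α,
      ∀ x : orbitField f (funField (⊥ : IntermediateField K Ω) t) t,
        ((h (incl f L t x) : orbitField f (funField L t) t) : Ω) =
          (g x : orbitField f (funField (⊥ : IntermediateField K Ω) t) t) := by
  have h1 : g ∈ specialization f L t α ↔ ∃ h ∈ decompositionGroup f L t α,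
      ∀ x, h (incl f L t x) = incl f L t (g x) := Iff.rfl
  have h2 : ∀ (h : IMG f L t) (x : orbitField f (funField (⊥ : IntermediateField K Ω) t) t),
      h (incl f L t x) = incl f L t (g x) ↔
        ((h (incl f L t x) : orbitField f (funField L t) t) : Ω) =
          (g x : orbitField f (funField (⊥ : IntermediateField K Ω) t) t) := fun h x => by
    rw [← coe_incl (L := L), Subtype.ext_iff]
  simp only [h1, h2]

/-- An element of the arithmetic monodromy group induced by `σ` lies in the specialization if and
only if `σ` agrees on the backward orbit of `t` with an automorphism over `L(t)` that
stabilizes `α`. -/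
theorem mem_specialization_iff_of_lift (hΩ : IsSepClosure K⟮t⟯ Ω) {α : Ideal (integers f L t)}
    {g : arithIMG f t} {σ : Ω ≃ₐ[K] Ω}
    (hσ : σ ∈ (funField (⊥ : IntermediateField K Ω) t).fixingSubgroup)
    (hg : ∀ x : orbitField f (funField (⊥ : IntermediateField K Ω) t) t,
      σ (x : Ω) = (g x : orbitField f (funField (⊥ : IntermediateField K Ω) t) t)) :
    g ∈ specialization f L t α ↔
      ∃ δ ∈ (funField L t).fixingSubgroup, (∀ x, δ x ∈ idealSet f α ↔ x ∈ idealSet f α) ∧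
        ∀ x ∈ backwardOrbit f t, δ x = σ x := by
  have hN := normal_orbitField f hΩ L
  rw [mem_specialization_iff]
  constructor
  · rintro ⟨h, hh, hhg⟩
    obtain ⟨δ, hδ, hδh⟩ := exists_lift hΩ (self_mem_funField L t)
      (orbitField f (funField L t) t) h
    rw [mem_decompositionGroup_iff] at hh
    refine ⟨δ, hδ, fun x => ?_, fun x hx => ?_⟩
    · by_cases hx : x ∈ orbitField f (funField L t) t
      · have h1 := hh ⟨x, hx⟩
        rwa [← hδh] at h1
      · exact iff_of_false
          (fun hmem => hx ((map_mem_orbitField f hδ).1 (idealSet_subset f hmem)))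
          (fun hmem => hx (idealSet_subset f hmem))
    · have hx' : x ∈ orbitField f (funField (⊥ : IntermediateField K Ω) t) t :=
        IntermediateField.subset_adjoin _ _ hx
      have h1 := hδh (incl f L t ⟨x, hx'⟩)
      rwa [hhg, ← hg, coe_incl] at h1
  · rintro ⟨δ, hδ, hstab, hδσ⟩
    have hle : funField (⊥ : IntermediateField K Ω) t ≤ funField L t :=
      sup_le_sup_right bot_le _
    obtain ⟨h, hh⟩ := exists_restrict (orbitField f (funField L t) t) hδ
    refine ⟨h, (mem_decompositionGroup_iff f).2 fun x => ?_, fun x => ?_⟩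
    · rw [← hh]
      exact hstab x
    · rw [← hh, ← hg, coe_incl]
      exact eq_on_orbitField f (IntermediateField.fixingSubgroup_le hle hδ) hσ hδσ x.2

/-- The specialization is surjective if and only if each automorphism over `K(t)` agrees on the
backward orbit of `t` with an automorphism over `L(t)` that stabilizes `α`. -/
theorem specialization_eq_top_iff (hΩ : IsSepClosure K⟮t⟯ Ω) (α : Ideal (integers f L t)) :
    specialization f L t α = ⊤ ↔ ∀ σ : Ω ≃ₐ[K] Ω, σ t = t →
      ∃ δ ∈ (funField L t).fixingSubgroup, (∀ x, δ x ∈ idealSet f α ↔ x ∈ idealSet f α) ∧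
        ∀ x ∈ backwardOrbit f t, δ x = σ x := by
  have hN := normal_orbitField f hΩ (⊥ : IntermediateField K Ω)
  rw [Subgroup.eq_top_iff']
  constructor
  · intro h σ hσ
    have hσ' : σ ∈ (funField (⊥ : IntermediateField K Ω) t).fixingSubgroup :=
      mem_fixingSubgroup_funField.2 ⟨fun x hx => by
        obtain ⟨c, rfl⟩ := IntermediateField.mem_bot.1 hx
        exact σ.commutes c, hσ⟩
    obtain ⟨g, hg⟩ := exists_restrict
      (orbitField f (funField (⊥ : IntermediateField K Ω) t) t) hσ'
    exact (mem_specialization_iff_of_lift f hΩ hσ' hg).1 (h g)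
  · intro h g
    obtain ⟨σ, hσ, hσg⟩ := exists_lift hΩ (self_mem_funField (⊥ : IntermediateField K Ω) t)
      (orbitField f (funField (⊥ : IntermediateField K Ω) t) t) g
    exact (mem_specialization_iff_of_lift f hΩ hσ hσg).2
      (h σ (mem_fixingSubgroup_funField.1 hσ).2)

/-- The decomposition group of the prime `P` over `F(t)`. -/
def primeStabilizer (P : Ideal (bigIntegers L t)) (F : IntermediateField K Ω) :
    Subgroup (Ω ≃ₐ[K] Ω) :=
  (funField F t).fixingSubgroup ⊓ MulAction.stabilizer (Ω ≃ₐ[K] Ω) (carrierSet P)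

theorem mem_primeStabilizer {P : Ideal (bigIntegers L t)} {F : IntermediateField K Ω}
    {δ : Ω ≃ₐ[K] Ω} : δ ∈ primeStabilizer P F ↔
      δ ∈ (funField F t).fixingSubgroup ∧ ∀ x, δ x ∈ carrierSet P ↔ x ∈ carrierSet P := by
  rw [primeStabilizer, Subgroup.mem_inf, MulAction.mem_stabilizer_set]
  rfl

/-- The elements of the decomposition group of `P` act trivially on the fibre over `t` if and only
if they act trivially on the fibre over `a`, its reduction. -/
theorem fixes_fiber_iff_of_mem_primeStabilizer (ht : Transcendental K t) (hΩ : IsSepClosure K⟮t⟯ Ω)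
    (hf : IsTamelyRamified f) (hL : L ≤ algebraicClosure K Ω) (haK : IsAlgebraic K a)
    (hpc : ¬ IsPostCritical f a) (P : Ideal (bigIntegers L t)) [P.IsMaximal]
    (hta : ∀ h : t - a ∈ bigIntegers L t, (⟨t - a, h⟩ : bigIntegers L t) ∈ P)
    {F : IntermediateField K Ω} (hLF : L ≤ F) {δ : Ω ≃ₐ[K] Ω} (hδ : δ ∈ primeStabilizer P F)
    (m : ℕ) : (∀ x ∈ fiber f m a, δ x = x) ↔ ∀ x ∈ fiber f m t, δ x = x := by
  have := hΩ.sep_closed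
  obtain ⟨v, hv, hred⟩ := exists_constPlace_of_isMaximal ht hΩ hL haK P hta
  obtain ⟨hδF, hδP⟩ := mem_primeStabilizer.1 hδ
  have hδL : δ ∈ (funField L t).fixingSubgroup :=
    IntermediateField.fixingSubgroup_le (sup_le_sup_right hLF _) hδF
  refine (v.fixes_fiber_iff f hf.1 (wronskian_ne_zero f hf) ht haK hpc hred m δ ?_
    (mem_fixingSubgroup_funField.1 hδF).2).symm
  have key : ∀ σ ∈ (funField L t).fixingSubgroup,
      (∀ x, σ x ∈ carrierSet P ↔ x ∈ carrierSet P) → ∀ x ∈ v.ring, σ x ∈ v.ring := by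
    intro σ hσ hσP x hx
    obtain ⟨r, s, hs, h⟩ := (hv x).1 hx
    refine (hv _).2 ⟨⟨σ r, map_mem_bigIntegers hσ r.2⟩, ⟨σ s, map_mem_bigIntegers hσ s.2⟩, ?_, ?_⟩
    · rwa [← coe_mem_carrierSet, hσP, coe_mem_carrierSet]
    · rw [← map_mul, h]
  intro x
  refine ⟨fun h => ?_, key δ hδL hδP x⟩
  have := key δ⁻¹ (inv_mem hδL) (fun y => by
    rw [← hδP (δ⁻¹ y), ← AlgEquiv.mul_apply, mul_inv_cancel, AlgEquiv.one_apply]) _ h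
  rwa [← AlgEquiv.mul_apply, inv_mul_cancel, AlgEquiv.one_apply] at this

/-- The Galois group of an extension of constants of `F` is a quotient of the decomposition
group of `P`. -/
theorem exists_mem_primeStabilizer (ht : Transcendental K t) (hΩ : IsSepClosure K⟮t⟯ Ω)
    (hL : L ≤ algebraicClosure K Ω) (ha : a ∈ L) (P : Ideal (bigIntegers L t)) [P.IsPrime]
    (hta : ∀ h : t - a ∈ bigIntegers L t, (⟨t - a, h⟩ : bigIntegers L t) ∈ P)
    {F : IntermediateField K Ω} (hLF : L ≤ F) (hF : F ≤ algebraicClosure K Ω) {S : Set Ω}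
    (hS : ∀ x ∈ S, IsAlgebraic K x) [IsGalois F (IntermediateField.adjoin F S)]
    (g : Gal(IntermediateField.adjoin F S/F)) :
    ∃ δ ∈ primeStabilizer P F, ∀ x : IntermediateField.adjoin F S, δ (x : Ω) = g x := by
  obtain ⟨σ, hσ, hσg⟩ := exists_extension_of_isAlgebraic ht hΩ hF hS g
  obtain ⟨τ, hτ, hstab⟩ := exists_geometric_mul_stabilizes ht hΩ hL ha P hta
    (IntermediateField.fixingSubgroup_le (sup_le_sup_right hLF _) hσ)
  have hτF : τ ∈ (funField F t).fixingSubgroup :=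
    IntermediateField.fixingSubgroup_le (sup_le_sup_right hF _) hτ
  refine ⟨τ * σ, mem_primeStabilizer.2 ⟨mul_mem hτF hσ, hstab⟩, fun x => ?_⟩
  rw [AlgEquiv.mul_apply, hσg]
  refine (mem_fixingSubgroup_funField.1 hτ).1 _ ?_
  have : Algebra.IsAlgebraic K F := ⟨fun x =>
    (isAlgebraic_algebraMap_iff (A := Ω) (algebraMap F Ω).injective).1
      (show IsIntegral K (x : Ω) from hF x.2).isAlgebraic⟩
  have hx : IsIntegral F ((g x : _) : Ω) := adjoin_le_algebraicClosure hS (g x).2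
  exact (hx.isAlgebraic.restrictScalars K).isIntegral

/-- The Galois groups of the fibres over `a` and over `t` are isomorphic if and only if the
decomposition group surjects onto the latter: it surjects onto the former, with the same kernel. -/
theorem nonempty_fiberGal_iff (ht : Transcendental K t) (hΩ : IsSepClosure K⟮t⟯ Ω)
    (hf : IsTamelyRamified f) (hL : L ≤ algebraicClosure K Ω) (ha : a ∈ L)
    (hpc : ¬ IsPostCritical f a) (P : Ideal (bigIntegers L t)) [P.IsMaximal]
    (hta : ∀ h : t - a ∈ bigIntegers L t, (⟨t - a, h⟩ : bigIntegers L t) ∈ P)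
    {C F : IntermediateField K Ω} (hLF : L ≤ F) (hCF : C ≤ F) (hF : F ≤ algebraicClosure K Ω)
    (m : ℕ) :
    Nonempty (fiberGal f F m a ≃* fiberGal f (funField C t) m t) ↔
      ∀ σ ∈ (funField C t).fixingSubgroup,
        ∃ δ ∈ primeStabilizer P F, ∀ x ∈ fiber f m t, δ x = σ x := by
  have haK : IsAlgebraic K a := (show IsIntegral K a from hL ha).isAlgebraic
  have hS : ∀ x ∈ fiber f m a, IsAlgebraic K x := fun x hx =>
    isAlgebraic_of_mem_fiber f hf.1 haK m hx
  have hG : IsGalois F (fiberField f F m a) := isGalois_adjoin_of_isAlgebraic ht hΩ hF hS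
    fun σ hσ => map_mem_fiber_of_fixed f
      ((IntermediateField.mem_fixingSubgroup_iff _ _).1 hσ a (hLF ha))
  have hN : Normal F (fiberField f F m a) := hG.to_normal
  have hN' : Normal (funField C t) (fiberField f (funField C t) m t) :=
    normal_adjoin hΩ (self_mem_funField _ t) fun σ hσ => map_mem_fiber_of_fixed f hσ
  have hGal := isGalois_of_mem hΩ (self_mem_funField C t)
  have : FiniteDimensional (funField C t) (fiberField f (funField C t) m t) := by
    have : Finite (fiber f m t) := finite_fiber f hf.1 m t
    exact IntermediateField.finiteDimensional_adjoin fun x _ => Algebra.IsIntegral.isIntegral x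
  exact nonempty_gal_adjoin_iff (primeStabilizer P F)
    (fun δ hδ => IntermediateField.fixingSubgroup_le (le_sup_left : F ≤ funField F t)
      (mem_primeStabilizer.1 hδ).1)
    (fun δ hδ => IntermediateField.fixingSubgroup_le (sup_le_sup_right hCF _)
      (mem_primeStabilizer.1 hδ).1)
    (exists_lift hΩ (self_mem_funField C t) _)
    (exists_mem_primeStabilizer ht hΩ hL ha P hta hLF hF hS)
    fun δ hδ => fixes_fiber_iff_of_mem_primeStabilizer f ht hΩ hf hL haK hpc P hta hLF hδ m

/-! ### Surjectivity of the specialization -/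

/-- If every automorphism over `K(t)` agrees on the backward orbit with one over `L(t)`, then the
elements of `L ∩ K̂_f` are fixed by the absolute Galois group of `K(t)`. -/
theorem inf_constField_eq_bot_of_forall (ht : Transcendental K t) (hΩ : IsSepClosure K⟮t⟯ Ω)
    (h : ∀ σ : Ω ≃ₐ[K] Ω, σ t = t →
      ∃ δ ∈ (funField L t).fixingSubgroup, ∀ x ∈ backwardOrbit f t, δ x = σ x) :
    L ⊓ constField f t = ⊥ := by
  refine le_bot_iff.1 fun x hx => ?_
  refine mem_bot_of_mem_adjoin ht (mem_of_forall_fixed hΩ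
    (IntermediateField.mem_adjoin_simple_self K t) fun σ hσ => ?_)
    (show IsIntegral K x from hx.2.1).isAlgebraic
  obtain ⟨δ, hδ, hδσ⟩ := h σ ((IntermediateField.mem_fixingSubgroup_iff _ _).1 hσ t
    (IntermediateField.mem_adjoin_simple_self K t))
  rw [← eq_on_adjoin_of_eq_on hδσ hx.2.2]
  exact (mem_fixingSubgroup_funField.1 hδ).1 x hx.1

/-- If the specialization is surjective, then the decomposition group of `P` over `L K̂_f(t)`
induces all automorphisms of the backward orbit over `K̂_f(t)`: an automorphism that stabilizes `α` is moved
into the decomposition group of `P` by one that is trivial on `L(f^{-∞}(t))`. -/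
theorem exists_primeStabilizer_of_forall (hΩ : IsSepClosure K⟮t⟯ Ω) {α : Ideal (integers f L t)}
    (P : Ideal (bigIntegers L t)) [P.IsPrime]
    (hP : ∀ x, x ∈ idealSet f α ↔ x ∈ orbitField f (funField L t) t ∧ x ∈ carrierSet P)
    (h : ∀ σ : Ω ≃ₐ[K] Ω, σ t = t →
      ∃ δ ∈ (funField L t).fixingSubgroup, (∀ x, δ x ∈ idealSet f α ↔ x ∈ idealSet f α) ∧
        ∀ x ∈ backwardOrbit f t, δ x = σ x)
    {σ : Ω ≃ₐ[K] Ω} (hσ : σ ∈ (funField (constField f t) t).fixingSubgroup) :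
    ∃ δ ∈ primeStabilizer P (L ⊔ constField f t), ∀ x ∈ backwardOrbit f t, δ x = σ x := by
  obtain ⟨hσK, hσt⟩ := mem_fixingSubgroup_funField.1 hσ
  obtain ⟨δ, hδ, hδα, hδσ⟩ := h σ hσt
  obtain ⟨τ, hτ, hstab⟩ := exists_mul_stabilizes hΩ P
    (F := (orbitField f (funField L t) t).restrictScalars K)
    (fun x hx => IntermediateField.algebraMap_mem _ (⟨x, hx⟩ : funField L t)) hδ (by
      intro x hx
      have hx : x ∈ orbitField f (funField L t) t := hx
      have h1 := hδα (δ⁻¹ x)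
      rw [← AlgEquiv.mul_apply, mul_inv_cancel, AlgEquiv.one_apply, hP, hP,
        map_mem_orbitField f (inv_mem hδ)] at h1
      tauto)
  rw [IntermediateField.mem_fixingSubgroup_iff] at hτ
  have hτ' : ∀ x ∈ orbitField f (funField L t) t, τ x = x := hτ
  have horb : ∀ x ∈ backwardOrbit f t, (τ * δ) x = σ x := fun x hx => by
    rw [AlgEquiv.mul_apply, hδσ x hx]
    exact hτ' _ (IntermediateField.subset_adjoin _ _ (map_mem_backwardOrbit f hσt x hx))
  refine ⟨τ * δ, mem_primeStabilizer.2 ⟨mem_fixingSubgroup_funField.2 ⟨fun x hx => ?_, ?_⟩, hstab⟩,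
    horb⟩
  · have hle : L ⊔ constField f t ≤ IntermediateField.fixedField (Subgroup.zpowers (τ * δ)) := by
      have hL : (τ * δ) ∈ L.fixingSubgroup := by
        rw [IntermediateField.mem_fixingSubgroup_iff]
        intro x hx
        rw [AlgEquiv.mul_apply, (mem_fixingSubgroup_funField.1 hδ).1 x hx]
        exact hτ' x (IntermediateField.algebraMap_mem _
          (⟨x, (le_sup_left : L ≤ funField L t) hx⟩ : funField L t))
      have hC : (τ * δ) ∈ (constField f t).fixingSubgroup := by
        rw [IntermediateField.mem_fixingSubgroup_iff]
        intro x hx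
        rw [eq_on_adjoin_of_eq_on horb hx.2, hσK x hx]
      refine (IntermediateField.le_iff_le _ _).2 ?_
      rw [Subgroup.zpowers_le, IntermediateField.fixingSubgroup_sup]
      exact ⟨hL, hC⟩
    exact (IntermediateField.mem_fixedField_iff _ _).1 (hle hx) _ (Subgroup.mem_zpowers _)
  · rw [horb t (self_mem_backwardOrbit f), hσt]

/-- The Frattini argument: if modulo an open subgroup inside the Frattini subgroup the
decomposition group is everything, then each element of the geometric monodromy group stabilizes
`α`. -/
theorem stabilizes_of_geometric (ht : Transcendental K t) (hΩ : IsSepClosure K⟮t⟯ Ω)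
    (hL : L ≤ algebraicClosure K Ω) {α : Ideal (integers f L t)} (P : Ideal (bigIntegers L t))
    (hP : ∀ x, x ∈ idealSet f α ↔ x ∈ orbitField f (funField L t) t ∧ x ∈ carrierSet P) (m : ℕ)
    (hm : ∀ g : geomIMG f t,
      (∀ x : orbitField f (funField (algebraicClosure K Ω) t) t, (x : Ω) ∈ fiber f m t → g x = x) →
      g ∈ profiniteFrattini (geomIMG f t))
    (h : ∀ σ ∈ (funField (constField f t) t).fixingSubgroup,
      ∃ δ ∈ primeStabilizer P (L ⊔ constField f t), ∀ x ∈ fiber f m t, δ x = σ x)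
    {σ : Ω ≃ₐ[K] Ω} (hσ : σ ∈ (funField (algebraicClosure K Ω) t).fixingSubgroup) (x : Ω) :
    σ x ∈ idealSet f α ↔ x ∈ idealSet f α := by
  have hN := normal_orbitField f hΩ (algebraicClosure K Ω)
  have hGal := isGalois_of_mem hΩ (self_mem_funField (algebraicClosure K Ω) t)
  have hKL : ∀ {σ : Ω ≃ₐ[K] Ω}, σ ∈ (funField (algebraicClosure K Ω) t).fixingSubgroup →
      σ ∈ (funField L t).fixingSubgroup := fun h =>
    IntermediateField.fixingSubgroup_le (sup_le_sup_right hL _) h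
  have : IsGalois (funField (algebraicClosure K Ω) t)
      (orbitField f (funField (algebraicClosure K Ω) t) t) := ⟨⟩
  have horb : ∀ {y : Ω}, y ∈ orbitField f (funField L t) t →
      y ∈ orbitField f (funField (algebraicClosure K Ω) t) t := by
    intro y hy
    induction hy using IntermediateField.adjoin_induction with
    | mem y hy => exact IntermediateField.subset_adjoin _ _ hy
    | algebraMap y =>
      exact IntermediateField.algebraMap_mem _
        (⟨y, (sup_le_sup_right hL _ : funField L t ≤ funField (algebraicClosure K Ω) t) y.2⟩ :
          funField (algebraicClosure K Ω) t)
    | add y z _ _ hy hz => exact add_mem hy hz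
    | inv y _ hy => exact inv_mem hy
    | mul y z _ _ hy hz => exact mul_mem hy hz
  let S : Set (orbitField f (funField (algebraicClosure K Ω) t) t) := Subtype.val ⁻¹' idealSet f α
  let D : Subgroup (geomIMG f t) := MulAction.stabilizer (geomIMG f t) S
  have hD : ∀ σ (hσ : σ ∈ (funField (algebraicClosure K Ω) t).fixingSubgroup),
      resHom _ (orbitField f (funField (algebraicClosure K Ω) t) t) ⟨σ, hσ⟩ ∈ D ↔
        ∀ x, σ x ∈ idealSet f α ↔ x ∈ idealSet f α := by
    intro σ hσ
    have key : ∀ y : orbitField f (funField (algebraicClosure K Ω) t) t,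
        (resHom _ (orbitField f (funField (algebraicClosure K Ω) t) t) ⟨σ, hσ⟩ • y ∈ S ↔ y ∈ S) ↔
          (σ (y : Ω) ∈ idealSet f α ↔ (y : Ω) ∈ idealSet f α) := by
      intro y
      rw [Set.mem_preimage, Set.mem_preimage, AlgEquiv.smul_def, coe_resHom]
    rw [MulAction.mem_stabilizer_set]
    refine ⟨fun h y => ?_, fun h y => (key y).2 (h y)⟩
    by_cases hy : y ∈ orbitField f (funField L t) t
    · exact (key ⟨y, horb hy⟩).1 (h ⟨y, horb hy⟩)
    · exact iff_of_false
        (fun hmem => hy ((map_mem_orbitField f (hKL hσ)).1 (idealSet_subset f hmem)))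
        (fun hmem => hy (idealSet_subset f hmem))
  have htop : D = ⊤ := by
    refine eq_top_of_sup_profiniteFrattini D (isClosed_stabilizer_set S) (top_le_iff.1 ?_)
    intro g _
    obtain ⟨⟨σ, hσ⟩, rfl⟩ := resHom_surjective hΩ (self_mem_funField (algebraicClosure K Ω) t)
      (orbitField f (funField (algebraicClosure K Ω) t) t) g
    obtain ⟨δ, hδ, hδσ⟩ := h σ (IntermediateField.fixingSubgroup_le
      (sup_le_sup_right (constField_le_algebraicClosure f) _) hσ)
    obtain ⟨hδF, hδP⟩ := mem_primeStabilizer.1 hδ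
    have hδL : δ ∈ (funField L t).fixingSubgroup :=
      IntermediateField.fixingSubgroup_le (sup_le_sup_right le_sup_left _) hδF
    obtain ⟨δ', hδ', hδδ'⟩ := exists_geometric f ht hΩ
      (IntermediateField.fixingSubgroup_le (sup_le_sup_right le_sup_right _) hδF)
    have h1 : resHom _ (orbitField f (funField (algebraicClosure K Ω) t) t) ⟨δ', hδ'⟩ ∈ D := by
      rw [hD]
      refine stabilizes_congr f α hδL (hKL hδ') (fun x hx => (hδδ' x hx).symm) fun x => ?_
      rw [hP, hP, map_mem_orbitField f hδL, hδP]
    rw [← mul_inv_cancel_left (resHom _ (orbitField f (funField (algebraicClosure K Ω) t) t)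
      ⟨δ', hδ'⟩) (resHom _ (orbitField f (funField (algebraicClosure K Ω) t) t) ⟨σ, hσ⟩)]
    refine mul_mem (Subgroup.mem_sup_left h1) (Subgroup.mem_sup_right (hm _ fun x hx => ?_))
    rw [← map_inv, ← map_mul]
    refine Subtype.ext ?_
    rw [coe_resHom]
    change δ'.symm (σ (x : Ω)) = x
    rw [AlgEquiv.symm_apply_eq, hδδ' _ (fiber_subset_backwardOrbit f m hx), hδσ _ hx]
  exact (hD σ hσ).1 (htop ▸ Subgroup.mem_top _) x

/-- If the geometric monodromy group stabilizes `α` and `L ∩ K̂_f = K`, then the specialization is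
surjective: the action of `σ` on `K̂_f` is realized over `L(t)` by an element of the decomposition
group, which differs from `σ` by a geometric automorphism. -/
theorem forall_exists_of_stabilizes (ht : Transcendental K t) (hΩ : IsSepClosure K⟮t⟯ Ω)
    (hL : L ≤ algebraicClosure K Ω) (ha : a ∈ L) {α : Ideal (integers f L t)}
    (P : Ideal (bigIntegers L t)) [P.IsPrime]
    (hta : ∀ h : t - a ∈ bigIntegers L t, (⟨t - a, h⟩ : bigIntegers L t) ∈ P)
    (hP : ∀ x, x ∈ idealSet f α ↔ x ∈ orbitField f (funField L t) t ∧ x ∈ carrierSet P)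
    (hinf : L ⊓ constField f t = ⊥)
    (h : ∀ σ ∈ (funField (algebraicClosure K Ω) t).fixingSubgroup, ∀ x,
      σ x ∈ idealSet f α ↔ x ∈ idealSet f α) (σ : Ω ≃ₐ[K] Ω) (hσ : σ t = t) :
    ∃ δ ∈ (funField L t).fixingSubgroup, (∀ x, δ x ∈ idealSet f α ↔ x ∈ idealSet f α) ∧
      ∀ x ∈ backwardOrbit f t, δ x = σ x := by
  have := isGalois_constField f ht hΩ
  have hC := constField_le_algebraicClosure (K := K) (Ω := Ω) f (t := t)
  have hcomm : ∀ x : constField f t,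
      ((σ.restrictNormal (constField f t) x : constField f t) : Ω) = σ (x : Ω) := fun x =>
    AlgEquiv.restrictNormal_commutes σ (constField f t) x
  -- extend the action of `σ` on the constant field to an automorphism over `L(t)`
  obtain ⟨τ, hτ, hτσ⟩ := exists_extension hΩ (constField f t) (M := funField L t)
    (self_mem_funField L t) (σ.restrictNormal (constField f t)) (fun x hx => Subtype.ext (by
      have hxL : (x : Ω) ∈ L := mem_of_mem_sup_of_isAlgebraic ht hL hx
        (show IsIntegral K (x : Ω) from hC x.2).isAlgebraic
      have hbot : (x : Ω) ∈ L ⊓ constField f t := ⟨hxL, x.2⟩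
      rw [hinf] at hbot
      obtain ⟨c, hc⟩ := IntermediateField.mem_bot.1 hbot
      rw [hcomm, ← hc, AlgEquiv.commutes]))
  obtain ⟨ρ, hρ, hstab⟩ := exists_geometric_mul_stabilizes ht hΩ hL ha P hta hτ
  have hρL : ρ ∈ (funField L t).fixingSubgroup :=
    IntermediateField.fixingSubgroup_le (sup_le_sup_right hL _) hρ
  have hδ : ρ * τ ∈ (funField L t).fixingSubgroup := mul_mem hρL hτ
  -- correct it by a geometric automorphism
  have hmem : (ρ * τ)⁻¹ * σ ∈ (funField (constField f t) t).fixingSubgroup := by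
    refine mem_fixingSubgroup_funField.2 ⟨fun x hx => ?_, ?_⟩
    · change (ρ * τ).symm (σ x) = x
      rw [AlgEquiv.symm_apply_eq, AlgEquiv.mul_apply, hτσ ⟨x, hx⟩, hcomm]
      exact ((mem_fixingSubgroup_funField.1 hρ).1 _ (map_mem_algebraicClosure σ (hC hx))).symm
    · change (ρ * τ).symm (σ t) = t
      rw [hσ, AlgEquiv.symm_apply_eq, (mem_fixingSubgroup_funField.1 hδ).2]
  obtain ⟨σ', hσ', hσσ'⟩ := exists_geometric f ht hΩ hmem
  refine ⟨ρ * τ * σ', mul_mem hδ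
    (IntermediateField.fixingSubgroup_le (sup_le_sup_right hL _) hσ'), fun x => ?_, fun x hx => ?_⟩
  · rw [← h σ' hσ' x, AlgEquiv.mul_apply, hP, hP, map_mem_orbitField f hδ, hstab]
  · rw [AlgEquiv.mul_apply, hσσ' x hx, ← AlgEquiv.mul_apply, mul_inv_cancel_left]

end Decomposition

end PfIMG

end

theorem mainTheorem7 {K : Type*} [Field K] {Ω : Type*} [Field Ω] [Algebra K Ω]
    (t : Ω) (ht : Transcendental K t) (hΩ : IsSepClosure K⟮t⟯ Ω)
    (f : RatFunc K) (hf : PfIMG.IsTamelyRamified f)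
    (hΦ : IsOpen (PfIMG.profiniteFrattini (PfIMG.geomIMG f t) : Set (PfIMG.geomIMG f t))) :
    (∃ m : ℕ, ∀ (L : IntermediateField K Ω), L ≤ algebraicClosure K Ω →
      ∀ a ∈ L, ¬ PfIMG.IsPostCritical f a →
      ∀ α : Ideal (PfIMG.integers f L t), PfIMG.IsMaximalOver f L t a α →
        (PfIMG.specialization f L t α = ⊤ ↔
          Nonempty (PfIMG.fiberGal f (L ⊔ PfIMG.constField f t) m a ≃*
            PfIMG.fiberGal f (PfIMG.funField (PfIMG.constField f t) t) m t) ∧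
          L.LinearDisjoint (PfIMG.constField f t))) ∧
    (⊥ : IntermediateField K Ω).LinearDisjoint (PfIMG.constField f t) := by
  have := hΩ.sep_closed
  obtain ⟨m, hm⟩ := PfIMG.exists_fiber_fixing_le f ht hf _ _ hΦ
  refine ⟨⟨m, fun L hL a ha hpc α hα => ?_⟩, IntermediateField.LinearDisjoint.bot_left _ _ _⟩
  obtain ⟨P, hmax, hta, hP⟩ := PfIMG.exists_isMaximal_over f hα
  have := PfIMG.isGalois_constField f ht hΩ
  rw [PfIMG.specialization_eq_top_iff f hΩ,
    PfIMG.nonempty_fiberGal_iff f ht hΩ hf hL ha hpc P hta le_sup_left le_sup_right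
      (sup_le hL (PfIMG.constField_le_algebraicClosure f)) m]
  constructor
  · intro h
    refine ⟨fun σ hσ => ?_, PfIMG.linearDisjoint_of_inf_eq_bot L _ hL
      (PfIMG.inf_constField_eq_bot_of_forall f ht hΩ fun σ hσ => ?_)⟩
    · obtain ⟨δ, hδ, hδσ⟩ := PfIMG.exists_primeStabilizer_of_forall f hΩ P hP h hσ
      exact ⟨δ, hδ, fun x hx => hδσ x (PfIMG.fiber_subset_backwardOrbit f m hx)⟩
    · obtain ⟨δ, hδ, -, hδσ⟩ := h σ hσ
      exact ⟨δ, hδ, hδσ⟩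
  · rintro ⟨h, hdis⟩
    exact PfIMG.forall_exists_of_stabilizes f ht hΩ hL ha P hta hP hdis.inf_eq_bot
      fun σ hσ => PfIMG.stabilizes_of_geometric f ht hΩ hL P hP m hm h hσ
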